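/- Let $n\ge 0$ and $d\ge 1$, put $m=n+2d+1$, and label the vertices of the cyclic polytope $C(m,2d)=\mathrm{conv}\{p_{t_1},\dots,p_{t_m}\}\subset\mathbb R^{2d}$, where $t_1<\dots<t_m$ and $p_t=(t,t^2,\dots,t^{2d})$, by $\mathbb Z/m$ (in the order of the $t_j$). For a set $S$ of labels let $|S|$ be the convex hull of the corresponding vertices. A triangulation $\mathcal T$ of $C(m,2d)$ is a collection of $(2d+1)$-element sets of labels whose realizations $|S|$ have pairwise disjoint interiors and have union $C(m,2d)$. A $d$-arc of $\mathcal T$ is a $(d+1)$-element subset $A$ of some member of $\mathcal T$ such that $|A|$ does not lie within a facet of $C(m,2d)$. Two triangulations $\mathcal T,\mathcal T'$ are bistellar flips of each other if there are $2d+2$ vertices $Z$ such that the members of $\mathcal T$ contained in $Z$ and the members of $\mathcal T'$ contained in $Z$ form two different triangulations of the subpolytope $|Z|$, while $\mathcal T$ and $\mathcal T'$ have the same members not contained in $Z$. A $d$-arc $A$ of $\mathcal T$ is mutable if there are a bistellar flip $\mathcal T'$ of $\mathcal T$ and a $d$-arc $B$ of $\mathcal T'$ such that the $d$-arcs of $\mathcal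 T$ other than $A$ are exactly the $d$-arcs of $\mathcal T'$ other than $B$. A tuple of labels is a cyclic ordering if it is strictly increasing for the order $l<l+1<\dots<l-1$ on $\mathbb Z/m$ for some $l$. Subsets of $\mathbb Z/m$ of size $d+1$ are written as cyclically ordered tuples $(a_0,\dots,a_d)$, up to cyclic rotation; indices of entries are read modulo $d+1$, and entries modulo $m$. Two such sets $A,B$ are intertwining, $A\wr B$, if they can be listed such that $a_0<b_0<a_1<b_1<\dots<a_d<b_d$ is a cyclic ordering. The quiver $Q(\mathcal T)$ has the $d$-arcs of $\mathcal T$ as vertices, and an arrow $A\to B$ whenever $A\ne B$, $(A-\mathbf 1)\wr B$ with $A-\mathbf 1=(a_0-1,\dots,a_d-1)$, and there is no $d$-arc $A'\ne A,B$ of $\mathcal T$ with $(A-\mathbf 1)\wr A'$ and $(A'-\mathbf 1)\wr B$. Let $E_i$ be the $i$-th unit vector. A path $A\to A+rE_i\to A+rE_i+sE_{i-1}$ in $Q(\mathcal T)$ is retrograde at $A+rE_i$ if $a_{i-1}<a_{i-1}+s<a_i$ is a cyclic ordering. A path $A_0\to A_1\to\dots\to A_{l+1}$ ($l\ge 0$)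 is retrograde if, for every $1\le i\le l$, the path $A_{i-1}\to A_i\to A_{i+1}$ is retrograde at $A_i$; the vertices $A_1,\dots,A_l$ are said to be in its middle. A retrograde path is maximal if it is not contained (as a contiguous subpath) in a longer retrograde path. Theorem. For every triangulation $\mathcal T$ of $C(n+2d+1,2d)$, a $d$-arc of $\mathcal T$ is mutable if and only if it is not in the middle of a maximal retrograde path in $Q(\mathcal T)$. -/

import Mathlib

namespace CyclicPolytope

/-! ## Geometry: cyclic polytopes, triangulations, facets, bistellar flips

The vertices of the cyclic polytope with `m` vertices are labelled by `Fin m`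
(i.e. by residues modulo `m`); `t : Fin m → ℝ` is the increasing list of parameters
chosen on the moment curve. -/

/-- The moment curve `x ↦ (x, x², …, x^δ)` in `ℝ^δ`. -/
def momentCurve (δ : ℕ) (x : ℝ) : Fin δ → ℝ := fun k => x ^ ((k : ℕ) + 1)

/-- The geometric realisation `|S|`: the convex hull of the points of the moment curve that are
labelled by the elements of `S`. -/
def realization (δ : ℕ) {m : ℕ} (t : Fin m → ℝ) (S : Finset (Fin m)) : Set (Fin δ → ℝ) :=
  convexHull ℝ ((fun v => momentCurve δ (t v)) '' (S : Set (Fin m)))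

/-- The cyclic polytope `C(m, δ)`, realised with the parameters `t`. -/
def polytope (δ : ℕ) {m : ℕ} (t : Fin m → ℝ) : Set (Fin δ → ℝ) :=
  realization δ t Finset.univ

/-- `T` is a triangulation of the cyclic polytope with vertex set `Z`: a collection of
`δ`-simplices on vertices of `Z` whose interiors are pairwise disjoint and whose union is the
whole polytope `|Z|`. -/
def IsTriangulationOn (δ : ℕ) {m : ℕ} (t : Fin m → ℝ) (Z : Finset (Fin m))
    (T : Finset (Finset (Fin m))) : Prop :=
  (∀ S ∈ T, S ⊆ Z ∧ S.card = δ + 1) ∧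
  (∀ S ∈ T, ∀ S' ∈ T, S ≠ S' →
    Disjoint (interior (realization δ t S)) (interior (realization δ t S'))) ∧
  (⋃ S ∈ T, realization δ t S) = realization δ t Z

/-- `T` is a triangulation of the cyclic polytope `C(m, δ)`. -/
def IsTriangulation (δ : ℕ) {m : ℕ} (t : Fin m → ℝ) (T : Finset (Finset (Fin m))) : Prop :=
  IsTriangulationOn δ t Finset.univ T

/-- `F` is a facet of the polytope `P` in `ℝ^δ`: a face of codimension one. -/
def IsFacet {δ : ℕ} (P F : Set (Fin δ → ℝ)) : Prop :=
  IsExposed ℝ P F ∧ Module.finrank ℝ (vectorSpan ℝ F) + 1 = δ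

/-- The triangulations `T` and `T'` of `C(m, δ)` are bistellar flips of each other: there are
`δ + 2` vertices, forming a subpolytope `C(δ + 2, δ)`, such that both `T` and `T'` restrict to
triangulations of this subpolytope, these two restrictions are different, and outside of the
subpolytope `T` and `T'` consist of the same simplices. -/
def IsBistellarFlip (δ : ℕ) {m : ℕ} (t : Fin m → ℝ) (T T' : Finset (Finset (Fin m))) : Prop :=
  IsTriangulation δ t T ∧ IsTriangulation δ t T' ∧
  ∃ Z : Finset (Fin m), Z.card = δ + 2 ∧
    IsTriangulationOn δ t Z (T.filter (fun S => S ⊆ Z)) ∧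
    IsTriangulationOn δ t Z (T'.filter (fun S => S ⊆ Z)) ∧
    T.filter (fun S => S ⊆ Z) ≠ T'.filter (fun S => S ⊆ Z) ∧
    T.filter (fun S => ¬ S ⊆ Z) = T'.filter (fun S => ¬ S ⊆ Z)

/-- The `d`-arcs of a triangulation `T` of `C(m, 2d)`: the `d`-simplices of `T` (the `d`-dimensional
faces of its members) that are internal, i.e. do not lie within a facet of `C(m, 2d)`. -/
def dArcs (d : ℕ) {m : ℕ} (t : Fin m → ℝ) (T : Finset (Finset (Fin m))) :
    Set (Finset (Fin m)) :=
  {A | A.card = d + 1 ∧ (∃ S ∈ T, A ⊆ S) ∧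
    ¬ ∃ F, IsFacet (polytope (2 * d) t) F ∧ realization (2 * d) t A ⊆ F}

/-- The `d`-arc `A` of `T` is mutable: there is a bistellar flip `T'` of `T` that exchanges `A`
for some `d`-arc `B` of `T'` and keeps all the other `d`-arcs. -/
def IsMutable (d : ℕ) {m : ℕ} (t : Fin m → ℝ) (T : Finset (Finset (Fin m)))
    (A : Finset (Fin m)) : Prop :=
  A ∈ dArcs d t T ∧ ∃ T', IsBistellarFlip (2 * d) t T T' ∧
    ∃ B ∈ dArcs d t T', dArcs d t T \ {A} = dArcs d t T' \ {B}

/-! ## Combinatorics: the quiver of a triangulation and retrograde paths -/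

/-- `(a₀, …, a_{k-1})` is cyclically ordered: it is increasing for the order
`l < l + 1 < ⋯ < l - 1` on residues modulo `m`, for some `l`. -/
def IsCyclicallyOrdered {m k : ℕ} [NeZero m] (a : Fin k → Fin m) : Prop :=
  ∃ l : Fin m, StrictMono fun j => a j - l

/-- The cyclically ordered tuple `a` lists the elements of the simplex `A`. -/
def IsListing {m k : ℕ} [NeZero m] (a : Fin k → Fin m) (A : Finset (Fin m)) : Prop :=
  IsCyclicallyOrdered a ∧ Finset.univ.image a = A

/-- The `d`-simplices `A` and `B` are intertwining: their elements can be listed such that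
`a₀ < b₀ < a₁ < b₁ < ⋯ < a_d < b_d` is a cyclic ordering. -/
def Intertwining (d : ℕ) {m : ℕ} [NeZero m] (A B : Finset (Fin m)) : Prop :=
  ∃ a b : Fin (d + 1) → Fin m, Finset.univ.image a = A ∧ Finset.univ.image b = B ∧
    ∃ l : Fin m, (∀ i, a i - l < b i - l) ∧
      ∀ i : Fin d, b i.castSucc - l < a i.succ - l

/-- `A - (1, …, 1)`, computed modulo `m`. -/
def shiftDown {m : ℕ} [NeZero m] (A : Finset (Fin m)) : Finset (Fin m) :=
  A.image fun x => x - 1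

/-- The arrows `A → B` of the quiver `Q(T)`, whose vertices are the `d`-arcs of `T`. -/
def Arrow (d : ℕ) {m : ℕ} [NeZero m] (t : Fin m → ℝ) (T : Finset (Finset (Fin m)))
    (A B : Finset (Fin m)) : Prop :=
  A ∈ dArcs d t T ∧ B ∈ dArcs d t T ∧ A ≠ B ∧ Intertwining d (shiftDown A) B ∧
    ¬ ∃ A' ∈ dArcs d t T, A' ≠ A ∧ A' ≠ B ∧
      Intertwining d (shiftDown A) A' ∧ Intertwining d (shiftDown A') B

/-- `X → Y → Z` is a path in `Q(T)` of the form `A → A + r E_i → A + r E_i + s E_{i-1}` with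
`a_{i-1} < a_{i-1} + s < a_i` a cyclic ordering, i.e. it is retrograde at `Y`. The index `i - 1`
is computed modulo `d + 1`, and entries are computed modulo `m`. -/
def IsRetrogradeAt (d : ℕ) {m : ℕ} [NeZero m] (t : Fin m → ℝ) (T : Finset (Finset (Fin m)))
    (X Y Z : Finset (Fin m)) : Prop :=
  Arrow d t T X Y ∧ Arrow d t T Y Z ∧
    ∃ (a : Fin (d + 1) → Fin m) (i : Fin (d + 1)) (r s : Fin m),
      IsListing a X ∧ IsListing (a + Pi.single i r) Y ∧
      IsListing (a + Pi.single i r + Pi.single (i - 1) s) Z ∧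
      IsCyclicallyOrdered ![a (i - 1), a (i - 1) + s, a i]

/-- `p = [A₀, …, A_{l+1}]` is a retrograde path in `Q(T)`: a path with at least one arrow that is
retrograde at each of `A₁, …, A_l`. -/
def IsRetrogradePath (d : ℕ) {m : ℕ} [NeZero m] (t : Fin m → ℝ) (T : Finset (Finset (Fin m)))
    (p : List (Finset (Fin m))) : Prop :=
  2 ≤ p.length ∧ p.IsChain (Arrow d t T) ∧
    ∀ X Y Z, [X, Y, Z] <:+: p → IsRetrogradeAt d t T X Y Z

/-- A retrograde path is maximal if it is not contained in any longer retrograde path. -/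
def IsMaximalRetrogradePath (d : ℕ) {m : ℕ} [NeZero m] (t : Fin m → ℝ)
    (T : Finset (Finset (Fin m))) (p : List (Finset (Fin m))) : Prop :=
  IsRetrogradePath d t T p ∧
    ∀ q, IsRetrogradePath d t T q → p <:+: q → ¬ p.length < q.length

/-- `A` is in the middle of the path `[A₀, …, A_{l+1}]`: it is one of `A₁, …, A_l`. -/
def InMiddle {m : ℕ} (A : Finset (Fin m)) (p : List (Finset (Fin m))) : Prop :=
  ∃ i, 1 ≤ i ∧ i + 1 < p.length ∧ p[i]? = some A

end CyclicPolytope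

/-! Affine dependences between points of the moment curve in dimension 2d are exactly the weights
that annihilate all polynomials of degree at most 2d, so signs are controlled by choosing test
polynomials. An interlacing pair A, B of (d+1)-sets carries a dependence positive on A and negative
on B (`Interlace.exists_circuit`). Hence |A| and |B| cross, and they cannot both be faces of one
triangulation (`IsTriangulation.not_interlace`).

The polytope |A ∪ B| has exactly two triangulations: omit one vertex of B, or omit one vertex of A.
A flip therefore trades some A for an interlacing B, and A is mutable if and only if some
interlacing B has (A ∪ B) \ {b} in T for all b in B (`IsMutable.exists_interlace`,
`Interlace.isMutable`). The star of an internal A covers all directions at a relatively interior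
point of |A| (`IsTriangulation.exists_star`), so the link of A has a vertex in every gap of A. If no
gap contains two, these vertices form such a B (`isMutable_of_link`).

Suppose the gap between consecutive elements a₀, a₁ of A contains link vertices v before v'. Choose
y as late as possible in the gap with A - a₁ + y a face of T, and x as early as possible with A - a₀
+ x a face. Then x comes before y, and A - a₁ + y → A → A - a₀ + x is retrograde
(`exists_isRetrogradeAt_of_link`).

Conversely, let X → A → Z be retrograde, with X = A - a₁ + x, Z = A - a₀ + p' and a₀ < p' < x < a₁,
and let A be mutable with partner B, where b₀ lies between a₀ and a₁. If p' < b₀, then Z crosses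
{a₀, b₀, …, b_{d-1}}; otherwise X crosses {b₀, a₁, b₂, …, b_d}. Both of these miss an element of B,
so they are faces of T: a contradiction (`IsMutable.not_isRetrogradeAt`).

Finally, every retrograde triple lies in a maximal retrograde path because lengths are bounded: each
step moves the element just before the one moved last, so d + 1 steps would lead to a set crossing
the initial one (`IsRetrogradePath.length_le`). -/

namespace CyclicPolytope

/-! ## Cyclic order on `Fin m` -/

/-- Three natural numbers are in strict cyclic order. -/
def NatCyc (a b c : ℕ) : Prop := (a < b ∧ b < c) ∨ (b < c ∧ c < a) ∨ (c < a ∧ a < b)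

/-- Three labels are in strict cyclic order. -/
def Cyc {m : ℕ} (a b c : Fin m) : Prop := NatCyc a.val b.val c.val

theorem sub_val_eq {m : ℕ} (a l : Fin m) :
    (a - l).val = if l.val ≤ a.val then a.val - l.val else a.val + m - l.val := by
  rw [Fin.sub_def]
  have ha := a.2
  have hl := l.2
  simp only
  split_ifs with h
  · rw [show m - l.val + a.val = (a.val - l.val) + m by omega, Nat.add_mod_right,
      Nat.mod_eq_of_lt (by omega)]
  · rw [Nat.mod_eq_of_lt (by omega)]; omega

/-- Cyclic order is invariant under rotation, so any label can serve as origin and cyclic statements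
become inequalities between natural numbers. -/
theorem natCyc_sub_iff {m : ℕ} (a b c l : Fin m) :
    NatCyc (a - l).val (b - l).val (c - l).val ↔ Cyc a b c := by
  unfold Cyc NatCyc
  rw [sub_val_eq, sub_val_eq, sub_val_eq]
  have ha := a.2
  have hb := b.2
  have hc := c.2
  have hl := l.2
  split_ifs <;> omega

theorem sub_val_inj {m : ℕ} {a b l : Fin m} : (a - l).val = (b - l).val ↔ a = b := by
  rw [Fin.ext_iff, sub_val_eq, sub_val_eq]
  have ha := a.2
  have hb := b.2
  have hl := l.2
  split_ifs <;> omega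

theorem sub_self_val {m : ℕ} (l : Fin m) : (l - l).val = 0 := by
  rw [sub_val_eq]; simp

theorem cyc_sub_self_iff {m : ℕ} (l b c : Fin m) :
    Cyc l b c ↔ 0 < (b - l).val ∧ (b - l).val < (c - l).val := by
  rw [← natCyc_sub_iff l b c l, sub_self_val]
  unfold NatCyc; omega

theorem add_one_val {m : ℕ} [NeZero m] (hm : 1 < m) (x : Fin m) :
    (x + 1).val = if x.val + 1 = m then 0 else x.val + 1 := by
  have hx := x.2
  rw [Fin.val_add, Fin.val_one', Nat.mod_eq_of_lt hm]
  split_ifs with h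
  · rw [h, Nat.mod_self]
  · rw [Nat.mod_eq_of_lt (by omega)]

theorem sub_one_val {m : ℕ} [NeZero m] (hm : 1 < m) (x : Fin m) :
    (x - 1).val = if x.val = 0 then m - 1 else x.val - 1 := by
  have hx := x.2
  rw [sub_val_eq, Fin.val_one', Nat.mod_eq_of_lt hm]
  split_ifs <;> omega

/-! ### Interlacing sets and their listings -/

/-- Every arc between distinct elements of one of the sets contains an element of the other. -/
def Interlace {m : ℕ} (A B : Finset (Fin m)) : Prop :=
  Disjoint A B ∧ (∀ x ∈ A, ∀ x' ∈ A, x ≠ x' → ∃ b ∈ B, Cyc x b x') ∧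
    (∀ y ∈ B, ∀ y' ∈ B, y ≠ y' → ∃ a ∈ A, Cyc y a y')

theorem Interlace.symm {m : ℕ} {A B : Finset (Fin m)} (h : Interlace A B) : Interlace B A :=
  ⟨h.1.symm, h.2.2, h.2.1⟩

/-- The order relations in an alternating listing. -/
theorem alternating_lt {d : ℕ} {α β : Fin (d + 1) → ℕ} (h1 : ∀ i, α i < β i)
    (h2 : ∀ i : Fin d, β i.castSucc < α i.succ) :
    StrictMono α ∧ StrictMono β ∧ ∀ i j, i < j → β i < α j := by
  have hα : StrictMono α := Fin.strictMono_iff_lt_succ.2 fun i => (h1 _).trans (h2 i)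
  have hβ : StrictMono β := Fin.strictMono_iff_lt_succ.2 fun i => (h2 i).trans (h1 _)
  refine ⟨hα, hβ, fun i j hij => ?_⟩
  have hi : i.val < d := by have := j.2; have : i.val < j.val := hij; omega
  have := h2 ⟨i.val, hi⟩
  refine lt_of_lt_of_le this (hα.monotone ?_)
  rw [Fin.le_def]; exact hij

/-- `Interlace` is symmetric and involves neither a listing nor an origin.
`Interlace.exists_listing` recovers an alternating listing from any chosen first element. -/
theorem Intertwining.interlace {d m : ℕ} [NeZero m] {A B : Finset (Fin m)}
    (h : Intertwining d A B) : A.card = d + 1 ∧ B.card = d + 1 ∧ Interlace A B := by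
  obtain ⟨a, b, rfl, rfl, l, h1, h2⟩ := h
  obtain ⟨hα, hβ, hαβ⟩ := alternating_lt (α := fun i => (a i - l).val)
    (β := fun i => (b i - l).val) h1 h2
  have hle : ∀ i j, i ≤ j → (a i - l).val < (b j - l).val := fun i j hij =>
    lt_of_lt_of_le (h1 i) (hβ.monotone hij)
  have ha : Function.Injective a := fun i j hij => hα.injective (by simp [hij])
  have hb : Function.Injective b := fun i j hij => hβ.injective (by simp [hij])
  refine ⟨by simp [Finset.card_image_of_injective _ ha],
    by simp [Finset.card_image_of_injective _ hb], ?_, ?_, ?_⟩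
  · rw [Finset.disjoint_left]
    intro x hx hy
    simp only [Finset.mem_image, Finset.mem_univ, true_and] at hx hy
    obtain ⟨i, rfl⟩ := hx
    obtain ⟨j, hj⟩ := hy
    rcases lt_or_ge j i with hji | hij
    · have := hαβ j i hji
      simp [hj] at this
    · have := hle i j hij
      simp [hj] at this
  · intro x hx x' hx' hne
    simp only [Finset.mem_image, Finset.mem_univ, true_and] at hx hx'
    obtain ⟨i, rfl⟩ := hx
    obtain ⟨j, rfl⟩ := hx'
    refine ⟨b i, by simp, (natCyc_sub_iff _ _ _ l).1 ?_⟩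
    have h3 := hle i i le_rfl
    rcases lt_trichotomy i j with hij | hij | hij
    · exact Or.inl ⟨h3, hαβ i j hij⟩
    · exact absurd (by rw [hij]) hne
    · exact Or.inr (Or.inr ⟨hα hij, h3⟩)
  · intro x hx x' hx' hne
    simp only [Finset.mem_image, Finset.mem_univ, true_and] at hx hx'
    obtain ⟨i, rfl⟩ := hx
    obtain ⟨j, rfl⟩ := hx'
    refine ⟨a j, by simp, (natCyc_sub_iff _ _ _ l).1 ?_⟩
    have h3 := hle j j le_rfl
    rcases lt_trichotomy i j with hij | hij | hij
    · exact Or.inl ⟨hαβ i j hij, h3⟩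
    · exact absurd (by rw [hij]) hne
    · exact Or.inr (Or.inl ⟨h3, hβ hij⟩)

/-- No two elements of `A` are cyclically adjacent. -/
def NonAdj {m : ℕ} [NeZero m] (A : Finset (Fin m)) : Prop := ∀ x ∈ A, x + 1 ∉ A

/-- This gives an internal simplex a partner that does not depend on the triangulation, so that
circuits are available for it. -/
theorem NonAdj.interlace {m : ℕ} [NeZero m] (hm : 1 < m) {A : Finset (Fin m)} (h : NonAdj A) :
    Interlace A (A.image (· + 1)) := by
  refine ⟨?_, ?_, ?_⟩
  · rw [Finset.disjoint_left]
    intro x hx hx'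
    obtain ⟨y, hy, rfl⟩ := Finset.mem_image.1 hx'
    exact h y hy hx
  · intro x hx x' hx' hne
    refine ⟨x + 1, Finset.mem_image_of_mem _ hx, ?_⟩
    have h1 : x + 1 ≠ x' := fun e => h x hx (e ▸ hx')
    rw [Ne, Fin.ext_iff] at h1 hne
    unfold Cyc NatCyc
    rw [add_one_val hm] at *
    have := x.2
    have := x'.2
    split_ifs at * <;> omega
  · intro y hy y' hy' hne
    obtain ⟨x, hx, rfl⟩ := Finset.mem_image.1 hy
    obtain ⟨x', hx', rfl⟩ := Finset.mem_image.1 hy'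
    refine ⟨x', hx', ?_⟩
    have h1 : x + 1 ≠ x' := fun e => h x hx (e ▸ hx')
    simp only [Ne, Fin.ext_iff] at h1 hne
    unfold Cyc NatCyc
    simp only [add_one_val hm] at *
    have := x.2
    have := x'.2
    split_ifs at * <;> omega

theorem card_image_add_one {m : ℕ} [NeZero m] (A : Finset (Fin m)) :
    (A.image (· + 1)).card = A.card :=
  Finset.card_image_of_injective _ (add_left_injective 1)

theorem exists_next {m : ℕ} {A : Finset (Fin m)} {a : Fin m} (hA : (A.erase a).Nonempty) :
    ∃ n ∈ A, n ≠ a ∧ ∀ c ∈ A, ¬ Cyc a c n := by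
  obtain ⟨n, hn, hmin⟩ := Finset.exists_min_image _ (fun x => (x - a).val) hA
  rw [Finset.mem_erase] at hn
  refine ⟨n, hn.2, hn.1, fun c hc h => ?_⟩
  rw [cyc_sub_self_iff] at h
  have hca : c ≠ a := by rintro rfl; rw [sub_self_val] at h; omega
  have := hmin c (Finset.mem_erase.2 ⟨hca, hc⟩)
  omega

theorem exists_nextFun {m : ℕ} {A : Finset (Fin m)} (hA : 2 ≤ A.card) :
    ∃ nx : Fin m → Fin m, ∀ a ∈ A, nx a ∈ A ∧ nx a ≠ a ∧ ∀ c ∈ A, ¬ Cyc a c (nx a) := by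
  have : ∀ a : Fin m, ∃ n, a ∈ A → n ∈ A ∧ n ≠ a ∧ ∀ c ∈ A, ¬ Cyc a c n := by
    intro a
    by_cases ha : a ∈ A
    · have : (A.erase a).Nonempty := by
        rw [← Finset.card_pos, Finset.card_erase_of_mem ha]; omega
      obtain ⟨n, h1, h2⟩ := exists_next this
      exact ⟨n, fun _ => ⟨h1, h2⟩⟩
    · exact ⟨a, fun h => absurd h ha⟩
  choose nx h using this
  exact ⟨nx, h⟩

/-- The arcs following two distinct elements of a set are disjoint. -/
theorem arc_disjoint {m : ℕ} {a a' n n' v : Fin m} (hne : a ≠ a') (h : Cyc a v n)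
    (h' : Cyc a' v n') (h1 : ¬ Cyc a a' n) (h2 : ¬ Cyc a' a n') : False := by
  rw [Ne, Fin.ext_iff] at hne
  unfold Cyc NatCyc at *
  omega

/-- The arcs from each element of A to its successor are pairwise disjoint, and each contains an
element of D. -/
theorem card_le_of_arcs {m : ℕ} {A D : Finset (Fin m)} (hA : 2 ≤ A.card)
    (h : ∀ x ∈ A, ∀ x' ∈ A, x ≠ x' → ∃ b ∈ D, Cyc x b x') : A.card ≤ D.card := by
  obtain ⟨nx, hnx⟩ := exists_nextFun hA
  have : ∀ a : Fin m, ∃ v, a ∈ A → v ∈ D ∧ Cyc a v (nx a) := by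
    intro a
    by_cases ha : a ∈ A
    · obtain ⟨b, hb, hb'⟩ := h a ha _ (hnx a ha).1 (hnx a ha).2.1.symm
      exact ⟨b, fun _ => ⟨hb, hb'⟩⟩
    · exact ⟨a, fun h => absurd h ha⟩
  choose f hf using this
  refine Finset.card_le_card_of_injOn f (fun a ha => (hf a ha).1) ?_
  intro a ha a' ha' e
  by_contra hne
  have h2 := (hf a' ha').2
  rw [← e] at h2
  exact arc_disjoint hne (hf a ha).2 h2 ((hnx a ha).2.2 _ ha') ((hnx a' ha').2.2 _ ha)

/-- A set can be listed in increasing order, for any choice of the first label. -/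
theorem exists_sorted_listing {m k : ℕ} {A : Finset (Fin m)} (hA : A.card = k + 1) (l : Fin m) :
    ∃ a : Fin (k + 1) → Fin m, Finset.univ.image a = A ∧ StrictMono fun j => (a j - l).val := by
  have hm : NeZero m := ⟨fun h => by subst h; exact l.elim0⟩
  have hc : (A.image fun x => x - l).card = k + 1 := by
    rw [Finset.card_image_of_injective _ sub_left_injective, hA]
  let e := (A.image fun x => x - l).orderEmbOfFin hc
  have himg : Finset.univ.image e = A.image fun x => x - l := by
    apply Finset.coe_injective
    rw [← Finset.range_orderEmbOfFin _ hc, Finset.coe_image, Finset.coe_univ, Set.image_univ]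
  refine ⟨fun j => e j + l, ?_, fun i j hij => ?_⟩
  · have : (Finset.univ.image e).image (fun x => x + l) = A := by
      rw [himg, Finset.image_image]
      simp [Function.comp_def]
    rwa [Finset.image_image] at this
  · simp only [add_sub_cancel_right]
    exact e.strictMono hij

/-- A set can be listed cyclically, starting from any of its elements. -/
theorem exists_listing {m k : ℕ} {A : Finset (Fin m)} (hA : A.card = k + 1) {a₀ : Fin m}
    (ha₀ : a₀ ∈ A) :
    ∃ a : Fin (k + 1) → Fin m, a 0 = a₀ ∧ Finset.univ.image a = A ∧
      StrictMono fun j => (a j - a₀).val := by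
  obtain ⟨a, himg, hmono⟩ := exists_sorted_listing hA a₀
  refine ⟨a, ?_, himg, hmono⟩
  rw [← himg] at ha₀
  obtain ⟨j, -, hj⟩ := Finset.mem_image.1 ha₀
  have h1 : (a 0 - a₀).val ≤ (a j - a₀).val := hmono.monotone (Fin.zero_le j)
  rw [hj, sub_self_val] at h1
  exact (sub_val_inj (l := a₀)).1 (by rw [sub_self_val]; omega)

/-- Given a cyclic listing of one of two interlacing sets, the other can be listed alternately. -/
theorem Interlace.exists_alternate {m d : ℕ} {A B : Finset (Fin m)} (h : Interlace A B)
    (hB : B.card = d + 1) (hd : 1 ≤ d) {a : Fin (d + 1) → Fin m} (himg : Finset.univ.image a = A)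
    (hmono : StrictMono fun j => (a j - a 0).val) :
    ∃ b : Fin (d + 1) → Fin m, Finset.univ.image b = B ∧
      (∀ i, (a i - a 0).val < (b i - a 0).val) ∧
      ∀ i : Fin d, (b i.castSucc - a 0).val < (a i.succ - a 0).val := by
  have hmem : ∀ j, a j ∈ A := fun j => by rw [← himg]; simp
  have hinj : ∀ i j, i ≠ j → a i ≠ a j := fun i j hij e => hij (hmono.injective (by simp [e]))
  have hex : ∀ i : Fin (d + 1), ∃ b ∈ B, (a i - a 0).val < (b - a 0).val ∧
      ∀ j, i < j → (b - a 0).val < (a j - a 0).val := by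
    intro i
    by_cases hi : i.val < d
    · have hlt : i < (⟨i.val + 1, by omega⟩ : Fin (d + 1)) := by rw [Fin.lt_def]; simp
      obtain ⟨b, hb, hb'⟩ := h.2.1 _ (hmem i) _ (hmem ⟨i.val + 1, by omega⟩)
        (hinj _ _ hlt.ne)
      rw [← natCyc_sub_iff _ _ _ (a 0)] at hb'
      have h1 := hmono hlt
      simp only at h1
      unfold NatCyc at hb'
      refine ⟨b, hb, by omega, fun j hj => ?_⟩
      have : (a ⟨i.val + 1, by omega⟩ - a 0).val ≤ (a j - a 0).val :=
        hmono.monotone (by rw [Fin.le_def]; exact hj)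
      omega
    · have hlt : (0 : Fin (d + 1)) < i := by rw [Fin.lt_def, Fin.val_zero]; omega
      obtain ⟨b, hb, hb'⟩ := h.2.1 _ (hmem i) _ (hmem 0) (hinj _ _ hlt.ne')
      rw [← natCyc_sub_iff _ _ _ (a 0), sub_self_val] at hb'
      unfold NatCyc at hb'
      refine ⟨b, hb, by omega, fun j hj => ?_⟩
      have := j.2
      have : i.val < j.val := hj
      omega
  choose b hb h1 h2 using hex
  have h3 : ∀ i : Fin d, (b i.castSucc - a 0).val < (a i.succ - a 0).val :=
    fun i => h2 _ _ (Fin.castSucc_lt_succ)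
  obtain ⟨-, hβ, -⟩ := alternating_lt (α := fun i => (a i - a 0).val)
    (β := fun i => (b i - a 0).val) h1 h3
  refine ⟨b, ?_, h1, h3⟩
  refine Finset.eq_of_subset_of_card_le (fun x hx => ?_) ?_
  · obtain ⟨j, -, rfl⟩ := Finset.mem_image.1 hx
    exact hb j
  · rw [hB, Finset.card_image_of_injective _ (fun i j e => hβ.injective (by simp [e]))]
    simp

/-- Interlacing sets can be listed alternately, starting from any element of the first. -/
theorem Interlace.exists_listing {m d : ℕ} {A B : Finset (Fin m)} (h : Interlace A B)
    (hA : A.card = d + 1) (hB : B.card = d + 1) (hd : 1 ≤ d) {a₀ : Fin m} (ha₀ : a₀ ∈ A) :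
    ∃ a b : Fin (d + 1) → Fin m, a 0 = a₀ ∧ Finset.univ.image a = A ∧ Finset.univ.image b = B ∧
      (∀ i, (a i - a₀).val < (b i - a₀).val) ∧
      ∀ i : Fin d, (b i.castSucc - a₀).val < (a i.succ - a₀).val := by
  obtain ⟨a, rfl, himg, hmono⟩ := CyclicPolytope.exists_listing hA ha₀
  obtain ⟨b, h1, h2, h3⟩ := h.exists_alternate hB hd himg hmono
  exact ⟨a, b, rfl, himg, h1, h2, h3⟩

/-! ### Affine dependences on the moment curve -/

/-- `ρ` is an affine dependence (with coefficients `ρ v`) between the labelled points of the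
moment curve. -/
def AffRel (δ : ℕ) {m : ℕ} (t : Fin m → ℝ) (ρ : Fin m → ℝ) : Prop :=
  ∀ k ≤ δ, ∑ v, ρ v * t v ^ k = 0

section Relations

variable {δ m : ℕ} {t : Fin m → ℝ}

theorem AffRel.sum_eq_zero {ρ : Fin m → ℝ} (h : AffRel δ t ρ) : ∑ v, ρ v = 0 := by
  simpa using h 0 (Nat.zero_le _)

theorem AffRel.add {ρ σ : Fin m → ℝ} (h : AffRel δ t ρ) (h' : AffRel δ t σ) :
    AffRel δ t (ρ + σ) := fun k hk => by
  simp only [Pi.add_apply, add_mul, Finset.sum_add_distrib, h k hk, h' k hk, add_zero]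

theorem AffRel.smul {ρ : Fin m → ℝ} (c : ℝ) (h : AffRel δ t ρ) : AffRel δ t (c • ρ) :=
  fun k hk => by
    simp only [Pi.smul_apply, smul_eq_mul, mul_assoc, ← Finset.mul_sum, h k hk, mul_zero]

theorem AffRel.neg {ρ : Fin m → ℝ} (h : AffRel δ t ρ) : AffRel δ t (-ρ) := by
  simpa using h.smul (-1)

theorem AffRel.sub {ρ σ : Fin m → ℝ} (h : AffRel δ t ρ) (h' : AffRel δ t σ) :
    AffRel δ t (ρ - σ) := by
  rw [sub_eq_add_neg]; exact h.add h'.neg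

theorem AffRel.sum_eval {ρ : Fin m → ℝ} (h : AffRel δ t ρ) {q : Polynomial ℝ}
    (hq : q.natDegree ≤ δ) : ∑ v, ρ v * q.eval (t v) = 0 := by
  simp only [Polynomial.eval_eq_sum_range' (Nat.lt_succ_of_le hq), Finset.mul_sum]
  rw [Finset.sum_comm]
  refine Finset.sum_eq_zero fun k hk => ?_
  have hk' : k ≤ δ := Nat.lt_succ_iff.1 (Finset.mem_range.1 hk)
  calc ∑ v, ρ v * (q.coeff k * t v ^ k) = q.coeff k * ∑ v, ρ v * t v ^ k := by
        rw [Finset.mul_sum]; exact Finset.sum_congr rfl fun v _ => by ring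
    _ = 0 := by rw [h k hk', mul_zero]

theorem affRel_iff {ρ : Fin m → ℝ} :
    AffRel δ t ρ ↔ ∑ v, ρ v = 0 ∧ ∑ v, ρ v • momentCurve δ (t v) = 0 := by
  constructor
  · refine fun h => ⟨h.sum_eq_zero, ?_⟩
    ext k
    simpa [momentCurve, Finset.sum_apply] using h (k + 1) k.2
  · rintro ⟨h0, h1⟩ k hk
    rcases k with _ | k
    · simpa using h0
    · simpa [momentCurve, Finset.sum_apply] using congrFun h1 ⟨k, hk⟩

theorem affRel_sub_iff {u w : Fin m → ℝ} :
    AffRel δ t (u - w) ↔ ∑ v, u v = ∑ v, w v ∧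
      ∑ v, u v • momentCurve δ (t v) = ∑ v, w v • momentCurve δ (t v) := by
  rw [affRel_iff]
  simp only [Pi.sub_apply, sub_smul, Finset.sum_sub_distrib, sub_eq_zero]

/-- Testing against a Lagrange basis polynomial of S, of degree at most δ, isolates a single
coefficient. -/
theorem AffRel.eq_zero (ht : StrictMono t) {ρ : Fin m → ℝ} (h : AffRel δ t ρ)
    {S : Finset (Fin m)} (hS : S.card ≤ δ + 1) (hρ : ∀ v ∉ S, ρ v = 0) : ρ = 0 := by
  ext z
  by_cases hz : z ∈ S
  · have hd : (Lagrange.basis S t z).natDegree ≤ δ := by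
      rw [Lagrange.natDegree_basis ht.injective.injOn hz]; omega
    have := h.sum_eval hd
    rw [Finset.sum_eq_single z, Lagrange.eval_basis_self ht.injective.injOn hz, mul_one] at this
    · simpa using this
    · intro v _ hv
      by_cases hvS : v ∈ S
      · rw [Lagrange.eval_basis_of_ne hv.symm hvS, mul_zero]
      · rw [hρ v hvS, zero_mul]
    · simp
  · exact hρ z hz

/-- Any weights can be replaced by equivalent weights on `δ + 1` given labels. -/
theorem exists_affRel_sub (ht : StrictMono t) {Y : Finset (Fin m)} (hY : δ + 1 ≤ Y.card)
    (g : Fin m → ℝ) : ∃ w : Fin m → ℝ, (∀ v ∉ Y, w v = 0) ∧ AffRel δ t (g - w) := by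
  classical
  -- Lagrange interpolation at Y is exact in degree at most δ, so a unit mass at v is equivalent to
  -- the masses L_z(t v) at the nodes z of Y.
  refine ⟨fun z => if z ∈ Y then ∑ v, g v * (Lagrange.basis Y t z).eval (t v) else 0,
    fun v hv => if_neg hv, fun k hk => ?_⟩
  have hint : ∀ v, t v ^ k = ∑ z ∈ Y, t z ^ k * (Lagrange.basis Y t z).eval (t v) := by
    intro v
    have hdeg : (Polynomial.X ^ k : Polynomial ℝ).degree < Y.card := by
      rw [Polynomial.degree_X_pow]
      exact_mod_cast lt_of_lt_of_le (Nat.lt_succ_of_le hk) hY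
    have := congrArg (Polynomial.eval (t v)) (Lagrange.eq_interpolate ht.injective.injOn hdeg)
    simpa [Lagrange.interpolate_apply, Polynomial.eval_finsetSum] using this
  have h1 : ∑ z, (if z ∈ Y then ∑ v, g v * (Lagrange.basis Y t z).eval (t v) else 0) * t z ^ k
      = ∑ v, g v * t v ^ k := by
    simp only [ite_mul, zero_mul, Finset.sum_ite_mem, Finset.univ_inter]
    simp only [Finset.sum_mul]
    rw [Finset.sum_comm]
    refine Finset.sum_congr rfl fun v _ => ?_
    rw [hint v, Finset.mul_sum]
    exact Finset.sum_congr rfl fun z _ => by ring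
  simp only [Pi.sub_apply, sub_mul, Finset.sum_sub_distrib, h1, sub_self]

end Relations

/-! ### Simplices and their interiors in terms of weights -/

section Realization

variable {δ m : ℕ} {t : Fin m → ℝ}

/-- Weights are functions on all labels, zero off S. Two representations of one point, even in
different simplices, thus differ by an `AffRel`. -/
theorem mem_realization {S : Finset (Fin m)} {x : Fin δ → ℝ} :
    x ∈ realization δ t S ↔ ∃ w : Fin m → ℝ, (∀ v, 0 ≤ w v) ∧ (∀ v ∉ S, w v = 0) ∧
      ∑ v, w v = 1 ∧ ∑ v, w v • momentCurve δ (t v) = x := by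
  classical
  constructor
  · intro hx
    let K : Set (Fin δ → ℝ) := {x | ∃ w : Fin m → ℝ, (∀ v, 0 ≤ w v) ∧ (∀ v ∉ S, w v = 0) ∧
      ∑ v, w v = 1 ∧ ∑ v, w v • momentCurve δ (t v) = x}
    have hK : Convex ℝ K := by
      rintro x ⟨w, h1, h2, h3, h4⟩ y ⟨w', h1', h2', h3', h4'⟩ a b ha hb hab
      refine ⟨fun v => a * w v + b * w' v, fun v => by have := h1 v; have := h1' v; positivity,
        fun v hv => by simp [h2 v hv, h2' v hv], ?_, ?_⟩
      · rw [Finset.sum_add_distrib, ← Finset.mul_sum, ← Finset.mul_sum, h3, h3']; linarith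
      · rw [← h4, ← h4']
        simp only [add_smul, mul_smul, Finset.sum_add_distrib, Finset.smul_sum]
    refine convexHull_min ?_ hK hx
    rintro _ ⟨v, hv, rfl⟩
    refine ⟨Pi.single v 1, fun u => ?_, fun u hu => ?_, by simp, ?_⟩
    · by_cases h : u = v
      · subst h; simp
      · simp [h]
    · have : u ≠ v := by rintro rfl; exact hu hv
      simp [this]
    · simp [Pi.single_apply]
  · rintro ⟨w, h1, h2, h3, rfl⟩
    have hsum : ∀ {M : Type} [AddCommMonoid M] (f : Fin m → M), (∀ v ∉ S, f v = 0) →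
        ∑ v, f v = ∑ v ∈ S, f v := fun f hf =>
      (Finset.sum_subset (Finset.subset_univ S) fun v _ hv => hf v hv).symm
    rw [hsum _ fun v hv => by rw [h2 v hv, zero_smul]]
    rw [hsum _ h2] at h3
    exact (convex_convexHull ℝ _).sum_mem (fun v _ => h1 v) h3
      fun v hv => subset_convexHull ℝ _ (Set.mem_image_of_mem _ hv)

theorem realization_mono {S S' : Finset (Fin m)} (h : S ⊆ S') :
    realization δ t S ⊆ realization δ t S' :=
  convexHull_mono (Set.image_mono (by exact_mod_cast h))

theorem affineIndependent_momentCurve (ht : StrictMono t) {S : Finset (Fin m)}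
    (hS : S.card ≤ δ + 1) : AffineIndependent ℝ fun v : S => momentCurve δ (t v) := by
  classical
  rw [affineIndependent_iff]
  intro s w h0 h1 e he
  let ρ : Fin m → ℝ := fun v => if hv : v ∈ S then (if (⟨v, hv⟩ : S) ∈ s then w ⟨v, hv⟩ else 0)
    else 0
  have hsum : ∀ {M : Type} [AddCommGroup M] [Module ℝ M] (f : Fin m → M),
      ∑ v, ρ v • f v = ∑ v ∈ s, w v • f v := by
    intro M _ _ f
    rw [← Finset.sum_subset (Finset.subset_univ S), ← Finset.sum_coe_sort S]
    · rw [← Finset.sum_subset (Finset.subset_univ s) (fun v _ hv => by simp [ρ, hv])]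
      exact Finset.sum_congr rfl fun v hv => by simp [ρ, hv]
    · intro v _ hv
      simp [ρ, hv]
  have hρ : ρ = 0 := by
    refine AffRel.eq_zero ht (affRel_iff.2 ⟨?_, ?_⟩) hS fun v hv => by simp [ρ, hv]
    · simpa using (hsum fun _ => (1 : ℝ)).trans (by simpa using h0)
    · rw [hsum]; exact h1
  have := congrFun hρ e
  simpa [ρ, he] using this

theorem exists_affineBasis (ht : StrictMono t) {S : Finset (Fin m)}
    (hS : S.card = δ + 1) : ∃ b : AffineBasis S ℝ (Fin δ → ℝ),
      ∀ v : S, b v = momentCurve δ (t v) :=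
  ⟨⟨fun v : S => momentCurve δ (t v), affineIndependent_momentCurve ht hS.le,
    (affineIndependent_momentCurve ht hS.le).affineSpan_eq_top_iff_card_eq_finrank_add_one.2
      (by simp [hS])⟩, fun _ => rfl⟩

theorem mem_interior_realization (ht : StrictMono t) {S : Finset (Fin m)} (hS : S.card = δ + 1)
    {x : Fin δ → ℝ} :
    x ∈ interior (realization δ t S) ↔ ∃ w : Fin m → ℝ, (∀ v ∈ S, 0 < w v) ∧
      (∀ v ∉ S, w v = 0) ∧ ∑ v, w v = 1 ∧ ∑ v, w v • momentCurve δ (t v) = x := by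
  classical
  obtain ⟨b, hb⟩ := exists_affineBasis ht hS
  have hr : realization δ t S = convexHull ℝ (Set.range b) := by
    unfold realization
    congr 1
    ext y
    simp [hb]
  rw [hr, b.interior_convexHull, Set.mem_ofPred_eq]
  have hsum : ∀ {M : Type} [AddCommMonoid M] (f : Fin m → M), (∀ v ∉ S, f v = 0) →
      ∑ v, f v = ∑ v : S, f v := fun f hf => by
    rw [Finset.sum_coe_sort S]
    exact (Finset.sum_subset (Finset.subset_univ S) fun v _ hv => hf v hv).symm
  constructor
  · intro h
    refine ⟨fun v => if hv : v ∈ S then b.coord ⟨v, hv⟩ x else 0, fun v hv => ?_, fun v hv => ?_,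
      ?_, ?_⟩
    · simp only [hv, dif_pos]; exact h _
    · simp [hv]
    · rw [hsum _ fun v hv => by simp [hv]]
      simpa using b.sum_coord_apply_eq_one x
    · rw [hsum _ fun v hv => by simp [hv]]
      simpa [hb] using b.linear_combination_coord_eq_self x
  · rintro ⟨w, h1, h2, h3, rfl⟩ i
    rw [hsum _ fun v hv => by rw [h2 v hv, zero_smul]]
    rw [hsum _ h2] at h3
    have h4 := b.coord_apply_combination_of_mem (Finset.mem_univ i) (w := fun v : S => w v) h3
    rw [Finset.affineCombination_eq_linear_combination _ _ _ h3] at h4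
    simp only [hb] at h4
    rw [h4]
    exact h1 i i.2

/-- The weights need not be normalised: an affine dependence forces equal totals, and dividing by
the common total gives a common interior point. -/
theorem interiors_meet (ht : StrictMono t) {S S' : Finset (Fin m)} (hS : S.card = δ + 1)
    (hS' : S'.card = δ + 1) {u u' : Fin m → ℝ} (hu : ∀ v ∈ S, 0 < u v) (hu0 : ∀ v ∉ S, u v = 0)
    (hu' : ∀ v ∈ S', 0 < u' v) (hu0' : ∀ v ∉ S', u' v = 0) (h : AffRel δ t (u - u')) :
    ¬ Disjoint (interior (realization δ t S)) (interior (realization δ t S')) := by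
  rw [affRel_sub_iff] at h
  have hpos : 0 < ∑ v, u v := by
    obtain ⟨z, hz⟩ : S.Nonempty := Finset.card_pos.1 (by omega)
    refine Finset.sum_pos' (fun v _ => ?_) ⟨z, Finset.mem_univ _, hu z hz⟩
    by_cases hv : v ∈ S
    · exact (hu v hv).le
    · exact (hu0 v hv).ge
  rw [Set.not_disjoint_iff]
  refine ⟨(∑ v, u v)⁻¹ • ∑ v, u v • momentCurve δ (t v), ?_, ?_⟩
  · rw [mem_interior_realization ht hS]
    refine ⟨fun v => (∑ v, u v)⁻¹ * u v, fun v hv => by have := hu v hv; positivity,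
      fun v hv => by simp [hu0 v hv], ?_, ?_⟩
    · rw [← Finset.mul_sum, inv_mul_cancel₀ hpos.ne']
    · simp only [mul_smul, Finset.smul_sum]
  · rw [mem_interior_realization ht hS', h.2, h.1]
    rw [h.1] at hpos
    refine ⟨fun v => (∑ v, u' v)⁻¹ * u' v, fun v hv => by have := hu' v hv; positivity,
      fun v hv => by simp [hu0' v hv], ?_, ?_⟩
    · rw [← Finset.mul_sum, inv_mul_cancel₀ hpos.ne']
    · simp only [mul_smul, Finset.smul_sum]

theorem interior_realization_nonempty (ht : StrictMono t) {S : Finset (Fin m)}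
    (hS : S.card = δ + 1) : (interior (realization δ t S)).Nonempty := by
  by_contra h
  have hu : ∀ v ∈ S, 0 < (if v ∈ S then (1 : ℝ) else 0) := fun v hv => by simp [hv]
  have hu' : ∀ v ∉ S, (if v ∈ S then (1 : ℝ) else 0) = 0 := fun v hv => by simp [hv]
  refine interiors_meet ht hS hS hu hu' hu hu' (fun k _ => by simp) ?_
  rw [Set.not_nonempty_iff_eq_empty.1 h]
  exact disjoint_bot_left

theorem realization_subset_closure_interior (ht : StrictMono t) {S : Finset (Fin m)}
    (hS : S.card = δ + 1) :
    realization δ t S ⊆ closure (interior (realization δ t S)) := by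
  rw [(show Convex ℝ (realization δ t S) from convex_convexHull ℝ _).closure_interior_eq_closure_of_nonempty_interior
    (interior_realization_nonempty ht hS)]
  exact subset_closure

theorem isClosed_realization (S : Finset (Fin m)) : IsClosed (realization δ t S) :=
  (Set.Finite.isCompact_convexHull ℝ (S.finite_toSet.image _)).isClosed

/-- An open set that meets a full-dimensional simplex meets its interior. -/
theorem inter_interior_nonempty (ht : StrictMono t) {S : Finset (Fin m)} (hS : S.card = δ + 1)
    {U : Set (Fin δ → ℝ)} (hU : IsOpen U) {x : Fin δ → ℝ} (hx : x ∈ U)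
    (hxS : x ∈ realization δ t S) : (U ∩ interior (realization δ t S)).Nonempty :=
  mem_closure_iff.1 (realization_subset_closure_interior ht hS hxS) U hU hx

end Realization

/-! ### Sign patterns of affine dependences -/

section Circuits

variable {d m : ℕ} {t : Fin m → ℝ}

/-- Take simple roots at x and x' and double roots at the other d - 1 elements of A, giving degree
2d. The sign changes only at x and x'; the factor ε makes it negative on the cyclic arc from x to
x', also when this arc passes the last label. -/
theorem exists_arcPoly (ht : StrictMono t) (hd : 1 ≤ d) {A : Finset (Fin m)}
    (hA : A.card = d + 1) {x x' : Fin m} (hx : x ∈ A) (hx' : x' ∈ A) (hne : x ≠ x') :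
    ∃ q : Polynomial ℝ, q.natDegree ≤ 2 * d ∧ (∀ v ∈ A, q.eval (t v) = 0) ∧
      (∀ v ∉ A, Cyc x v x' → q.eval (t v) < 0) ∧
      (∀ v ∉ A, ¬ Cyc x v x' → 0 < q.eval (t v)) := by
  classical
  let R := (A.erase x).erase x'
  have hR : R.card = d - 1 := by
    rw [Finset.card_erase_of_mem (Finset.mem_erase.2 ⟨hne.symm, hx'⟩),
      Finset.card_erase_of_mem hx]; omega
  let ε : ℝ := if x < x' then 1 else -1
  let q : Polynomial ℝ := Polynomial.C ε * ((Polynomial.X - Polynomial.C (t x)) *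
    (Polynomial.X - Polynomial.C (t x')) * Lagrange.nodal R t ^ 2)
  have hev : ∀ v, q.eval (t v) = ε * ((t v - t x) * (t v - t x') *
      (∏ i ∈ R, (t v - t i)) ^ 2) := by
    intro v
    simp [q, Lagrange.eval_nodal]
  have hsq : ∀ v ∉ A, 0 < (∏ i ∈ R, (t v - t i)) ^ 2 := by
    intro v hv
    refine sq_pos_of_ne_zero (Finset.prod_ne_zero_iff.2 fun i hi => ?_)
    have hiA : i ∈ A := Finset.mem_of_mem_erase (Finset.mem_of_mem_erase hi)
    rw [sub_ne_zero]
    exact fun e => hv (ht.injective e ▸ hiA)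
  refine ⟨q, ?_, ?_, ?_, ?_⟩
  · refine (Polynomial.natDegree_C_mul_le _ _).trans ?_
    refine Polynomial.natDegree_mul_le.trans ?_
    have h1 : ((Polynomial.X - Polynomial.C (t x)) *
      (Polynomial.X - Polynomial.C (t x'))).natDegree ≤ 1 + 1 :=
      Polynomial.natDegree_mul_le.trans (by
        rw [Polynomial.natDegree_X_sub_C, Polynomial.natDegree_X_sub_C])
    have h2 : (Lagrange.nodal R t ^ 2).natDegree ≤ 2 * (d - 1) :=
      Polynomial.natDegree_pow_le.trans (by rw [Lagrange.natDegree_nodal, hR])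
    omega
  · intro v hv
    rw [hev]
    by_cases h1 : v = x
    · simp [h1]
    by_cases h2 : v = x'
    · simp [h2]
    have : ∏ i ∈ R, (t v - t i) = 0 :=
      Finset.prod_eq_zero (Finset.mem_erase.2 ⟨h2, Finset.mem_erase.2 ⟨h1, hv⟩⟩) (sub_self _)
    rw [this]; ring
  · intro v hv hc
    rw [hev]
    have hp := hsq v hv
    have key : ε * ((t v - t x) * (t v - t x')) < 0 := by
      by_cases hlt : x < x'
      · have h1 : x < v ∧ v < x' := by
          unfold Cyc NatCyc at hc; rw [Fin.lt_def] at hlt; constructor <;> rw [Fin.lt_def] <;> omega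
        have h2 := ht h1.1
        have h3 := ht h1.2
        simp only [ε, if_pos hlt, one_mul]
        exact mul_neg_of_pos_of_neg (by linarith) (by linarith)
      · have h1 : x < v ∨ v < x' := by
          unfold Cyc NatCyc at hc; rw [Fin.lt_def] at hlt; rw [Fin.lt_def, Fin.lt_def]; omega
        have hlt' : t x' < t x := ht (lt_of_le_of_ne (not_lt.1 hlt) hne.symm)
        simp only [ε, if_neg hlt]
        rcases h1 with h1 | h1
        · have := ht h1
          have : 0 < (t v - t x) * (t v - t x') := mul_pos (by linarith) (by linarith)
          linarith
        · have := ht h1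
          have : 0 < (t v - t x) * (t v - t x') := mul_pos_of_neg_of_neg (by linarith) (by linarith)
          linarith
    rw [← mul_assoc]
    exact mul_neg_of_neg_of_pos key hp
  · intro v hv hc
    rw [hev]
    have hp := hsq v hv
    have hvx : v ≠ x := fun e => hv (e ▸ hx)
    have hvx' : v ≠ x' := fun e => hv (e ▸ hx')
    have key : 0 < ε * ((t v - t x) * (t v - t x')) := by
      rw [Ne, Fin.ext_iff] at hvx hvx' hne
      by_cases hlt : x < x'
      · have h1 : v < x ∨ x' < v := by
          unfold Cyc NatCyc at hc; rw [Fin.lt_def] at hlt; rw [Fin.lt_def, Fin.lt_def]; omega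
        have hlt' := ht hlt
        simp only [ε, if_pos hlt, one_mul]
        rcases h1 with h1 | h1
        · have := ht h1
          exact mul_pos_of_neg_of_neg (by linarith) (by linarith)
        · have := ht h1
          exact mul_pos (by linarith) (by linarith)
      · have h1 : x' < v ∧ v < x := by
          unfold Cyc NatCyc at hc; rw [Fin.lt_def] at hlt; constructor <;> rw [Fin.lt_def] <;> omega
        have h2 := ht h1.1
        have h3 := ht h1.2
        simp only [ε, if_neg hlt]
        have : (t v - t x) * (t v - t x') < 0 :=
          mul_neg_of_neg_of_pos (by linarith) (by linarith)
        linarith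
    rw [← mul_assoc]
    exact mul_pos key hp

/-- If the positive part of a nontrivial affine dependence is supported on a set with `d + 1`
elements, then every arc between elements of this set contains a label from the negative part. -/
theorem AffRel.exists_neg (ht : StrictMono t) (hd : 1 ≤ d) {A : Finset (Fin m)}
    (hA : A.card = d + 1) {ρ : Fin m → ℝ} (hρ : AffRel (2 * d) t ρ) (h0 : ρ ≠ 0)
    (hpos : ∀ v, 0 < ρ v → v ∈ A) {x x' : Fin m} (hx : x ∈ A) (hx' : x' ∈ A) (hne : x ≠ x') :
    ∃ v, v ∉ A ∧ Cyc x v x' ∧ ρ v < 0 := by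
  obtain ⟨q, hq, hqA, hneg, hqpos⟩ := exists_arcPoly ht hd hA hx hx' hne
  by_contra! hcon
  have hterm : ∀ v, ρ v * q.eval (t v) ≤ 0 := by
    intro v
    by_cases hv : v ∈ A
    · simp [hqA v hv]
    · have h1 : ρ v ≤ 0 := not_lt.1 fun h => hv (hpos v h)
      by_cases hc : Cyc x v x'
      · have := hcon v hv hc
        have : ρ v = 0 := le_antisymm h1 this
        simp [this]
      · exact mul_nonpos_of_nonpos_of_nonneg h1 (hqpos v hv hc).le
  -- The terms are nonpositive with sum zero, so ρ vanishes wherever the polynomial does not, that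
  -- is, off A. A nonzero dependence has larger support.
  have hz := (Finset.sum_eq_zero_iff_of_nonpos fun v _ => hterm v).1 (hρ.sum_eval hq)
  refine h0 (hρ.eq_zero ht (S := A) (by omega) fun v hv => ?_)
  have h1 := hz v (Finset.mem_univ v)
  rcases mul_eq_zero.1 h1 with h1 | h1
  · exact h1
  · exfalso
    by_cases hc : Cyc x v x'
    · exact (hneg v hv hc).ne h1
    · exact (hqpos v hv hc).ne' h1

/-- Test against the polynomial of degree δ with simple roots at Z minus {z, z'}. Only two terms
survive, and the polynomial has the same sign at z and z' because no root lies between them. -/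
theorem AffRel.mul_neg_of_adjacent {δ : ℕ} (ht : StrictMono t) {Z : Finset (Fin m)}
    (hZ : Z.card = δ + 2) {ω : Fin m → ℝ} (hω : AffRel δ t ω) (h0 : ∀ v ∉ Z, ω v = 0)
    (hne : ∀ v ∈ Z, ω v ≠ 0) {z z' : Fin m} (hz : z ∈ Z) (hz' : z' ∈ Z) (hlt : z < z')
    (hadj : ∀ y ∈ Z, z < y → y < z' → False) : ω z * ω z' < 0 := by
  classical
  let R := (Z.erase z).erase z'
  have hR : R.card = δ := by
    rw [Finset.card_erase_of_mem (Finset.mem_erase.2 ⟨hlt.ne', hz'⟩),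
      Finset.card_erase_of_mem hz]; omega
  have h1 := hω.sum_eval (q := Lagrange.nodal R t) (by rw [Lagrange.natDegree_nodal, hR])
  have hzero : ∀ v, v ≠ z → v ≠ z' → ω v * (Lagrange.nodal R t).eval (t v) = 0 := by
    intro v hv hv'
    by_cases hvZ : v ∈ Z
    · rw [Lagrange.eval_nodal_at_node (Finset.mem_erase.2 ⟨hv', Finset.mem_erase.2 ⟨hv, hvZ⟩⟩),
        mul_zero]
    · rw [h0 v hvZ, zero_mul]
  rw [← Finset.sum_subset (Finset.subset_univ {z, z'}) (fun v _ hv => by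
    simp only [Finset.mem_insert, Finset.mem_singleton, not_or] at hv
    exact hzero v hv.1 hv.2), Finset.sum_pair hlt.ne] at h1
  have hP : 0 < (Lagrange.nodal R t).eval (t z) * (Lagrange.nodal R t).eval (t z') := by
    rw [Lagrange.eval_nodal, Lagrange.eval_nodal, ← Finset.prod_mul_distrib]
    refine Finset.prod_pos fun y hy => ?_
    have hyZ : y ∈ Z := Finset.mem_of_mem_erase (Finset.mem_of_mem_erase hy)
    have hyz : y ≠ z := Finset.ne_of_mem_erase (Finset.mem_of_mem_erase hy)
    have hyz' : y ≠ z' := Finset.ne_of_mem_erase hy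
    have := ht hlt
    rcases lt_or_gt_of_ne hyz with h | h
    · have := ht h
      exact mul_pos (by linarith) (by linarith)
    · rcases lt_or_gt_of_ne hyz' with h' | h'
      · exact (hadj y hyZ h h').elim
      · have := ht h'
        exact mul_pos_of_neg_of_neg (by linarith) (by linarith)
  set P := (Lagrange.nodal R t).eval (t z)
  set P' := (Lagrange.nodal R t).eval (t z')
  have h2 : (ω z * ω z') * (P * P') = -(ω z * P) ^ 2 := by
    have : ω z' * P' = -(ω z * P) := by linarith
    calc (ω z * ω z') * (P * P') = (ω z * P) * (ω z' * P') := by ring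
      _ = _ := by rw [this]; ring
  have h3 : 0 < (ω z * P) ^ 2 := by
    have : P ≠ 0 := fun e => by rw [e, zero_mul] at hP; exact lt_irrefl _ hP
    have := hne z hz
    positivity
  by_contra hcon
  have := mul_nonneg (not_lt.1 hcon) hP.le
  linarith

/-- Interlacing sets carry a circuit. -/
theorem Interlace.exists_circuit (ht : StrictMono t) {A B : Finset (Fin m)}
    (hI : Interlace A B) (hA : A.card = d + 1) (hB : B.card = d + 1) :
    ∃ ω : Fin m → ℝ, AffRel (2 * d) t ω ∧ (∀ v ∈ A, 0 < ω v) ∧ (∀ v ∈ B, ω v < 0) ∧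
      ∀ v, v ∉ A → v ∉ B → ω v = 0 := by
  classical
  set Z := A ∪ B with hZdef
  have hZ : Z.card = 2 * d + 2 := by rw [Finset.card_union_of_disjoint hI.1, hA, hB]; ring
  obtain ⟨z₀, hz₀⟩ : Z.Nonempty := Finset.card_pos.1 (by omega)
  have hY : (Z.erase z₀).card = 2 * d + 1 := by rw [Finset.card_erase_of_mem hz₀, hZ]; rfl
  obtain ⟨w, hw, hrel⟩ := exists_affRel_sub (δ := 2 * d) ht hY.ge (Pi.single z₀ 1)
  set ω : Fin m → ℝ := Pi.single z₀ 1 - w with hωdef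
  have h0 : ∀ v ∉ Z, ω v = 0 := by
    intro v hv
    have h1 : v ≠ z₀ := fun e => hv (e ▸ hz₀)
    have h2 : v ∉ Z.erase z₀ := fun h => hv (Finset.mem_of_mem_erase h)
    simp [hωdef, h1, hw v h2]
  have hωz₀ : ω z₀ = 1 := by simp [hωdef, hw z₀ (Finset.notMem_erase _ _)]
  have hne : ∀ v ∈ Z, ω v ≠ 0 := by
    intro v hv hv0
    have : ω = 0 := hrel.eq_zero ht (S := Z.erase v)
      (by rw [Finset.card_erase_of_mem hv, hZ]; omega) (fun u hu => by
        by_cases huv : u = v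
        · rw [huv, hv0]
        · exact h0 u fun h => hu (Finset.mem_erase.2 ⟨huv, h⟩))
    rw [this] at hωz₀
    simp at hωz₀
  let χ : Fin m → ℝ := fun v => if v ∈ A then 1 else -1
  let e := Z.orderEmbOfFin hZ
  have heZ : ∀ j, e j ∈ Z := fun j => Finset.orderEmbOfFin_mem _ _ _
  have hsurj : ∀ v ∈ Z, ∃ j, e j = v := fun v hv => by
    have : v ∈ Set.range e := by rw [Finset.range_orderEmbOfFin]; exact hv
    exact this
  -- Neighbours in the linear order of Z lie in different sets by interlacing, so χ changes sign
  -- between them; by `AffRel.mul_neg_of_adjacent` so does ω. Hence χ * ω has constant sign on Z.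
  have hstep : ∀ j (hj : j + 1 < 2 * d + 2),
      0 < (χ (e ⟨j, by omega⟩) * ω (e ⟨j, by omega⟩)) * (χ (e ⟨j + 1, hj⟩) * ω (e ⟨j + 1, hj⟩)) := by
    intro j hj
    have hlt : e ⟨j, by omega⟩ < e ⟨j + 1, hj⟩ := e.strictMono (by rw [Fin.lt_def]; simp)
    have hadj : ∀ y ∈ Z, e ⟨j, by omega⟩ < y → y < e ⟨j + 1, hj⟩ → False := by
      intro y hy h1 h2
      obtain ⟨k, rfl⟩ := hsurj y hy
      have h1 := e.lt_iff_lt.1 h1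
      have h2 := e.lt_iff_lt.1 h2
      rw [Fin.lt_def] at h1 h2
      simp only at h1 h2
      omega
    have hm := hrel.mul_neg_of_adjacent ht hZ h0 hne (heZ _) (heZ _) hlt hadj
    have hcyc : ∀ y ∈ Z, ¬ Cyc (e ⟨j, by omega⟩) y (e ⟨j + 1, hj⟩) := by
      intro y hy hc
      refine hadj y hy ?_ ?_ <;>
      · unfold Cyc NatCyc at hc
        rw [Fin.lt_def] at hlt ⊢
        omega
    have hχ : χ (e ⟨j, by omega⟩) * χ (e ⟨j + 1, hj⟩) = -1 := by
      have h1 := heZ ⟨j, by omega⟩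
      have h2 := heZ ⟨j + 1, hj⟩
      rw [hZdef, Finset.mem_union] at h1 h2
      by_cases hA1 : e ⟨j, by omega⟩ ∈ A <;> by_cases hA2 : e ⟨j + 1, hj⟩ ∈ A
      · obtain ⟨b, hb, hb'⟩ := hI.2.1 _ hA1 _ hA2 hlt.ne
        exact (hcyc b (Finset.mem_union_right _ hb) hb').elim
      · simp [χ, hA1, hA2]
      · simp [χ, hA1, hA2]
      · obtain ⟨b, hb, hb'⟩ := hI.2.2 _ (h1.resolve_left hA1) _ (h2.resolve_left hA2) hlt.ne
        exact (hcyc b (Finset.mem_union_left _ hb) hb').elim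
    have : (χ (e ⟨j, by omega⟩) * ω (e ⟨j, by omega⟩)) * (χ (e ⟨j + 1, hj⟩) * ω (e ⟨j + 1, hj⟩))
      = (χ (e ⟨j, by omega⟩) * χ (e ⟨j + 1, hj⟩)) * (ω (e ⟨j, by omega⟩) * ω (e ⟨j + 1, hj⟩)) := by
      ring
    rw [this, hχ]
    linarith
  have hall : ∀ j (hj : j < 2 * d + 2), 0 < (χ (e 0) * ω (e 0)) * (χ (e ⟨j, hj⟩) * ω (e ⟨j, hj⟩)) := by
    intro j
    induction j with
    | zero =>
      intro hj
      have h1 : χ (e 0) ≠ 0 := by simp only [χ]; split_ifs <;> norm_num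
      have h2 := hne _ (heZ 0)
      exact mul_self_pos.2 (mul_ne_zero h1 h2)
    | succ j ih =>
      intro hj
      have h1 := ih (by omega)
      have h2 := hstep j hj
      have h3 := mul_pos h1 h2
      set x := χ (e 0) * ω (e 0)
      set y := χ (e ⟨j, by omega⟩) * ω (e ⟨j, by omega⟩)
      set z := χ (e ⟨j + 1, hj⟩) * ω (e ⟨j + 1, hj⟩)
      have hy : 0 < y * y := mul_self_pos.2 fun e => by rw [e, zero_mul] at h2; exact lt_irrefl _ h2
      have : (x * z) * (y * y) = x * y * (y * z) := by ring
      by_contra hcon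
      have := mul_nonpos_of_nonpos_of_nonneg (not_lt.1 hcon) hy.le
      linarith
  have hall' : ∀ v ∈ Z, 0 < (χ (e 0) * ω (e 0)) * (χ v * ω v) := by
    intro v hv
    obtain ⟨j, rfl⟩ := hsurj v hv
    exact hall j j.2
  refine ⟨(χ (e 0) * ω (e 0)) • ω, hrel.smul _, fun v hv => ?_, fun v hv => ?_, fun v hv hv' => ?_⟩
  · have := hall' v (Finset.mem_union_left _ hv)
    simpa [χ, hv] using this
  · have := hall' v (Finset.mem_union_right _ hv)
    have hvA : v ∉ A := fun h => Finset.disjoint_left.1 hI.1 h hv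
    simp only [χ, hvA, if_false] at this
    simp only [Pi.smul_apply, smul_eq_mul, χ]
    linarith
  · have : v ∉ Z := by rw [hZdef, Finset.mem_union]; tauto
    simp [h0 v this]

/-- Simplices with a common point, carried by faces that together span, have intersecting
interiors. -/
theorem interiors_meet_of_span {δ : ℕ} (ht : StrictMono t) {S S' : Finset (Fin m)}
    (hS : S.card = δ + 1)
    (hS' : S'.card = δ + 1) {u u' : Fin m → ℝ} (hu : ∀ v, 0 ≤ u v) (hu0 : ∀ v ∉ S, u v = 0)
    (hu' : ∀ v, 0 ≤ u' v) (hu0' : ∀ v ∉ S', u' v = 0) (h : AffRel δ t (u - u'))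
    (hcard : δ + 1 ≤ (Finset.univ.filter fun v => 0 < u v ∨ 0 < u' v).card) :
    ¬ Disjoint (interior (realization δ t S)) (interior (realization δ t S')) := by
  classical
  -- The two barycentres differ by g, which can be rewritten as weights w on the two supports alone.
  -- A large multiple M of the common point then absorbs w, into u where u is positive and into u'
  -- elsewhere.
  let g : Fin m → ℝ := fun v => (if v ∈ S then 1 else 0) - (if v ∈ S' then 1 else 0)
  obtain ⟨w, hw, hrel⟩ := exists_affRel_sub ht hcard g
  have hbound : ∃ M : ℝ, ∀ v, (0 < u v → |w v| < M * u v) ∧ (0 < u' v → |w v| < M * u' v) := by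
    have h1 : ∀ᶠ M : ℝ in Filter.atTop, ∀ v,
        (0 < u v → |w v| < M * u v) ∧ (0 < u' v → |w v| < M * u' v) := by
      rw [Filter.eventually_all]
      intro v
      have key : ∀ a : ℝ, ∀ᶠ M : ℝ in Filter.atTop, (0 < a → |w v| < M * a) := by
        intro a
        by_cases ha : 0 < a
        · filter_upwards [Filter.eventually_gt_atTop (|w v| / a)] with M hM _
          rwa [div_lt_iff₀ ha] at hM
        · exact Filter.Eventually.of_forall fun M h => absurd h ha
      exact (key _).and (key _)
    exact h1.exists
  obtain ⟨M, hM⟩ := hbound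
  let p : Fin m → ℝ := fun v => if 0 < u v then w v else 0
  let p' : Fin m → ℝ := fun v => if 0 < u v then 0 else -w v
  have hsub : p - p' = w := by
    ext v
    simp only [p, p', Pi.sub_apply]
    split_ifs <;> simp
  let U : Fin m → ℝ := fun v => M * u v + (if v ∈ S then 1 else 0) - p v
  let U' : Fin m → ℝ := fun v => M * u' v + (if v ∈ S' then 1 else 0) - p' v
  have hzero : ∀ v, ¬ 0 < u v → ¬ 0 < u' v → w v = 0 := fun v h1 h2 => hw v (by simp_all)
  have hrelU : AffRel δ t (U - U') := by
    have : U - U' = M • (u - u') + (g - w) := by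
      rw [← hsub]
      ext v
      simp only [U, U', g, Pi.sub_apply, Pi.add_apply, Pi.smul_apply, smul_eq_mul]
      ring
    rw [this]
    exact (h.smul M).add hrel
  refine interiors_meet ht hS hS' (u := U) (u' := U') ?_ ?_ ?_ ?_ hrelU
  · intro v hv
    simp only [U, p, if_pos hv]
    by_cases h1 : 0 < u v
    · have := (hM v).1 h1
      have := le_abs_self (w v)
      rw [if_pos h1]
      linarith
    · have : u v = 0 := le_antisymm (not_lt.1 h1) (hu v)
      simp [this]
  · intro v hv
    simp [U, p, hv, hu0 v hv]
  · intro v hv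
    simp only [U', p', if_pos hv]
    by_cases h1 : 0 < u v
    · have h2 : 0 ≤ M * u' v := by
        by_cases h3 : 0 < u' v
        · exact (abs_nonneg _).trans ((hM v).2 h3).le
        · rw [le_antisymm (not_lt.1 h3) (hu' v), mul_zero]
      rw [if_pos h1]
      linarith
    · rw [if_neg h1]
      by_cases h3 : 0 < u' v
      · have := (hM v).2 h3
        have := neg_abs_le (w v)
        linarith
      · rw [hzero v h1 h3, le_antisymm (not_lt.1 h3) (hu' v)]
        norm_num
  · intro v hv
    have h3 : ¬ 0 < u' v := by rw [hu0' v hv]; exact lt_irrefl _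
    simp only [U', p', if_neg hv, hu0' v hv]
    by_cases h1 : 0 < u v
    · rw [if_pos h1]; ring
    · rw [if_neg h1, hzero v h1 h3]; ring

end Circuits

/-! ### Internal simplices and Gale's evenness condition -/

section Facets

variable {d m : ℕ} {t : Fin m → ℝ}

theorem momentCurve_mem_realization {δ : ℕ} {S : Finset (Fin m)} {v : Fin m} (hv : v ∈ S) :
    momentCurve δ (t v) ∈ realization δ t S :=
  subset_convexHull ℝ _ (Set.mem_image_of_mem _ hv)

/-- A `d`-simplex that interlaces with another one does not lie within a facet. -/
theorem Interlace.not_in_facet (ht : StrictMono t) {A B : Finset (Fin m)}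
    (hI : Interlace A B) (hA : A.card = d + 1) (hB : B.card = d + 1) :
    ¬ ∃ F, IsFacet (polytope (2 * d) t) F ∧ realization (2 * d) t A ⊆ F := by
  classical
  rintro ⟨F, ⟨hexp, hdim⟩, hAF⟩
  obtain ⟨a₀, ha₀⟩ : A.Nonempty := Finset.card_pos.1 (by omega)
  obtain ⟨l, hl⟩ := hexp ⟨_, hAF (momentCurve_mem_realization ha₀)⟩
  -- The slack of each vertex in the inequality that defines the face: nonnegative, zero on A, and
  -- annihilated by every affine dependence.
  let c : Fin m → ℝ := fun v => l (momentCurve (2 * d) (t a₀)) - l (momentCurve (2 * d) (t v))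
  have hPmem : ∀ v, momentCurve (2 * d) (t v) ∈ polytope (2 * d) t := fun v =>
    momentCurve_mem_realization (Finset.mem_univ v)
  have hmax : ∀ a ∈ A, ∀ y ∈ polytope (2 * d) t, l y ≤ l (momentCurve (2 * d) (t a)) := by
    intro a ha
    have := hAF (momentCurve_mem_realization ha)
    rw [hl] at this
    exact this.2
  have hc0 : ∀ v, 0 ≤ c v := fun v => sub_nonneg.2 (hmax a₀ ha₀ _ (hPmem v))
  have hcA : ∀ v ∈ A, c v = 0 := fun v hv =>
    le_antisymm (sub_nonpos.2 (hmax v hv _ (hPmem a₀))) (hc0 v)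
  have hcrel : ∀ ρ, AffRel (2 * d) t ρ → ∑ v, ρ v * c v = 0 := by
    intro ρ hρ
    have h1 := affRel_iff.1 hρ
    have h2 : ∑ v, ρ v * l (momentCurve (2 * d) (t v)) = 0 := by
      have := congrArg l h1.2
      simpa using this
    simp only [c, mul_sub, Finset.sum_sub_distrib, h2, ← Finset.sum_mul, h1.1, zero_mul, sub_zero]
  obtain ⟨ω, hω, hωA, hωB, hω0⟩ := hI.exists_circuit ht hA hB
  -- The circuit is negative on B and pairs to zero with the slack, so the slack vanishes on B too.
  -- As A ∪ B spans, it vanishes everywhere and the face is the whole polytope, which has the wrong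
  -- dimension.
  have hcB : ∀ v ∈ B, c v = 0 := by
    have hterm : ∀ v, ω v * c v ≤ 0 := by
      intro v
      by_cases h1 : v ∈ A
      · simp [hcA v h1]
      · by_cases h2 : v ∈ B
        · exact mul_nonpos_of_nonpos_of_nonneg (hωB v h2).le (hc0 v)
        · simp [hω0 v h1 h2]
    intro v hv
    have hz := (Finset.sum_eq_zero_iff_of_nonpos fun v _ => hterm v).1 (hcrel ω hω) v
      (Finset.mem_univ v)
    exact (mul_eq_zero.1 hz).resolve_left (hωB v hv).ne
  have hZ : (A ∪ B).card = 2 * d + 2 := by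
    rw [Finset.card_union_of_disjoint hI.1, hA, hB]; ring
  have hcall : ∀ v, c v = 0 := by
    intro v
    obtain ⟨w, hw, hrel⟩ := exists_affRel_sub (δ := 2 * d) ht (Y := A ∪ B) (by omega)
      (Pi.single v 1)
    have h1 := hcrel _ hrel
    have h2 : ∑ u, w u * c u = 0 := by
      refine Finset.sum_eq_zero fun u _ => ?_
      by_cases hu : u ∈ A ∪ B
      · rcases Finset.mem_union.1 hu with hu | hu
        · rw [hcA u hu, mul_zero]
        · rw [hcB u hu, mul_zero]
      · rw [hw u hu, zero_mul]
    simpa [sub_mul, Finset.sum_sub_distrib, h2, Pi.single_apply] using h1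
  have hF : ∀ v, momentCurve (2 * d) (t v) ∈ F := by
    intro v
    rw [hl]
    refine ⟨hPmem v, fun y hy => ?_⟩
    have := hmax a₀ ha₀ y hy
    have := hcall v
    simp only [c] at this
    linarith
  obtain ⟨Y, -, hYc⟩ := Finset.exists_subset_card_eq (show 2 * d + 1 ≤ (A ∪ B).card by omega)
  obtain ⟨b, hb⟩ := exists_affineBasis ht hYc
  have htop : vectorSpan ℝ F = ⊤ := by
    have h1 : affineSpan ℝ F = ⊤ := by
      rw [eq_top_iff, ← b.tot]
      refine affineSpan_mono ℝ ?_
      rintro _ ⟨v, rfl⟩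
      rw [hb]
      exact hF v
    rw [← direction_affineSpan, h1, AffineSubspace.direction_top]
  rw [htop] at hdim
  simp at hdim

/-- Gale's pairs: the polynomial vanishing at two adjacent labels is nonnegative. -/
theorem exists_pairPoly [NeZero m] (hm : 1 < m) (ht : StrictMono t) (j : Fin m) :
    ∃ q : Polynomial ℝ, q.natDegree ≤ 2 ∧ (∀ v, 0 ≤ q.eval (t v)) ∧
      ∀ v, q.eval (t v) = 0 ↔ v = j ∨ v = j + 1 := by
  have hd : ∀ a b : ℝ, ((Polynomial.X - Polynomial.C a) *
      (Polynomial.X - Polynomial.C b)).natDegree ≤ 2 := fun a b =>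
    Polynomial.natDegree_mul_le.trans (by
      rw [Polynomial.natDegree_X_sub_C, Polynomial.natDegree_X_sub_C])
  have hzero : ∀ v, (t v - t j) * (t v - t (j + 1)) = 0 ↔ v = j ∨ v = j + 1 := by
    intro v
    rw [mul_eq_zero, sub_eq_zero, sub_eq_zero, ht.injective.eq_iff, ht.injective.eq_iff]
  have hj := add_one_val hm j
  by_cases hlast : j.val + 1 = m
  · rw [if_pos hlast] at hj
    -- For the pair formed by the last and the first label, all parameters lie between the two
    -- roots, whence the sign.
    refine ⟨Polynomial.C (-1) * ((Polynomial.X - Polynomial.C (t j)) *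
      (Polynomial.X - Polynomial.C (t (j + 1)))),
      (Polynomial.natDegree_C_mul_le _ _).trans (hd _ _), fun v => ?_, fun v => ?_⟩
    · have h1 : t v ≤ t j := ht.monotone (by rw [Fin.le_def]; have := v.2; omega)
      have h2 : t (j + 1) ≤ t v := ht.monotone (by rw [Fin.le_def]; omega)
      have := mul_nonneg (sub_nonneg.2 h1) (sub_nonneg.2 h2)
      simp only [Polynomial.eval_mul, Polynomial.eval_C, Polynomial.eval_sub, Polynomial.eval_X]
      linarith
    · rw [← hzero]
      simp
  · rw [if_neg hlast] at hj
    refine ⟨(Polynomial.X - Polynomial.C (t j)) * (Polynomial.X - Polynomial.C (t (j + 1))),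
      hd _ _, fun v => ?_, fun v => ?_⟩
    · simp only [Polynomial.eval_mul, Polynomial.eval_C, Polynomial.eval_sub, Polynomial.eval_X]
      by_cases hv : v ≤ j
      · have h1 := ht.monotone hv
        have h2 : t v ≤ t (j + 1) := ht.monotone (by rw [Fin.le_def] at *; omega)
        exact mul_nonneg_of_nonpos_of_nonpos (by linarith) (by linarith)
      · have h1 := ht.monotone (not_le.1 hv).le
        have h2 : t (j + 1) ≤ t v := ht.monotone (by rw [Fin.le_def] at *; omega)
        exact mul_nonneg (by linarith) (by linarith)
    · rw [← hzero]
      simp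

/-- The product of the d pair polynomials is nonnegative at all vertices, has degree at most 2d and
vanishes exactly on the pairs. Its nonconstant coefficients, negated, form the supporting
functional. -/
theorem isFacet_of_pairs [NeZero m] (hm : 1 < m) (hd : 1 ≤ d) (ht : StrictMono t)
    {J : Finset (Fin m)} (hJ : J.card = d) (hJ' : ∀ j ∈ J, j + 1 ∉ J) :
    IsFacet (polytope (2 * d) t) (realization (2 * d) t (J ∪ J.image (· + 1))) := by
  classical
  choose f hf1 hf2 hf3 using exists_pairPoly hm ht
  set G := J ∪ J.image (· + 1) with hG
  have hGc : G.card = 2 * d := by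
    rw [hG, Finset.card_union_of_disjoint, card_image_add_one, hJ]
    · ring
    · rw [Finset.disjoint_left]
      intro x hx hx'
      obtain ⟨y, hy, rfl⟩ := Finset.mem_image.1 hx'
      exact hJ' y hy hx
  let q : Polynomial ℝ := ∏ j ∈ J, f j
  have hqd : q.natDegree ≤ 2 * d := by
    refine (Polynomial.natDegree_prod_le _ _).trans ?_
    calc ∑ j ∈ J, (f j).natDegree ≤ ∑ _j ∈ J, 2 := Finset.sum_le_sum fun j _ => hf1 j
      _ = 2 * d := by simp [hJ, mul_comm]
  have hq0 : ∀ v, 0 ≤ q.eval (t v) := fun v => by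
    simp only [q, Polynomial.eval_prod]
    exact Finset.prod_nonneg fun j _ => hf2 j v
  have hqG : ∀ v, q.eval (t v) = 0 ↔ v ∈ G := by
    intro v
    simp only [q, Polynomial.eval_prod, Finset.prod_eq_zero_iff, hf3, hG, Finset.mem_union,
      Finset.mem_image]
    constructor
    · rintro ⟨j, hj, rfl | rfl⟩
      · exact Or.inl hj
      · exact Or.inr ⟨j, hj, rfl⟩
    · rintro (h | ⟨j, hj, rfl⟩)
      · exact ⟨v, h, Or.inl rfl⟩
      · exact ⟨j, hj, Or.inr rfl⟩
  let l : (Fin (2 * d) → ℝ) →L[ℝ] ℝ :=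
    ∑ k : Fin (2 * d), (-q.coeff (k + 1)) • ContinuousLinearMap.proj k
  have hl : ∀ v, l (momentCurve (2 * d) (t v)) = q.coeff 0 - q.eval (t v) := by
    intro v
    rw [Polynomial.eval_eq_sum_range' (Nat.lt_succ_of_le hqd), Finset.sum_range_succ',
      Finset.sum_range]
    simp [l, momentCurve]
  have hlw : ∀ w : Fin m → ℝ, ∑ v, w v = 1 → l (∑ v, w v • momentCurve (2 * d) (t v)) =
      q.coeff 0 - ∑ v, w v * q.eval (t v) := by
    intro w hw
    simp only [map_sum, map_smul, hl, smul_eq_mul, mul_sub, Finset.sum_sub_distrib,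
      ← Finset.sum_mul, hw, one_mul]
  have hle : ∀ y ∈ polytope (2 * d) t, l y ≤ q.coeff 0 := by
    intro y hy
    obtain ⟨w, h1, -, h3, rfl⟩ := mem_realization.1 hy
    rw [hlw w h3]
    have : 0 ≤ ∑ v, w v * q.eval (t v) :=
      Finset.sum_nonneg fun v _ => mul_nonneg (h1 v) (hq0 v)
    linarith
  obtain ⟨g, hg⟩ : G.Nonempty := Finset.card_pos.1 (by omega)
  constructor
  · refine fun _ => ⟨l, ?_⟩
    ext x
    constructor
    · intro hx
      refine ⟨realization_mono (Finset.subset_univ _) hx, fun y hy => (hle y hy).trans_eq ?_⟩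
      obtain ⟨w, h1, h2, h3, rfl⟩ := mem_realization.1 hx
      rw [hlw w h3, Finset.sum_eq_zero, sub_zero]
      intro v _
      by_cases hv : v ∈ G
      · rw [(hqG v).2 hv, mul_zero]
      · rw [h2 v hv, zero_mul]
    · rintro ⟨hx, hmax⟩
      obtain ⟨w, h1, h2, h3, rfl⟩ := mem_realization.1 hx
      have h4 := hmax _ (momentCurve_mem_realization (Finset.mem_univ g))
      rw [hl, (hqG g).2 hg, hlw w h3] at h4
      have hterm : ∀ v, 0 ≤ w v * q.eval (t v) := fun v => mul_nonneg (h1 v) (hq0 v)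
      have h5 : ∑ v, w v * q.eval (t v) = 0 :=
        le_antisymm (by linarith) (Finset.sum_nonneg fun v _ => hterm v)
      refine mem_realization.2 ⟨w, h1, fun v hv => ?_, h3, rfl⟩
      have h6 := (Finset.sum_eq_zero_iff_of_nonneg fun v _ => hterm v).1 h5 v (Finset.mem_univ v)
      exact (mul_eq_zero.1 h6).resolve_right fun h => hv ((hqG v).1 h)
  · have hind := affineIndependent_momentCurve (δ := 2 * d) ht (S := G) (by omega)
    have h1 := hind.finrank_vectorSpan (n := 2 * d - 1) (by simp [hGc]; omega)
    have h2 : vectorSpan ℝ (realization (2 * d) t G) =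
        vectorSpan ℝ (Set.range fun v : G => momentCurve (2 * d) (t v)) := by
      rw [← direction_affineSpan, ← direction_affineSpan]
      congr 1
      unfold realization
      rw [affineSpan_convexHull]
      congr 1
      ext y
      simp
    rw [h2, h1]
    omega

/-- Greedy choice: take the pair {s, s + 1} if s must be covered or if no room is left, and skip s
otherwise. The alternative `N = 2 * e` accounts for pairs that fill the interval, which cover A
whatever its size. -/
theorem exists_pairs_nat : ∀ (N e s : ℕ) (A : Finset ℕ), 2 * e ≤ N → (A.card ≤ e ∨ N = 2 * e) →
    (∀ a ∈ A, s ≤ a ∧ a < s + N) →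
    ∃ J : Finset ℕ, J.card = e ∧ (∀ j ∈ J, s ≤ j ∧ j + 1 < s + N ∧ j + 1 ∉ J) ∧
      ∀ a ∈ A, a ∈ J ∨ ∃ j ∈ J, a = j + 1 := by
  intro N
  induction N using Nat.strong_induction_on with
  | _ N ih =>
    intro e s A hN hc hA
    rcases Nat.eq_zero_or_pos e with rfl | he
    · refine ⟨∅, rfl, by simp, fun a ha => ?_⟩
      exfalso
      rcases hc with hc | hc
      · rw [Finset.card_eq_zero.1 (Nat.le_zero.1 hc)] at ha
        simp at ha
      · have := hA a ha
        omega
    · by_cases h : s ∈ A ∨ N = 2 * e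
      · obtain ⟨J, h1, h2, h3⟩ := ih (N - 2) (by omega) (e - 1) (s + 2)
          ((A.erase s).erase (s + 1)) (by omega) (by
            rcases h with h | h
            · rcases hc with hc | hc
              · left
                have := Finset.card_erase_of_mem h
                have := Finset.card_erase_le (s := A.erase s) (a := s + 1)
                omega
              · right; omega
            · right; omega) (by
            intro a ha
            simp only [Finset.mem_erase] at ha
            have := hA a ha.2.2
            omega)
        have hs : s ∉ J := fun h => by have := h2 s h; omega
        refine ⟨insert s J, by rw [Finset.card_insert_of_notMem hs, h1]; omega, ?_, ?_⟩
        · intro j hj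
          rcases Finset.mem_insert.1 hj with rfl | hj
          · refine ⟨le_rfl, by omega, fun h => ?_⟩
            rcases Finset.mem_insert.1 h with h | h
            · omega
            · have := h2 _ h; omega
          · have := h2 j hj
            refine ⟨by omega, by omega, fun h => ?_⟩
            rcases Finset.mem_insert.1 h with h | h
            · omega
            · exact this.2.2 h
        · intro a ha
          by_cases h4 : a = s
          · exact Or.inl (by simp [h4])
          by_cases h5 : a = s + 1
          · exact Or.inr ⟨s, by simp, h5⟩
          rcases h3 a (by simp [h4, h5, ha]) with h | ⟨j, hj, h⟩
          · exact Or.inl (Finset.mem_insert_of_mem h)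
          · exact Or.inr ⟨j, Finset.mem_insert_of_mem hj, h⟩
      · push Not at h
        obtain ⟨J, h1, h2, h3⟩ := ih (N - 1) (by omega) e (s + 1) A (by omega)
          (Or.inl (hc.resolve_right h.2)) (by
            intro a ha
            have h1 := hA a ha
            have h2 : a ≠ s := fun e => h.1 (e ▸ ha)
            omega)
        refine ⟨J, h1, fun j hj => ?_, h3⟩
        have := h2 j hj
        exact ⟨by omega, by omega, this.2.2⟩

/-- A set of `d + 1` labels that contains two adjacent ones can be covered by `d` disjoint pairs of
adjacent labels. -/
theorem exists_pairs [NeZero m] (hd : 1 ≤ d) (hm : 2 * d + 1 ≤ m) {A : Finset (Fin m)}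
    (hA : A.card = d + 1) {x : Fin m} (hx : x ∈ A) (hx' : x + 1 ∈ A) :
    ∃ J : Finset (Fin m), J.card = d ∧ (∀ j ∈ J, j + 1 ∉ J) ∧ A ⊆ J ∪ J.image (· + 1) := by
  classical
  let φ : Fin m → ℕ := fun v => (v - x).val
  have hφ : Function.Injective φ := fun a b h => sub_val_inj.1 h
  have hlt : ∀ v, φ v < m := fun v => (v - x).2
  have hsucc : ∀ v, φ v + 1 < m → φ (v + 1) = φ v + 1 := by
    intro v hv
    simp only [φ] at hv ⊢
    rw [add_sub_right_comm, add_one_val (by omega), if_neg (by omega)]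
  have hsurj : ∀ k < m, ∃ v, φ v = k := fun k hk => ⟨⟨k, hk⟩ + x, by simp [φ]⟩
  have hx0 : φ x = 0 := sub_self_val x
  have hx1 : φ (x + 1) = 1 := by rw [hsucc x (by omega), hx0]
  have hne : x + 1 ≠ x := fun e => by rw [e, hx0] at hx1; omega
  -- With x as origin, the pair {0, 1} covers two elements of A; the other d - 1 are covered by d -
  -- 1 pairs in [2, m).
  obtain ⟨J, h1, h2, h3⟩ := exists_pairs_nat (m - 2) (d - 1) 2
    (((A.erase x).erase (x + 1)).image φ) (by omega) (Or.inl (by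
      refine Finset.card_image_le.trans ?_
      rw [Finset.card_erase_of_mem (Finset.mem_erase.2 ⟨hne, hx'⟩), Finset.card_erase_of_mem hx]
      omega)) (by
      intro a ha
      obtain ⟨v, hv, rfl⟩ := Finset.mem_image.1 ha
      simp only [Finset.mem_erase] at hv
      have h4 : φ v ≠ 0 := fun e => hv.2.1 (hφ (e.trans hx0.symm))
      have h5 : φ v ≠ 1 := fun e => hv.1 (hφ (e.trans hx1.symm))
      have := hlt v
      omega)
  have h0 : 0 ∉ J := fun h => by have := h2 0 h; omega
  have hJm : ∀ k ∈ insert 0 J, k + 1 < m := by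
    intro k hk
    rcases Finset.mem_insert.1 hk with rfl | hk
    · omega
    · have := h2 k hk; omega
  have hJJ : ∀ k ∈ insert 0 J, k + 1 ∉ insert 0 J := by
    intro k hk hk'
    rcases Finset.mem_insert.1 hk' with h | hk'
    · omega
    · rcases Finset.mem_insert.1 hk with rfl | hk
      · have := h2 _ hk'; omega
      · exact (h2 k hk).2.2 hk'
  refine ⟨Finset.univ.filter fun v => φ v ∈ insert 0 J, ?_, ?_, ?_⟩
  · rw [← Finset.card_image_of_injective _ hφ,
      show (Finset.univ.filter fun v => φ v ∈ insert 0 J).image φ = insert 0 J by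
        ext k
        simp only [Finset.mem_image, Finset.mem_filter, Finset.mem_univ, true_and]
        constructor
        · rintro ⟨v, hv, rfl⟩; exact hv
        · intro hk
          obtain ⟨v, rfl⟩ := hsurj k (by have := hJm k hk; omega)
          exact ⟨v, hk, rfl⟩, Finset.card_insert_of_notMem h0, h1]
    omega
  · intro j hj hj'
    simp only [Finset.mem_filter, Finset.mem_univ, true_and] at hj hj'
    rw [hsucc j (hJm _ hj)] at hj'
    exact hJJ _ hj hj'
  · intro a ha
    simp only [Finset.mem_union, Finset.mem_image, Finset.mem_filter, Finset.mem_univ, true_and]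
    by_cases h4 : a = x
    · left; simp [h4, hx0]
    by_cases h5 : a = x + 1
    · right; exact ⟨x, by simp [hx0], h5.symm⟩
    rcases h3 (φ a) (Finset.mem_image_of_mem _ (by simp [h4, h5, ha])) with h | ⟨j, hj, h⟩
    · left; exact Finset.mem_insert_of_mem h
    · right
      have hj' := hJm j (Finset.mem_insert_of_mem hj)
      obtain ⟨v, rfl⟩ := hsurj j (by omega)
      refine ⟨v, Finset.mem_insert_of_mem hj, hφ ?_⟩
      rw [hsucc v hj', h]

theorem nonAdj_of_not_in_facet [NeZero m] (hd : 1 ≤ d) (hm : 2 * d + 1 ≤ m) (ht : StrictMono t)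
    {A : Finset (Fin m)} (hA : A.card = d + 1)
    (h : ¬ ∃ F, IsFacet (polytope (2 * d) t) F ∧ realization (2 * d) t A ⊆ F) : NonAdj A := by
  intro x hx hx'
  obtain ⟨J, h1, h2, h3⟩ := exists_pairs hd hm hA hx hx'
  exact h ⟨_, isFacet_of_pairs (by omega) hd ht h1 h2, realization_mono h3⟩

end Facets

/-! ### Faces of triangulations do not cross -/

section Triangulations

variable {d m : ℕ} {t : Fin m → ℝ} {T : Finset (Finset (Fin m))}

/-- In a triangulation, points in the relative interior of a `d`-dimensional face have no other
representation. -/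
theorem IsTriangulation.face_unique (hT : IsTriangulation (2 * d) t T) (ht : StrictMono t)
    (hd : 1 ≤ d) {A S₀ S : Finset (Fin m)} (hA : A.card = d + 1) (hS₀ : S₀ ∈ T) (hAS : A ⊆ S₀)
    (hS : S ∈ T) {u u' : Fin m → ℝ} (hu : ∀ v ∈ A, 0 < u v) (hu0 : ∀ v ∉ A, u v = 0)
    (hu' : ∀ v, 0 ≤ u' v) (hu0' : ∀ v ∉ S, u' v = 0) (h : AffRel (2 * d) t (u - u')) :
    u = u' := by
  classical
  by_contra hne
  have h0 : u - u' ≠ 0 := sub_ne_zero.2 hne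
  have hu0S : ∀ v ∉ S₀, u v = 0 := fun v hv => hu0 v fun h => hv (hAS h)
  have hunn : ∀ v, 0 ≤ u v := fun v => by
    by_cases hv : v ∈ A
    · exact (hu v hv).le
    · exact (hu0 v hv).ge
  have hSne : S₀ ≠ S := by
    rintro rfl
    exact h0 (h.eq_zero ht (hT.1 S₀ hS₀).2.le fun v hv => by simp [hu0S v hv, hu0' v hv])
  have hpos : ∀ v, 0 < (u - u') v → v ∈ A := by
    intro v hv
    by_contra hvA
    have := hu' v
    simp only [Pi.sub_apply, hu0 v hvA] at hv
    linarith
  refine interiors_meet_of_span ht (hT.1 S₀ hS₀).2 (hT.1 S hS).2 hunn hu0S hu' hu0' h ?_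
    (hT.2.1 S₀ hS₀ S hS hSne)
  let D := Finset.univ.filter fun v => v ∉ A ∧ 0 < u' v
  -- Every gap of A contains a label where u' is positive. Together with A this makes at least 2d +
  -- 2 carriers, more than the 2d + 1 needed for the interiors to meet.
  have hD : A.card ≤ D.card := by
    refine card_le_of_arcs (by omega) fun x hx x' hx' hxx => ?_
    obtain ⟨v, hv, hc, hneg⟩ := h.exists_neg ht hd hA h0 hpos hx hx' hxx
    refine ⟨v, ?_, hc⟩
    simp only [Pi.sub_apply, hu0 v hv] at hneg
    simp only [D, Finset.mem_filter, Finset.mem_univ, true_and]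
    exact ⟨hv, by linarith⟩
  have hdis : Disjoint A D := by
    rw [Finset.disjoint_left]
    intro v hv hv'
    simp only [D, Finset.mem_filter, Finset.mem_univ, true_and] at hv'
    exact hv'.1 hv
  have hsub : A ∪ D ⊆ Finset.univ.filter fun v => 0 < u v ∨ 0 < u' v := by
    intro v hv
    simp only [Finset.mem_filter, Finset.mem_univ, true_and]
    rcases Finset.mem_union.1 hv with hv | hv
    · exact Or.inl (hu v hv)
    · simp only [D, Finset.mem_filter, Finset.mem_univ, true_and] at hv
      exact Or.inr hv.2
  have := Finset.card_le_card hsub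
  rw [Finset.card_union_of_disjoint hdis] at this
  omega

/-- The positive and negative parts of the circuit represent the same point, once on A and once on
B, contrary to `IsTriangulation.face_unique`. -/
theorem IsTriangulation.not_interlace (hT : IsTriangulation (2 * d) t T) (ht : StrictMono t)
    (hd : 1 ≤ d) {A B S S' : Finset (Fin m)} (hA : A.card = d + 1) (hB : B.card = d + 1)
    (hS : S ∈ T) (hS' : S' ∈ T) (hAS : A ⊆ S) (hBS : B ⊆ S') : ¬ Interlace A B := by
  intro hI
  obtain ⟨ω, hω, hωA, hωB, hω0⟩ := hI.exists_circuit ht hA hB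
  have hnA : ∀ v ∉ A, ω v ≤ 0 := fun v hv => by
    by_cases h : v ∈ B
    · exact (hωB v h).le
    · exact (hω0 v hv h).le
  have hnB : ∀ v ∉ B, 0 ≤ ω v := fun v hv => by
    by_cases h : v ∈ A
    · exact (hωA v h).le
    · exact (hω0 v h hv).ge
  have key := hT.face_unique ht hd hA hS hAS hS' (u := fun v => max (ω v) 0)
    (u' := fun v => max (-ω v) 0)
    (fun v hv => lt_max_of_lt_left (hωA v hv)) (fun v hv => max_eq_right (hnA v hv))
    (fun v => le_max_right _ _) (fun v hv => max_eq_right (by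
      have := hnB v fun h => hv (hBS h)
      linarith)) (by
      have : ((fun v => max (ω v) 0) - fun v => max (-ω v) 0) = ω := by
        ext v
        simp only [Pi.sub_apply]
        rcases le_total (ω v) 0 with h | h
        · rw [max_eq_right h, max_eq_left (by linarith)]; ring
        · rw [max_eq_left h, max_eq_right (by linarith)]; ring
      rw [this]; exact hω)
  obtain ⟨a, ha⟩ : A.Nonempty := Finset.card_pos.1 (by omega)
  have h1 : max (ω a) 0 = max (-ω a) 0 := congrFun key a
  have h2 := hωA a ha
  rw [max_eq_left h2.le, max_eq_right (by linarith)] at h1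
  linarith

/-- The star of an internal `d`-simplex covers all directions. -/
theorem IsTriangulation.exists_star (hT : IsTriangulation (2 * d) t T) (ht : StrictMono t)
    (hd : 1 ≤ d) {A B S₀ : Finset (Fin m)} (hA : A.card = d + 1) (hB : B.card = d + 1)
    (hS₀ : S₀ ∈ T) (hAS : A ⊆ S₀) (hI : Interlace A B) (g : Fin m → ℝ) :
    ∃ S ∈ T, A ⊆ S ∧ ∃ w : Fin m → ℝ, (∀ v ∉ S, w v = 0) ∧ (∀ v ∉ A, 0 ≤ w v) ∧
      AffRel (2 * d) t (g - w) := by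
  classical
  obtain ⟨ω, hω, hωA, hωB, hω0⟩ := hI.exists_circuit ht hA hB
  have hZ : (A ∪ B).card = 2 * d + 2 := by
    rw [Finset.card_union_of_disjoint hI.1, hA, hB]; ring
  obtain ⟨a₀, ha₀⟩ : A.Nonempty := Finset.card_pos.1 (by omega)
  set Ω : ℝ := ∑ v ∈ A, ω v with hΩ
  have hΩpos : 0 < Ω := Finset.sum_pos hωA ⟨a₀, ha₀⟩
  -- the weights of a point in the relative interior of `|A|`
  let u : Fin m → ℝ := fun v => if v ∈ A then Ω⁻¹ * ω v else 0
  have hu1 : ∑ v, u v = 1 := by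
    simp only [u, Finset.sum_ite_mem, Finset.univ_inter, ← Finset.mul_sum]
    exact inv_mul_cancel₀ hΩpos.ne'
  have huA : ∀ v ∈ A, 0 < u v := fun v hv => by
    have := hωA v hv
    simp only [u, if_pos hv]; positivity
  have huA0 : ∀ v ∉ A, u v = 0 := fun v hv => if_neg hv
  -- a direction of total weight zero
  let g₀ : Fin m → ℝ := g - Pi.single a₀ (∑ v, g v)
  have hg₀ : ∑ v, g₀ v = 0 := by simp [g₀, Finset.sum_sub_distrib]
  obtain ⟨w₀, hw₀, hrel₀⟩ := exists_affRel_sub (δ := 2 * d) ht (Y := A ∪ B) (by omega) g₀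
  let x : ℝ → Fin (2 * d) → ℝ := fun ε => ∑ v, (u v + ε * g₀ v) • momentCurve (2 * d) (t v)
  have hxP : ∀ᶠ ε in nhdsWithin (0 : ℝ) (Set.Ioi 0), x ε ∈ polytope (2 * d) t := by
    -- Subtracting half of the normalised circuit respreads the point x 0 with positive weights over
    -- A ∪ B, which spans. Hence x 0 is an interior point and small moves stay in the polytope.
    have hpos : ∀ v ∈ A ∪ B, 0 < u v - (2 * Ω)⁻¹ * ω v := by
      intro v hv
      rcases Finset.mem_union.1 hv with hv | hv
      · have h1 := hωA v hv
        simp only [u, if_pos hv]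
        have : Ω⁻¹ * ω v - (2 * Ω)⁻¹ * ω v = (2 * Ω)⁻¹ * ω v := by field_simp; ring
        rw [this]; positivity
      · have h1 := hωB v hv
        have h2 : v ∉ A := fun h => Finset.disjoint_left.1 hI.1 h hv
        simp only [u, if_neg h2]
        have : 0 < (2 * Ω)⁻¹ := by positivity
        nlinarith
    have hev : ∀ᶠ ε in nhdsWithin (0 : ℝ) (Set.Ioi 0), ∀ v, v ∈ A ∪ B →
        0 < (u v - (2 * Ω)⁻¹ * ω v) + ε * w₀ v := by
      refine Filter.Eventually.filter_mono nhdsWithin_le_nhds ?_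
      rw [Filter.eventually_all]
      intro v
      by_cases hv : v ∈ A ∪ B
      · have hc : Continuous fun ε : ℝ => (u v - (2 * Ω)⁻¹ * ω v) + ε * w₀ v := by fun_prop
        have := (hc.continuousAt (x := (0 : ℝ))).eventually (lt_mem_nhds (a := 0) (by
          simpa using hpos v hv))
        filter_upwards [this] with ε hε _ using hε
      · exact Filter.Eventually.of_forall fun ε h => absurd h hv
    filter_upwards [hev] with ε hε
    have hrel : AffRel (2 * d) t ((fun v => u v + ε * g₀ v) -
        fun v => (u v - (2 * Ω)⁻¹ * ω v) + ε * w₀ v) := by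
      have : ((fun v => u v + ε * g₀ v) - fun v => (u v - (2 * Ω)⁻¹ * ω v) + ε * w₀ v) =
          ε • (g₀ - w₀) + (2 * Ω)⁻¹ • ω := by
        ext v
        simp only [Pi.sub_apply, Pi.add_apply, Pi.smul_apply, smul_eq_mul]
        ring
      rw [this]
      exact (hrel₀.smul _).add (hω.smul _)
    have h1 := affRel_sub_iff.1 hrel
    refine mem_realization.2 ⟨fun v => (u v - (2 * Ω)⁻¹ * ω v) + ε * w₀ v, fun v => ?_,
      fun v hv => absurd (Finset.mem_univ v) hv, ?_, h1.2.symm⟩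
    · by_cases hv : v ∈ A ∪ B
      · exact (hε v hv).le
      · have h2 : v ∉ A ∧ v ∉ B := by simpa using hv
        simp [hw₀ v hv, u, h2.1, hω0 v h2.1 h2.2]
    · rw [← h1.1, Finset.sum_add_distrib, ← Finset.mul_sum, hg₀, hu1]
      ring
  have hxc : Continuous x := by
    refine continuous_finsetSum _ fun v _ => ?_
    fun_prop
  -- Simplices are closed and finite in number, so for small ε a member of T containing x ε also
  -- contains x 0, and then contains A by `IsTriangulation.face_unique`.
  have hS : ∀ᶠ ε in nhdsWithin (0 : ℝ) (Set.Ioi 0), ∀ S ∈ T,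
      x 0 ∉ realization (2 * d) t S → x ε ∉ realization (2 * d) t S := by
    refine Filter.Eventually.filter_mono nhdsWithin_le_nhds ?_
    rw [Filter.eventually_all_finset]
    intro S _
    by_cases h : x 0 ∈ realization (2 * d) t S
    · exact Filter.Eventually.of_forall fun ε h' => absurd h h'
    · filter_upwards [hxc.continuousAt.eventually ((isClosed_realization S).isOpen_compl.mem_nhds h)]
        with ε hε _ using hε
  obtain ⟨ε, ⟨hεP, hεS⟩, hεpos⟩ := ((hxP.and hS).and self_mem_nhdsWithin).exists
  have hεpos : 0 < ε := hεpos
  have hcov : x ε ∈ ⋃ S ∈ T, realization (2 * d) t S := by rw [hT.2.2]; exact hεP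
  simp only [Set.mem_iUnion] at hcov
  obtain ⟨S, hST, hxS⟩ := hcov
  have hx0 : x 0 ∈ realization (2 * d) t S := by
    by_contra h
    exact hεS S hST h hxS
  have hAS' : A ⊆ S := by
    obtain ⟨u', h1, h2, h3, h4⟩ := mem_realization.1 hx0
    have := hT.face_unique ht hd hA hS₀ hAS hST huA huA0 h1 h2
      (affRel_sub_iff.2 ⟨by rw [hu1, h3], by rw [h4]; simp [x]⟩)
    intro v hv
    by_contra hvS
    have h5 := huA v hv
    rw [this, h2 v hvS] at h5
    exact lt_irrefl _ h5
  obtain ⟨w, h1, h2, h3, h4⟩ := mem_realization.1 hxS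
  -- The move is divided by ε, and the total weight of g, taken away at a₀ to get total zero, is put
  -- back. Off A both u and the correction vanish, so the weights there stay nonnegative.
  refine ⟨S, hST, hAS', fun v => ε⁻¹ * (w v - u v) + (Pi.single a₀ (∑ v, g v) : Fin m → ℝ) v, ?_,
    ?_, ?_⟩
  · intro v hv
    have h5 : v ≠ a₀ := fun e => hv (e ▸ hAS' ha₀)
    simp [h2 v hv, huA0 v fun h => hv (hAS' h), h5]
  · intro v hv
    have h5 : v ≠ a₀ := fun e => hv (e ▸ ha₀)
    have := h1 v
    simp only [huA0 v hv, Pi.single_apply, if_neg h5]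
    have : 0 < ε⁻¹ := inv_pos.2 hεpos
    simp only [sub_zero, add_zero]
    positivity
  · have hrel : AffRel (2 * d) t ((fun v => u v + ε * g₀ v) - w) := by
      refine affRel_sub_iff.2 ⟨?_, ?_⟩
      · rw [h3, Finset.sum_add_distrib, ← Finset.mul_sum, hg₀, hu1]; ring
      · rw [h4]
    have : (g - fun v => ε⁻¹ * (w v - u v) + (Pi.single a₀ (∑ v, g v) : Fin m → ℝ) v) =
        ε⁻¹ • ((fun v => u v + ε * g₀ v) - w) := by
      ext v
      simp only [Pi.sub_apply, Pi.smul_apply, smul_eq_mul, g₀]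
      field_simp
      ring
    rw [this]
    exact hrel.smul _

end Triangulations

/-! ### Bistellar flips and mutability -/

section Flips

variable {d m : ℕ} {t : Fin m → ℝ} {T : Finset (Finset (Fin m))}

/-- Dependences on at most δ + 2 points are proportional: the difference vanishes at z, so it lives
on at most δ + 1 points. -/
theorem AffRel.eq_smul {δ : ℕ} (ht : StrictMono t) {ρ ω : Fin m → ℝ} (hρ : AffRel δ t ρ)
    (hω : AffRel δ t ω) {Z : Finset (Fin m)} (hZ : Z.card ≤ δ + 2) (hρ0 : ∀ v ∉ Z, ρ v = 0)
    (hω0 : ∀ v ∉ Z, ω v = 0) {z : Fin m} (hz : z ∈ Z) (hne : ω z ≠ 0) :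
    ρ = (ρ z / ω z) • ω := by
  rw [← sub_eq_zero]
  refine (hρ.sub (hω.smul _)).eq_zero ht (S := Z.erase z)
    (by rw [Finset.card_erase_of_mem hz]; omega) fun v hv => ?_
  by_cases hvz : v = z
  · subst hvz
    simp [hne]
  · have : v ∉ Z := fun h => hv (Finset.mem_erase.2 ⟨hvz, h⟩)
    simp [hρ0 v this, hω0 v this]

theorem Interlace.card_union {A B : Finset (Fin m)} (hI : Interlace A B) (hA : A.card = d + 1)
    (hB : B.card = d + 1) : (A ∪ B).card = 2 * d + 2 := by
  rw [Finset.card_union_of_disjoint hI.1, hA, hB]; ring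

theorem Interlace.card_erase {A B : Finset (Fin m)} (hI : Interlace A B) (hA : A.card = d + 1)
    (hB : B.card = d + 1) {z : Fin m} (hz : z ∈ A ∪ B) : ((A ∪ B).erase z).card = 2 * d + 1 := by
  rw [Finset.card_erase_of_mem hz, hI.card_union hA hB]; rfl

/-- The positive part of the circuit lives on A, which avoids b, and the negative part on B, which
avoids a. The common point has carriers A and B, which together span. -/
theorem Interlace.erase_meet (ht : StrictMono t) {A B : Finset (Fin m)} (hI : Interlace A B)
    (hA : A.card = d + 1) (hB : B.card = d + 1) {a b : Fin m} (ha : a ∈ A) (hb : b ∈ B) :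
    ¬ Disjoint (interior (realization (2 * d) t ((A ∪ B).erase a)))
      (interior (realization (2 * d) t ((A ∪ B).erase b))) := by
  classical
  obtain ⟨ω, hω, hωA, hωB, hω0⟩ := hI.exists_circuit ht hA hB
  rw [disjoint_comm]
  have hle : ∀ v ∉ A, ω v ≤ 0 := fun v h1 => by
    by_cases h2 : v ∈ B
    · exact (hωB v h2).le
    · exact (hω0 v h1 h2).le
  have hge : ∀ v ∉ B, 0 ≤ ω v := fun v h1 => by
    by_cases h2 : v ∈ A
    · exact (hωA v h2).le
    · exact (hω0 v h2 h1).ge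
  refine interiors_meet_of_span ht (u := fun v => max (ω v) 0) (u' := fun v => max (-ω v) 0)
    (hI.card_erase hA hB (Finset.mem_union_right _ hb))
    (hI.card_erase hA hB (Finset.mem_union_left _ ha)) (fun v => le_max_right _ _)
    (fun v hv => max_eq_right (hle v fun h => hv ?_)) (fun v => le_max_right _ _)
    (fun v hv => max_eq_right (neg_nonpos.2 (hge v fun h => hv ?_))) ?_ ?_
  · exact Finset.mem_erase.2 ⟨fun e => Finset.disjoint_left.1 hI.1 h (e ▸ hb),
      Finset.mem_union_left _ h⟩
  · exact Finset.mem_erase.2 ⟨fun e => Finset.disjoint_left.1 hI.1 ha (e ▸ h),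
      Finset.mem_union_right _ h⟩
  · have : ((fun v => max (ω v) 0) - fun v => max (-ω v) 0) = ω := by
      ext v
      simp only [Pi.sub_apply]
      rcases le_total (ω v) 0 with h | h
      · rw [max_eq_right h, max_eq_left (by linarith)]; ring
      · rw [max_eq_left h, max_eq_right (by linarith)]; ring
    rw [this]; exact hω
  · have hsub : A ∪ B ⊆ Finset.univ.filter fun v => 0 < max (ω v) 0 ∨ 0 < max (-ω v) 0 := by
      intro v hv
      simp only [Finset.mem_filter, Finset.mem_univ, true_and]
      rcases Finset.mem_union.1 hv with hv | hv
      · exact Or.inl (lt_max_of_lt_left (hωA v hv))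
      · exact Or.inr (lt_max_of_lt_left (neg_pos.2 (hωB v hv)))
    have := Finset.card_le_card hsub
    rw [hI.card_union hA hB] at this
    omega

/-- Moving the weights along the circuit raises them on A and lowers them on B. Stop at the first
zero in B, found by minimising the ratio w v / -ω v. -/
theorem Interlace.cover (ht : StrictMono t) {A B : Finset (Fin m)} (hI : Interlace A B)
    (hA : A.card = d + 1) (hB : B.card = d + 1) {x : Fin (2 * d) → ℝ}
    (hx : x ∈ realization (2 * d) t (A ∪ B)) :
    ∃ b ∈ B, x ∈ realization (2 * d) t ((A ∪ B).erase b) := by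
  obtain ⟨ω, hω, hωA, hωB, hω0⟩ := hI.exists_circuit ht hA hB
  obtain ⟨w, h1, h2, h3, h4⟩ := mem_realization.1 hx
  obtain ⟨b, hb, hmin⟩ := Finset.exists_min_image B (fun v => w v / -ω v)
    (Finset.card_pos.1 (by omega))
  set c := w b / -ω b with hc
  have hωb : 0 < -ω b := neg_pos.2 (hωB b hb)
  have hc0 : 0 ≤ c := div_nonneg (h1 b) hωb.le
  have hrel : AffRel (2 * d) t (w - (w + c • ω)) := by
    have : w - (w + c • ω) = (-c) • ω := by rw [neg_smul]; abel
    rw [this]; exact hω.smul _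
  have h5 := affRel_sub_iff.1 hrel
  refine ⟨b, hb, mem_realization.2 ⟨w + c • ω, fun v => ?_, fun v hv => ?_, h5.1 ▸ h3, h5.2 ▸ h4⟩⟩
  · simp only [Pi.add_apply, Pi.smul_apply, smul_eq_mul]
    by_cases hvA : v ∈ A
    · have := h1 v
      have := hωA v hvA
      positivity
    · by_cases hvB : v ∈ B
      · have h6 := hmin v hvB
        have h7 : 0 < -ω v := neg_pos.2 (hωB v hvB)
        rw [le_div_iff₀ h7] at h6
        linarith
      · rw [hω0 v hvA hvB, mul_zero, add_zero]; exact h1 v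
  · simp only [Pi.add_apply, Pi.smul_apply, smul_eq_mul]
    by_cases hvb : v = b
    · subst hvb
      have hne := (hωB v hb).ne
      rw [hc]; field_simp; ring
    · have hvZ : v ∉ A ∪ B := fun h => hv (Finset.mem_erase.2 ⟨hvb, h⟩)
      have : v ∉ A ∧ v ∉ B := by simpa using hvZ
      rw [h2 v hvZ, hω0 v this.1 this.2]; ring

/-- A common interior point of the simplices omitting b and b' would give a multiple of the circuit
with opposite signs at b and b', but the circuit is negative at both. -/
theorem Interlace.isTriangulationOn (ht : StrictMono t) {A B : Finset (Fin m)}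
    (hI : Interlace A B) (hA : A.card = d + 1) (hB : B.card = d + 1) :
    IsTriangulationOn (2 * d) t (A ∪ B) (B.image (A ∪ B).erase) := by
  refine ⟨?_, ?_, ?_⟩
  · intro S hS
    obtain ⟨b, hb, rfl⟩ := Finset.mem_image.1 hS
    exact ⟨Finset.erase_subset _ _, hI.card_erase hA hB (Finset.mem_union_right _ hb)⟩
  · intro S hS S' hS' hne
    obtain ⟨b, hb, rfl⟩ := Finset.mem_image.1 hS
    obtain ⟨b', hb', rfl⟩ := Finset.mem_image.1 hS'
    have hbb : b ≠ b' := fun e => hne (by rw [e])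
    have hbZ := Finset.mem_union_right A hb
    have hbZ' := Finset.mem_union_right A hb'
    rw [Set.disjoint_left]
    intro x hx hx'
    obtain ⟨ω, hω, hωA, hωB, hω0⟩ := hI.exists_circuit ht hA hB
    obtain ⟨w, h1, h2, h3, h4⟩ := (mem_interior_realization ht (hI.card_erase hA hB hbZ)).1 hx
    obtain ⟨w', h1', h2', h3', h4'⟩ :=
      (mem_interior_realization ht (hI.card_erase hA hB hbZ')).1 hx'
    have hrel : AffRel (2 * d) t (w - w') := affRel_sub_iff.2 ⟨h3.trans h3'.symm, h4.trans h4'.symm⟩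
    have hρ0 : ∀ v ∉ A ∪ B, (w - w') v = 0 := fun v hv => by
      simp [h2 v fun h => hv (Finset.mem_of_mem_erase h),
        h2' v fun h => hv (Finset.mem_of_mem_erase h)]
    have hω0' : ∀ v ∉ A ∪ B, ω v = 0 := fun v hv => by
      have : v ∉ A ∧ v ∉ B := by simpa using hv
      exact hω0 v this.1 this.2
    have key := hrel.eq_smul ht hω (hI.card_union hA hB).le hρ0 hω0' hbZ (hωB b hb).ne
    have hb1 : (w - w') b < 0 := by
      have := h1' b (Finset.mem_erase.2 ⟨hbb, hbZ⟩)
      simp only [Pi.sub_apply, h2 b (Finset.notMem_erase _ _)]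
      linarith
    have hb2 : 0 < (w - w') b' := by
      have := h1 b' (Finset.mem_erase.2 ⟨hbb.symm, hbZ'⟩)
      simp only [Pi.sub_apply, h2' b' (Finset.notMem_erase _ _)]
      linarith
    have hκ : 0 < (w - w') b / ω b := div_pos_of_neg_of_neg hb1 (hωB b hb)
    rw [key] at hb2
    have := mul_neg_of_pos_of_neg hκ (hωB b' hb')
    simp only [Pi.smul_apply, smul_eq_mul] at hb2 this
    linarith
  · ext x
    simp only [Set.mem_iUnion]
    constructor
    · rintro ⟨S, hS, hx⟩
      obtain ⟨b, hb, rfl⟩ := Finset.mem_image.1 hS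
      exact realization_mono (Finset.erase_subset _ _) hx
    · intro hx
      obtain ⟨b, hb, hx'⟩ := hI.cover ht hA hB hx
      exact ⟨_, Finset.mem_image_of_mem _ hb, hx'⟩

theorem exists_erase_eq {Z S : Finset (Fin m)} {k : ℕ} (hS : S ⊆ Z) (hSc : S.card = k)
    (hZ : Z.card = k + 1) : ∃ z ∈ Z, S = Z.erase z := by
  have h1 : (Z \ S).card = 1 := by rw [Finset.card_sdiff_of_subset hS]; omega
  obtain ⟨z, hz⟩ := Finset.card_eq_one.1 h1
  have hzm : z ∈ Z \ S := by rw [hz]; simp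
  rw [Finset.mem_sdiff] at hzm
  refine ⟨z, hzm.1, Finset.eq_of_subset_of_card_le (fun v hv => ?_) ?_⟩
  · exact Finset.mem_erase.2 ⟨fun e => hzm.2 (e ▸ hv), hS hv⟩
  · rw [Finset.card_erase_of_mem hzm.1]; omega

/-- An interior point of a missing simplex would be covered by another member, whose interior would
then overlap that of the missing simplex. -/
theorem Interlace.eq_of_subset (ht : StrictMono t) {A B : Finset (Fin m)} (hI : Interlace A B)
    (hA : A.card = d + 1) (hB : B.card = d + 1) {U : Finset (Finset (Fin m))}
    (hU : IsTriangulationOn (2 * d) t (A ∪ B) U) (hsub : U ⊆ B.image (A ∪ B).erase) :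
    U = B.image (A ∪ B).erase := by
  refine Finset.Subset.antisymm hsub fun S hS => ?_
  by_contra hSU
  have hT := hI.isTriangulationOn ht hA hB
  obtain ⟨x, hx⟩ := interior_realization_nonempty ht (hT.1 S hS).2
  have hxZ : x ∈ realization (2 * d) t (A ∪ B) := realization_mono (hT.1 S hS).1 (interior_subset hx)
  rw [← hU.2.2] at hxZ
  simp only [Set.mem_iUnion] at hxZ
  obtain ⟨S', hS', hx'⟩ := hxZ
  obtain ⟨y, hy, hy'⟩ := inter_interior_nonempty ht (hU.1 S' hS').2 isOpen_interior hx hx'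
  exact Set.disjoint_left.1 (hT.2.1 S hS S' (hsub hS') fun e => hSU (e ▸ hS')) hy hy'

/-- The polytope `|A ∪ B|` has exactly two triangulations. -/
theorem Interlace.triangulation_eq (ht : StrictMono t) {A B : Finset (Fin m)}
    (hI : Interlace A B) (hA : A.card = d + 1) (hB : B.card = d + 1)
    {U : Finset (Finset (Fin m))} (hU : IsTriangulationOn (2 * d) t (A ∪ B) U) :
    U = B.image (A ∪ B).erase ∨ U = A.image (A ∪ B).erase := by
  by_cases h : U ⊆ B.image (A ∪ B).erase
  · exact Or.inl (hI.eq_of_subset ht hA hB hU h)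
  · right
    rw [Finset.not_subset] at h
    obtain ⟨S, hS, hSB⟩ := h
    have hform : ∀ S ∈ U, ∃ z ∈ A ∪ B, S = (A ∪ B).erase z := fun S hS =>
      exists_erase_eq (hU.1 S hS).1 (hU.1 S hS).2 (hI.card_union hA hB)
    obtain ⟨a, ha, rfl⟩ := hform S hS
    have haA : a ∈ A := (Finset.mem_union.1 ha).resolve_right fun h =>
      hSB (Finset.mem_image_of_mem _ h)
    -- One member omits an element of A; by `Interlace.erase_meet` none can omit an element of B.
    have := hI.symm.eq_of_subset ht hB hA (U := U) (by rwa [Finset.union_comm]) ?_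
    · rwa [Finset.union_comm] at this
    · rw [Finset.union_comm]
      intro S' hS'
      obtain ⟨z, hz, rfl⟩ := hform S' hS'
      rcases Finset.mem_union.1 hz with hz | hz
      · exact Finset.mem_image_of_mem _ hz
      · exact (hI.erase_meet ht hA hB haA hz (hU.2.1 _ hS _ hS' fun e =>
          hSB (e ▸ Finset.mem_image_of_mem _ hz))).elim

theorem exists_alternating [NeZero m] {Z : Finset (Fin m)} (hZ : Z.card = 2 * d + 2) :
    ∃ A B, Z = A ∪ B ∧ A.card = d + 1 ∧ B.card = d + 1 ∧ Interlace A B := by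
  let e := Z.orderEmbOfFin hZ
  let a : Fin (d + 1) → Fin m := fun i => e ⟨2 * i, by omega⟩
  let b : Fin (d + 1) → Fin m := fun i => e ⟨2 * i + 1, by omega⟩
  have h : Intertwining d (Finset.univ.image a) (Finset.univ.image b) := by
    refine ⟨a, b, rfl, rfl, 0, fun i => ?_, fun i => ?_⟩
    · rw [sub_zero, sub_zero]
      exact e.strictMono (by rw [Fin.lt_def]; simp)
    · rw [sub_zero, sub_zero]
      exact e.strictMono (by rw [Fin.lt_def]; simp; omega)
  obtain ⟨h1, h2, h3⟩ := h.interlace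
  refine ⟨_, _, (Finset.eq_of_subset_of_card_le ?_ ?_).symm, h1, h2, h3⟩
  · intro v hv
    rcases Finset.mem_union.1 hv with hv | hv <;> obtain ⟨i, -, rfl⟩ := Finset.mem_image.1 hv <;>
      exact Finset.orderEmbOfFin_mem _ _ _
  · rw [h3.card_union h1 h2, hZ]

theorem Interlace.mem_dArcs (ht : StrictMono t) {A B S : Finset (Fin m)} (hI : Interlace A B)
    (hA : A.card = d + 1) (hB : B.card = d + 1) (hS : S ∈ T) (hAS : A ⊆ S) :
    A ∈ dArcs d t T :=
  ⟨hA, ⟨S, hS, hAS⟩, hI.not_in_facet ht hA hB⟩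

theorem Interlace.subset_erase {A B : Finset (Fin m)} (hI : Interlace A B) {b : Fin m}
    (hb : b ∈ B) : A ⊆ (A ∪ B).erase b := fun _ hv =>
  Finset.mem_erase.2 ⟨fun e => Finset.disjoint_left.1 hI.1 hv (e ▸ hb), Finset.mem_union_left _ hv⟩

/-- A₀ is a d-arc of T but not of T', where it would cross B₀. So it is the one exchanged. -/
theorem eq_of_flip (ht : StrictMono t) (hd : 1 ≤ d) {T' : Finset (Finset (Fin m))}
    (hT' : IsTriangulation (2 * d) t T') {A B A₀ B₀ : Finset (Fin m)} (hI : Interlace A₀ B₀)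
    (hA₀ : A₀.card = d + 1) (hB₀ : B₀.card = d + 1)
    (h : ∀ b ∈ B₀, (A₀ ∪ B₀).erase b ∈ T) (h' : ∀ a ∈ A₀, (A₀ ∪ B₀).erase a ∈ T')
    (hAB : dArcs d t T \ {A} = dArcs d t T' \ {B}) : A₀ = A := by
  obtain ⟨b, hb⟩ : B₀.Nonempty := Finset.card_pos.1 (by omega)
  obtain ⟨a, ha⟩ : A₀.Nonempty := Finset.card_pos.1 (by omega)
  have h1 : A₀ ∈ dArcs d t T := hI.mem_dArcs ht hA₀ hB₀ (h b hb) (hI.subset_erase hb)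
  have h2 : A₀ ∉ dArcs d t T' := by
    rintro ⟨-, ⟨S, hS, hAS⟩, -⟩
    refine hT'.not_interlace ht hd hA₀ hB₀ hS (h' a ha) hAS ?_ hI
    rw [Finset.union_comm]
    exact hI.symm.subset_erase ha
  by_contra hne
  have h3 : A₀ ∈ dArcs d t T \ {A} := ⟨h1, hne⟩
  rw [hAB] at h3
  exact h2 h3.1

theorem IsMutable.exists_interlace [NeZero m] (ht : StrictMono t) (hd : 1 ≤ d)
    {A : Finset (Fin m)} (h : IsMutable d t T A) :
    ∃ B, B.card = d + 1 ∧ Interlace A B ∧ ∀ b ∈ B, (A ∪ B).erase b ∈ T := by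
  obtain ⟨-, T', ⟨hT, hT', Z, hZ, hU, hU', hne, -⟩, B, -, hAB⟩ := h
  obtain ⟨A₀, B₀, rfl, hA₀, hB₀, hI⟩ := exists_alternating hZ
  have hmem : ∀ {C : Finset (Finset (Fin m))} {Y D : Finset (Fin m)},
      C.filter (fun S => S ⊆ Y) = D.image Y.erase → ∀ b ∈ D, Y.erase b ∈ C := by
    intro C Y D h b hb
    have : Y.erase b ∈ C.filter (fun S => S ⊆ Y) := by rw [h]; exact Finset.mem_image_of_mem _ hb
    exact (Finset.mem_filter.1 this).1
  rcases hI.triangulation_eq ht hA₀ hB₀ hU with h | h <;>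
    rcases hI.triangulation_eq ht hA₀ hB₀ hU' with h' | h'
  · exact (hne (h.trans h'.symm)).elim
  · have := eq_of_flip ht hd hT' hI hA₀ hB₀ (hmem h) (hmem h') hAB
    subst this
    exact ⟨B₀, hB₀, hI, hmem h⟩
  · have h1 := hmem h
    have h2 := hmem h'
    rw [Finset.union_comm] at h1 h2
    have := eq_of_flip ht hd hT' hI.symm hB₀ hA₀ h1 h2 hAB
    subst this
    exact ⟨A₀, hA₀, hI.symm, h1⟩
  · exact (hne (h.trans h'.symm)).elim

/-- Replace the members (A ∪ B) \ {b} of T by all (A ∪ B) \ {a}. Only A is lost and only B is gained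
among the d-arcs. -/
theorem Interlace.isMutable (hT : IsTriangulation (2 * d) t T) (ht : StrictMono t) (hd : 1 ≤ d)
    {A B : Finset (Fin m)} (hI : Interlace A B) (hA : A.card = d + 1) (hB : B.card = d + 1)
    (h : ∀ b ∈ B, (A ∪ B).erase b ∈ T) : IsMutable d t T A := by
  classical
  obtain ⟨b₀, hb₀⟩ : B.Nonempty := Finset.card_pos.1 (by omega)
  obtain ⟨a₀, ha₀⟩ : A.Nonempty := Finset.card_pos.1 (by omega)
  set Z := A ∪ B with hZdef
  have hTB : IsTriangulationOn (2 * d) t Z (B.image Z.erase) := hI.isTriangulationOn ht hA hB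
  have hTA : IsTriangulationOn (2 * d) t Z (A.image Z.erase) := by
    rw [hZdef, Finset.union_comm]; exact hI.symm.isTriangulationOn ht hB hA
  have hZc : Z.card = 2 * d + 2 := hI.card_union hA hB
  have hinj : ∀ a ∈ A, ∀ b ∈ B, Z.erase a ≠ Z.erase b := by
    intro a ha b hb e
    have h1 : a ∈ Z.erase b := hI.subset_erase hb ha
    rw [← e] at h1
    exact Finset.notMem_erase _ _ h1
  have hfilter : T.filter (fun S => S ⊆ Z) = B.image Z.erase := by
    ext S
    rw [Finset.mem_filter, Finset.mem_image]
    constructor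
    · rintro ⟨hS, hSZ⟩
      obtain ⟨z, hz, rfl⟩ := exists_erase_eq hSZ (hT.1 S hS).2 hZc
      rcases Finset.mem_union.1 hz with hz | hz
      · exact (hI.erase_meet ht hA hB hz hb₀ (hT.2.1 _ hS _ (h b₀ hb₀)
          (hinj z hz b₀ hb₀))).elim
      · exact ⟨z, hz, rfl⟩
    · rintro ⟨b, hb, rfl⟩
      exact ⟨h b hb, Finset.erase_subset _ _⟩
  set T' := T.filter (fun S => ¬ S ⊆ Z) ∪ A.image Z.erase with hT'def
  have hAimg : ∀ S ∈ A.image Z.erase, S ⊆ Z := fun S hS => (hTA.1 S hS).1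
  have hfilter' : T'.filter (fun S => S ⊆ Z) = A.image Z.erase := by
    ext S
    simp only [hT'def, Finset.mem_filter, Finset.mem_union]
    constructor
    · rintro ⟨h1 | h1, h2⟩
      · exact (h1.2 h2).elim
      · exact h1
    · exact fun h1 => ⟨Or.inr h1, hAimg S h1⟩
  have hfiltern : T'.filter (fun S => ¬ S ⊆ Z) = T.filter (fun S => ¬ S ⊆ Z) := by
    ext S
    simp only [hT'def, Finset.mem_filter, Finset.mem_union]
    constructor
    · rintro ⟨h1 | h1, h2⟩
      · exact h1
      · exact (h2 (hAimg S h1)).elim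
    · exact fun h1 => ⟨Or.inl h1, h1.2⟩
  -- The polytope |Z| is already covered by members of T inside Z, so the interior of any other
  -- member of T cannot meet a new simplex.
  have hmixed : ∀ S ∈ T, ¬ S ⊆ Z → ∀ S' ∈ A.image Z.erase,
      Disjoint (interior (realization (2 * d) t S)) (interior (realization (2 * d) t S')) := by
    intro S hS hSZ S' hS'
    rw [Set.disjoint_left]
    intro x hx hx'
    obtain ⟨b, hb, hxb⟩ := hI.cover ht hA hB
      (realization_mono (hAimg S' hS') (interior_subset hx'))
    obtain ⟨y, hy, hy'⟩ := inter_interior_nonempty ht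
      (hI.card_erase hA hB (Finset.mem_union_right _ hb)) isOpen_interior hx hxb
    exact Set.disjoint_left.1 (hT.2.1 S hS _ (h b hb) fun e =>
      hSZ (e ▸ Finset.erase_subset _ _)) hy hy'
  have hT' : IsTriangulation (2 * d) t T' := by
    refine ⟨fun S hS => ⟨Finset.subset_univ _, ?_⟩, fun S hS S' hS' hne => ?_, ?_⟩
    · rcases Finset.mem_union.1 hS with hS | hS
      · exact (hT.1 S (Finset.mem_filter.1 hS).1).2
      · exact (hTA.1 S hS).2
    · rcases Finset.mem_union.1 hS with hS | hS <;> rcases Finset.mem_union.1 hS' with hS' | hS'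
      · exact hT.2.1 S (Finset.mem_filter.1 hS).1 S' (Finset.mem_filter.1 hS').1 hne
      · exact hmixed S (Finset.mem_filter.1 hS).1 (Finset.mem_filter.1 hS).2 S' hS'
      · exact (hmixed S' (Finset.mem_filter.1 hS').1 (Finset.mem_filter.1 hS').2 S hS).symm
      · exact hTA.2.1 S hS S' hS' hne
    · refine Set.Subset.antisymm (Set.iUnion₂_subset fun S _ =>
        realization_mono (Finset.subset_univ _)) ?_
      rw [← hT.2.2]
      refine Set.iUnion₂_subset fun S hS x hx => ?_
      simp only [Set.mem_iUnion]
      by_cases hSZ : S ⊆ Z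
      · have hx' := realization_mono hSZ hx
        rw [← hTA.2.2] at hx'
        simp only [Set.mem_iUnion] at hx'
        obtain ⟨S', hS', hx'⟩ := hx'
        exact ⟨S', Finset.mem_union_right _ hS', hx'⟩
      · exact ⟨S, Finset.mem_union_left _ (Finset.mem_filter.2 ⟨hS, hSZ⟩), hx⟩
  have hBsub : ∀ a ∈ A, B ⊆ Z.erase a := fun a ha => by
    rw [hZdef, Finset.union_comm]; exact hI.symm.subset_erase ha
  -- A (d+1)-subset of Z other than E misses an element of E. With E = A or E = B it is therefore
  -- still a face after the exchange in either direction.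
  have hmiss : ∀ {D E : Finset (Fin m)}, D.card = d + 1 → E.card = d + 1 → D ≠ E → D ⊆ Z →
      ∃ e ∈ E, D ⊆ Z.erase e := by
    intro D E hD hE hne hDZ
    have : ¬ E ⊆ D := fun hs => hne (Finset.eq_of_subset_of_card_le hs (by omega)).symm
    obtain ⟨e, he, heD⟩ := Finset.not_subset.1 this
    exact ⟨e, he, fun v hv => Finset.mem_erase.2 ⟨fun h => heD (h ▸ hv), hDZ hv⟩⟩
  have hAarc : A ∈ dArcs d t T := hI.mem_dArcs ht hA hB (h b₀ hb₀) (hI.subset_erase hb₀)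
  refine ⟨hAarc, T', ⟨hT, hT', Z, hZc, ?_, ?_, ?_, hfiltern.symm⟩, B, ?_, ?_⟩
  · rw [hfilter]; exact hTB
  · rw [hfilter']; exact hTA
  · rw [hfilter, hfilter']
    intro e
    have : Z.erase b₀ ∈ A.image Z.erase := by rw [← e]; exact Finset.mem_image_of_mem _ hb₀
    obtain ⟨a, ha, hab⟩ := Finset.mem_image.1 this
    exact hinj a ha b₀ hb₀ hab
  · exact hI.symm.mem_dArcs ht hB hA
      (Finset.mem_union_right _ (Finset.mem_image_of_mem _ ha₀)) (hBsub a₀ ha₀)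
  · have hBT' : Z.erase a₀ ∈ T' := Finset.mem_union_right _ (Finset.mem_image_of_mem _ ha₀)
    ext D
    constructor
    · rintro ⟨⟨hD, ⟨S, hS, hDS⟩, hint⟩, hDA⟩
      refine ⟨⟨hD, ?_, hint⟩, ?_⟩
      · by_cases hSZ : S ⊆ Z
        · obtain ⟨a, ha, hDa⟩ := hmiss hD hA hDA (hDS.trans hSZ)
          exact ⟨_, Finset.mem_union_right _ (Finset.mem_image_of_mem _ ha), hDa⟩
        · exact ⟨S, Finset.mem_union_left _ (Finset.mem_filter.2 ⟨hS, hSZ⟩), hDS⟩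
      · rintro rfl
        exact hT.not_interlace ht hd hA hB (h b₀ hb₀) hS (hI.subset_erase hb₀) hDS hI
    · rintro ⟨⟨hD, ⟨S, hS, hDS⟩, hint⟩, hDB⟩
      refine ⟨⟨hD, ?_, hint⟩, ?_⟩
      · rcases Finset.mem_union.1 hS with hS | hS
        · exact ⟨S, (Finset.mem_filter.1 hS).1, hDS⟩
        · obtain ⟨b, hb, hDb⟩ := hmiss hD hB hDB (hDS.trans (hAimg S hS))
          exact ⟨_, h b hb, hDb⟩
      · rintro rfl
        exact hT'.not_interlace ht hd hA hB hS hBT' hDS (hBsub a₀ ha₀) hI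

theorem exists_arc_mem {A : Finset (Fin m)} {nx : Fin m → Fin m}
    (hnx : ∀ a ∈ A, nx a ∈ A ∧ nx a ≠ a ∧ ∀ c ∈ A, ¬ Cyc a c (nx a)) (hA : A.Nonempty)
    {v : Fin m} (hv : v ∉ A) : ∃ a ∈ A, Cyc a v (nx a) := by
  obtain ⟨a, ha, hmin⟩ := Finset.exists_min_image A (fun x => (v - x).val) hA
  refine ⟨a, ha, ?_⟩
  obtain ⟨h1, h2, -⟩ := hnx a ha
  have h3 := hmin _ h1
  have hva : v ≠ a := fun e => hv (e ▸ ha)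
  have hvn : v ≠ nx a := fun e => hv (e ▸ h1)
  rw [Ne, Fin.ext_iff] at h2 hva hvn
  rw [sub_val_eq, sub_val_eq] at h3
  have := v.2
  have := a.2
  have := (nx a).2
  unfold Cyc NatCyc
  split_ifs at h3 <;> omega

/-- If every gap of an internal `d`-simplex contains at most one vertex of its link, then it is
mutable. -/
theorem isMutable_of_link [NeZero m] (hT : IsTriangulation (2 * d) t T) (ht : StrictMono t)
    (hd : 1 ≤ d) {A : Finset (Fin m)} (hAT : A ∈ dArcs d t T)
    (hlink : ∀ a ∈ A, ∀ n ∈ A, a ≠ n → (∀ c ∈ A, ¬ Cyc a c n) → ∀ S ∈ T, ∀ S' ∈ T, A ⊆ S → A ⊆ S' →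
      ∀ v ∈ S, ∀ v' ∈ S', Cyc a v n → Cyc a v' n → v = v') : IsMutable d t T A := by
  classical
  obtain ⟨hA, ⟨S₀, hS₀, hAS₀⟩, hint⟩ := hAT
  have hm : 2 * d + 1 ≤ m := by
    have := Finset.card_le_univ S₀
    rw [(hT.1 S₀ hS₀).2, Fintype.card_fin] at this
    exact this
  have hI₁ := (nonAdj_of_not_in_facet hd hm ht hA hint).interlace (by omega)
  have hstar := hT.exists_star ht hd hA ((card_image_add_one A).trans hA) hS₀ hAS₀ hI₁
  -- Every arc between elements of A contains a link vertex: represent a label b of the arc in the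
  -- star of A and test with `exists_arcPoly`. The value at b is negative, so some nonnegative
  -- weight off A must sit in the arc.
  have hit : ∀ x ∈ A, ∀ x' ∈ A, x ≠ x' → ∃ v, v ∉ A ∧ Cyc x v x' ∧ ∃ S ∈ T, A ⊆ S ∧ v ∈ S := by
    intro x hx x' hx' hne
    obtain ⟨q, hq, hqA, hqneg, hqpos⟩ := exists_arcPoly ht hd hA hx hx' hne
    obtain ⟨b, hb, hbc⟩ := hI₁.2.1 x hx x' hx' hne
    have hbA : b ∉ A := fun h => Finset.disjoint_left.1 hI₁.1 h hb
    obtain ⟨S, hS, hAS, w, hw1, hw2, hrel⟩ := hstar (Pi.single b 1)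
    have h1 := hrel.sum_eval hq
    by_contra! hcon
    have h2 : 0 ≤ ∑ v, w v * q.eval (t v) := by
      refine Finset.sum_nonneg fun v _ => ?_
      by_cases hvA : v ∈ A
      · rw [hqA v hvA, mul_zero]
      · by_cases hvS : v ∈ S
        · by_cases hc : Cyc x v x'
          · exact (hcon v hvA hc S hS hAS hvS).elim
          · exact mul_nonneg (hw2 v hvA) (hqpos v hvA hc).le
        · rw [hw1 v hvS, zero_mul]
    have h3 := hqneg b hbA hbc
    simp [sub_mul, Finset.sum_sub_distrib, Pi.single_apply] at h1
    linarith
  obtain ⟨nx, hnx⟩ := exists_nextFun (A := A) (by omega)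
  have hf : ∀ a, ∃ v, a ∈ A → v ∉ A ∧ Cyc a v (nx a) ∧ ∃ S ∈ T, A ⊆ S ∧ v ∈ S := by
    intro a
    by_cases ha : a ∈ A
    · obtain ⟨v, hv⟩ := hit a ha _ (hnx a ha).1 (hnx a ha).2.1.symm
      exact ⟨v, fun _ => hv⟩
    · exact ⟨a, fun h => absurd h ha⟩
  choose f hf using hf
  set C := A.image f with hC
  have hCc : C.card = d + 1 := by
    rw [hC, Finset.card_image_of_injOn, hA]
    intro a ha a' ha' e
    by_contra hne
    have h2 := (hf a' ha').2.1
    rw [← e] at h2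
    exact arc_disjoint hne (hf a ha).2.1 h2 ((hnx a ha).2.2 _ ha') ((hnx a' ha').2.2 _ ha)
  have harc : ∀ a ∈ A, ∀ a' ∈ A, a ≠ a' → Cyc a (f a) a' := by
    intro a ha a' ha' hne
    have h1 := (hf a ha).2.1
    have h2 := (hnx a ha).2.2 a' ha'
    rw [Ne, Fin.ext_iff] at hne
    unfold Cyc NatCyc at *
    omega
  have hI : Interlace A C := by
    refine ⟨?_, ?_, ?_⟩
    · rw [Finset.disjoint_left]
      intro v hv hv'
      obtain ⟨a, ha, rfl⟩ := Finset.mem_image.1 hv'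
      exact (hf a ha).1 hv
    · exact fun x hx x' hx' hne => ⟨f x, Finset.mem_image_of_mem _ hx, harc x hx x' hx' hne⟩
    · intro y hy y' hy' hne
      obtain ⟨a, ha, rfl⟩ := Finset.mem_image.1 hy
      obtain ⟨a', ha', rfl⟩ := Finset.mem_image.1 hy'
      have hne' : a ≠ a' := fun e => hne (by rw [e])
      refine ⟨a', ha', ?_⟩
      have h1 := harc a ha a' ha' hne'
      have h2 := harc a' ha' a ha hne'.symm
      unfold Cyc NatCyc at *
      omega
  have hstarC : ∀ S ∈ T, A ⊆ S → ∃ c ∈ C, S = (A ∪ C).erase c := by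
    intro S hS hAS
    have hSZ : S ⊆ A ∪ C := by
      intro v hv
      by_cases hvA : v ∈ A
      · exact Finset.mem_union_left _ hvA
      · obtain ⟨a, ha, hva⟩ := exists_arc_mem hnx (Finset.card_pos.1 (by omega)) hvA
        obtain ⟨-, h2, S', hS', hAS', hfS'⟩ := hf a ha
        rw [hlink a ha _ (hnx a ha).1 (hnx a ha).2.1.symm (hnx a ha).2.2 S hS S' hS' hAS hAS' v hv
          _ hfS' hva h2]
        exact Finset.mem_union_right _ (Finset.mem_image_of_mem _ ha)
    obtain ⟨c, hc, rfl⟩ := exists_erase_eq hSZ (hT.1 S hS).2 (hI.card_union hA hCc)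
    refine ⟨c, (Finset.mem_union.1 hc).resolve_left fun h => ?_, rfl⟩
    exact Finset.notMem_erase _ _ (hAS h)
  refine hI.isMutable hT ht hd hA hCc fun c hc => ?_
  obtain ⟨ω, hω, hωA, hωC, hω0⟩ := hI.exists_circuit ht hA hCc
  -- The direction towards C \ {c} lies in the star. If the simplex found omits c' ≠ c, the
  -- resulting dependence is a multiple of the circuit equal to 1 at c' and nonpositive at c,
  -- although the circuit has the same sign at both.
  obtain ⟨S, hS, hAS, w, hw1, hw2, hrel⟩ := hstar fun v => if v ∈ C.erase c then 1 else 0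
  obtain ⟨c', hc', rfl⟩ := hstarC S hS hAS
  by_cases hcc : c' = c
  · rwa [hcc] at hS
  exfalso
  have hcA : c ∉ A := fun h => Finset.disjoint_left.1 hI.1 h hc
  have hω0' : ∀ v ∉ A ∪ C, ω v = 0 := fun v hv => by
    have : v ∉ A ∧ v ∉ C := by simpa using hv
    exact hω0 v this.1 this.2
  set ρ : Fin m → ℝ := (fun v => if v ∈ C.erase c then 1 else 0) - w with hρ
  have hρ0 : ∀ v ∉ A ∪ C, ρ v = 0 := fun v hv => by
    have h1 : v ∉ C := fun h => hv (Finset.mem_union_right _ h)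
    simp [hρ, hw1 v fun h => hv (Finset.mem_of_mem_erase h), h1]
  have key := hrel.eq_smul ht hω (hI.card_union hA hCc).le hρ0 hω0'
    (Finset.mem_union_right _ hc') (hωC c' hc').ne
  have h1 : ρ c' = 1 := by simp [hρ, hw1 c' (Finset.notMem_erase _ _), hcc, hc']
  have h2 : ρ c ≤ 0 := by
    have := hw2 c hcA
    simpa [hρ] using this
  rw [key, h1] at h2
  have h3 := mul_pos_of_neg_of_neg (one_div_neg.2 (hωC c' hc')) (hωC c hc)
  simp only [Pi.smul_apply, smul_eq_mul] at h2
  linarith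

end Flips

/-! ### Entries of cyclic listings -/

section Listings

variable {d m : ℕ}

theorem image_update {k : ℕ} {a : Fin k → Fin m} (ha : Function.Injective a) (i : Fin k)
    (n : Fin m) : Finset.univ.image (Function.update a i n) =
      insert n ((Finset.univ.image a).erase (a i)) := by
  ext v
  simp only [Finset.mem_image, Finset.mem_univ, true_and, Finset.mem_insert, Finset.mem_erase]
  constructor
  · rintro ⟨j, rfl⟩
    by_cases hj : j = i
    · subst hj; simp
    · right
      rw [Function.update_of_ne hj]
      exact ⟨fun e => hj (ha e), j, rfl⟩
  · rintro (rfl | ⟨h, j, rfl⟩)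
    · exact ⟨i, by simp⟩
    · exact ⟨j, by rw [Function.update_of_ne fun e => h (by rw [e])]⟩

theorem not_cyc_pred {l : Fin m} {a : Fin (d + 1) → Fin m} (hd : 1 ≤ d)
    (ha : StrictMono fun j => a j - l) (i j : Fin (d + 1)) :
    ¬ Cyc (a (i - 1)) (a j) (a i) := by
  rw [← natCyc_sub_iff _ _ _ l]
  have hi := sub_one_val (by omega) i
  have hm : ∀ u v : Fin (d + 1), u.val ≤ v.val → (a u - l).val ≤ (a v - l).val := fun u v h =>
    ha.monotone (Fin.le_def.2 h)
  unfold NatCyc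
  have := j.2
  split_ifs at hi with h
  · have h1 := hm i j (by omega)
    have h2 := hm j (i - 1) (by omega)
    omega
  · have h3 := hm (i - 1) i (by omega)
    rcases Nat.lt_or_ge j.val i.val with h1 | h1
    · have h2 := hm j (i - 1) (by omega)
      omega
    · have h2 := hm i j h1
      omega

theorem eq_second_of_next {a : Fin (d + 2) → Fin m}
    (ha : StrictMono fun j => (a j - a 0).val) {n : Fin m} (hn : n ∈ Finset.univ.image a)
    (hne : a 0 ≠ n) (hnext : ∀ c ∈ Finset.univ.image a, ¬ Cyc (a 0) c n) : n = a 1 := by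
  obtain ⟨j, -, rfl⟩ := Finset.mem_image.1 hn
  by_contra hj
  have hj0 : j ≠ 0 := fun e => hne (by rw [e])
  have hj1 : j ≠ 1 := fun e => hj (by rw [e])
  refine hnext (a 1) (Finset.mem_image_of_mem _ (Finset.mem_univ _)) ?_
  rw [cyc_sub_self_iff]
  have h1 := ha (show (0 : Fin (d + 2)) < 1 by simp)
  rw [Ne, Fin.ext_iff] at hj0 hj1
  simp only [Fin.val_zero, Fin.val_one] at hj0 hj1
  have h2 := ha (show (1 : Fin (d + 2)) < j by rw [Fin.lt_def, Fin.val_one]; omega)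
  simp only at h1 h2
  omega

end Listings

/-! ### Retrograde paths avoid mutable arcs -/

section Quiver

variable {d m : ℕ} [NeZero m] {t : Fin m → ℝ} {T : Finset (Finset (Fin m))}

theorem add_single_eq_update {k : ℕ} (a : Fin k → Fin m) (i : Fin k) (r : Fin m) :
    a + Pi.single i r = Function.update a i (a i + r) := by
  ext j
  by_cases hj : j = i
  · subst hj; simp
  · simp [hj]

theorem cyc_of_isCyclicallyOrdered {a b c : Fin m} (h : IsCyclicallyOrdered ![a, b, c]) :
    Cyc a b c := by
  obtain ⟨l, hl⟩ := h
  have h1 : (a - l).val < (b - l).val := by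
    exact hl (show (0 : Fin 3) < 1 by decide)
  have h2 : (b - l).val < (c - l).val := by
    exact hl (show (1 : Fin 3) < 2 by decide)
  exact (natCyc_sub_iff _ _ _ l).1 (Or.inl ⟨h1, h2⟩)

/-- The elements that are exchanged along a path that is retrograde in the middle. -/
theorem IsRetrogradeAt.exists_exchange (hd : 1 ≤ d) (hm : 1 < m) {X Y Z : Finset (Fin m)}
    (h : IsRetrogradeAt d t T X Y Z) : ∃ p p' x n : Fin m, p ∈ X ∧ x ∈ X ∧ n ∉ X ∧ p ≠ x ∧
      (∀ c ∈ X, ¬ Cyc p c x) ∧ Y = insert n (X.erase x) ∧ Z = insert p' (Y.erase p) ∧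
      Cyc p p' x ∧ Cyc p x n ∧ ∀ c ∈ X, ¬ Cyc x c n := by
  obtain ⟨⟨-, -, hXY, hint, -⟩, -, a, i, r, s, ⟨⟨l, ha⟩, rfl⟩, ⟨⟨l', ha'⟩, hY⟩, ⟨-, hZ⟩, hc⟩ := h
  rw [add_single_eq_update] at ha' hY hZ
  rw [add_single_eq_update] at hZ
  have hii : i - 1 ≠ i := by
    intro e
    have := sub_one_val (by omega) i
    rw [e] at this
    split_ifs at this <;> omega
  have hinj : Function.Injective a := fun u v e => ha.injective (by simp [e])
  have hinj' : Function.Injective (Function.update a i (a i + r)) := fun u v e =>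
    ha'.injective (by simp only [e])
  set n := a i + r
  clear_value n
  have hpY : a (i - 1) ∈ Y := by
    rw [← hY]
    exact Finset.mem_image.2 ⟨i - 1, Finset.mem_univ _, by rw [Function.update_of_ne hii]⟩
  have hnY : n ∈ Y := by
    rw [← hY]
    exact Finset.mem_image.2 ⟨i, Finset.mem_univ _, by rw [Function.update_self]⟩
  have hpredY : ∀ c ∈ Y, ¬ Cyc (a (i - 1)) c n := by
    intro c hcY
    rw [← hY] at hcY
    obtain ⟨j, -, rfl⟩ := Finset.mem_image.1 hcY
    have := not_cyc_pred hd ha' i j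
    rwa [Function.update_of_ne hii, Function.update_self] at this
  rw [image_update hinj'] at hZ
  rw [Function.update_of_ne hii] at hZ
  have hY' := hY
  rw [image_update hinj] at hY'
  have hpred : ∀ c ∈ Finset.univ.image a, ¬ Cyc (a (i - 1)) c (a i) := by
    intro c hcX
    obtain ⟨j, -, rfl⟩ := Finset.mem_image.1 hcX
    exact not_cyc_pred hd ha i j
  have hnx : n ≠ a i := by
    intro e
    apply hXY
    rw [← hY', e, Finset.insert_erase]
    exact Finset.mem_image_of_mem _ (Finset.mem_univ _)
  have hnX : n ∉ Finset.univ.image a := by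
    intro hn
    obtain ⟨j, -, hj⟩ := Finset.mem_image.1 hn
    have hji : j ≠ i := fun e => hnx (by rw [← hj, e])
    exact hji (hinj' (by rw [Function.update_of_ne hji, Function.update_self, hj]))
  have hpn : a (i - 1) ≠ n := fun e =>
    hnX (e ▸ Finset.mem_image_of_mem _ (Finset.mem_univ _))
  have hpx : a (i - 1) ≠ a i := fun e => hii (hinj e)
  -- The arrow X → Y puts some u - 1 with u in X strictly between the neighbours p and n of Y. Only
  -- u = x is possible, since any other u would lie in Y between p and n. So x moves forward to n.
  have hpxn : Cyc (a (i - 1)) (a i) n := by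
    obtain ⟨u', hu', hcu⟩ := hint.interlace.2.2.2.2 _ hpY _ hnY hpn
    obtain ⟨u, hu, rfl⟩ := Finset.mem_image.1 hu'
    have hsub := sub_one_val hm u
    by_cases hux : u = a i
    · rw [← hux] at hnx hpx ⊢
      rw [Ne, Fin.ext_iff] at hpx hnx
      unfold Cyc NatCyc at *
      have := u.2
      have := n.2
      have := (a (i - 1)).2
      split_ifs at hsub <;> omega
    · have huY : u ∈ Y := by
        rw [← hY']
        exact Finset.mem_insert_of_mem (Finset.mem_erase.2 ⟨hux, hu⟩)
      have h1 := hpredY u huY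
      have hun : u ≠ n := fun e => hnX (e ▸ hu)
      rw [Ne, Fin.ext_iff] at hun hpn
      exfalso
      unfold Cyc NatCyc at *
      have := u.2
      have := n.2
      have := (a (i - 1)).2
      split_ifs at hsub <;> omega
  refine ⟨a (i - 1), a (i - 1) + s, a i, n, Finset.mem_image_of_mem _ (Finset.mem_univ _),
    Finset.mem_image_of_mem _ (Finset.mem_univ _), hnX, hpx, hpred, hY'.symm,
    by rw [← hZ, hY], cyc_of_isCyclicallyOrdered hc, hpxn, fun c hcX hcyc => ?_⟩
  have hcx : c ≠ a i := by
    rintro rfl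
    unfold Cyc NatCyc at hcyc
    omega
  refine hpredY c (by rw [← hY']; exact Finset.mem_insert_of_mem (Finset.mem_erase.2 ⟨hcx, hcX⟩)) ?_
  unfold Cyc NatCyc at *
  omega

/-- A mutable `d`-arc is not in the middle of a retrograde path. -/
theorem IsMutable.not_isRetrogradeAt (hT : IsTriangulation (2 * d) t T) (ht : StrictMono t)
    (hd : 1 ≤ d) (hm : 1 < m) {X A Z : Finset (Fin m)} (hA : IsMutable d t T A) :
    ¬ IsRetrogradeAt d t T X A Z := by
  intro h
  obtain ⟨B, hB, hI, hflip⟩ := hA.exists_interlace ht hd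
  obtain ⟨p, p', x, n, hpX, hxX, hnX, hpx, hprev, hAeq, hZeq, hpp'x, hpxn, hnext⟩ :=
    h.exists_exchange hd hm
  have hAc : A.card = d + 1 := hA.1.1
  obtain ⟨⟨⟨-, ⟨SX, hSX, hXS⟩, -⟩, -⟩, ⟨-, ⟨-, ⟨SZ, hSZ, hZS⟩, -⟩, -⟩, -⟩ := h
  have hpA : p ∈ A := by rw [hAeq]; exact Finset.mem_insert_of_mem (Finset.mem_erase.2 ⟨hpx, hpX⟩)
  have hnA : n ∈ A := by rw [hAeq]; exact Finset.mem_insert_self _ _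
  have hpn : p ≠ n := fun e => hnX (e ▸ hpX)
  have hnextA : ∀ c ∈ A, ¬ Cyc p c n := by
    intro c hc
    rw [hAeq] at hc
    rcases Finset.mem_insert.1 hc with rfl | hc
    · unfold Cyc NatCyc; omega
    · obtain ⟨hcx, hcX⟩ := Finset.mem_erase.1 hc
      have h1 := hprev c hcX
      have h2 := hnext c hcX
      rw [Ne, Fin.ext_iff] at hcx
      unfold Cyc NatCyc at *
      omega
  obtain ⟨a, b, rfl, ha, hb, hab, hba⟩ := hI.exists_listing hAc hB hd hpA
  obtain ⟨hα, hβ, -⟩ := alternating_lt (α := fun i => (a i - a 0).val)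
    (β := fun i => (b i - a 0).val) hab hba
  have hbmem : ∀ j, b j ∈ B := fun j => by rw [← hb]; simp
  have hamem : ∀ j, a j ∈ A := fun j => by rw [← ha]; simp
  have hbinj : ∀ i j, i ≠ j → b i ≠ b j := fun i j hij e => hij (hβ.injective (by simp [e]))
  have hainj : ∀ i j, i ≠ j → a i ≠ a j := fun i j hij e => hij (hα.injective (by simp [e]))
  have habne : ∀ i j, a i ≠ b j := fun i j e =>
    Finset.disjoint_left.1 hI.1 (hamem i) (e ▸ hbmem j)
  obtain ⟨e, rfl⟩ : ∃ e, d = e + 1 := ⟨d - 1, by omega⟩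
  have hn1 : n = a 1 := eq_second_of_next hα (by rw [ha]; exact hnA) hpn (by rw [ha]; exact hnextA)
  subst hn1
  rw [cyc_sub_self_iff] at hpp'x hpxn
  rcases Nat.lt_or_ge (p' - a 0).val (b 0 - a 0).val with hcase | hcase
  -- Here a 0 < p' < b 0 < a 1 < b 1 < … < b (d - 1) < a d, so Z crosses a face that omits b d.
  · let w : Fin (e + 1 + 1) → Fin m := Fin.cons (a 0) fun j => b j.castSucc
    let z : Fin (e + 1 + 1) → Fin m := Fin.cons p' fun j => a j.succ
    have hWZ : Intertwining (e + 1) (Finset.univ.image w) (Finset.univ.image z) := by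
      refine ⟨w, z, rfl, rfl, a 0, fun i => ?_, fun i => ?_⟩
      · rw [Fin.lt_def]
        refine Fin.cases ?_ (fun j => ?_) i
        · simp only [w, z, Fin.cons_zero, sub_self_val]; exact hpp'x.1
        · simp only [w, z, Fin.cons_succ]; exact hba j
      · rw [Fin.lt_def]
        refine Fin.cases ?_ (fun j => ?_) i
        · simp only [w, z, Fin.cons_succ, Fin.castSucc_zero, Fin.cons_zero]; exact hcase
        · simp only [w, z, Fin.cons_succ, ← Fin.succ_castSucc]; exact hab _
    obtain ⟨h1, h2, h3⟩ := hWZ.interlace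
    refine hT.not_interlace ht hd h1 h2 (hflip _ (hbmem (Fin.last _))) hSZ ?_ ?_ h3
    · intro v hv
      obtain ⟨j, -, rfl⟩ := Finset.mem_image.1 hv
      refine Fin.cases ?_ (fun j => ?_) j
      · exact Finset.mem_erase.2 ⟨habne _ _, Finset.mem_union_left _ (hamem 0)⟩
      · exact Finset.mem_erase.2 ⟨hbinj _ _ (Fin.castSucc_lt_last j).ne,
          Finset.mem_union_right _ (hbmem _)⟩
    · intro v hv
      obtain ⟨j, -, rfl⟩ := Finset.mem_image.1 hv
      apply hZS
      rw [hZeq]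
      refine Fin.cases ?_ (fun j => ?_) j
      · exact Finset.mem_insert_self _ _
      · exact Finset.mem_insert_of_mem (Finset.mem_erase.2
          ⟨hainj _ _ (Fin.succ_ne_zero j), hamem _⟩)
  -- Here b 0 ≤ p' < x, so a 0 < b 0 < x < a 1 < a 2 < b 2 < …, and X crosses a face that omits b 1.
  · let w : Fin (e + 1 + 1) → Fin m := Function.update b 1 (a 1)
    let z : Fin (e + 1 + 1) → Fin m := Function.update a 1 x
    have h10 : (0 : Fin (e + 1 + 1)) ≠ 1 := by simp
    have hss : ∀ j : Fin e, j.succ.succ ≠ (1 : Fin (e + 1 + 1)) := fun j h => by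
      rw [Fin.ext_iff] at h; simp at h
    have hZW : Intertwining (e + 1) (Finset.univ.image z) (Finset.univ.image w) := by
      refine ⟨z, w, rfl, rfl, a 0, fun i => ?_, fun i => ?_⟩
      · rw [Fin.lt_def]
        by_cases hi : i = 1
        · subst hi
          simp only [w, z, Function.update_self]; exact hpxn.2
        · simp only [w, z, Function.update_of_ne hi]; exact hab i
      · rw [Fin.lt_def]
        by_cases hi : i = 0
        · subst hi
          simp only [w, z, Fin.castSucc_zero, Function.update_of_ne h10, Fin.succ_zero_eq_one,
            Function.update_self]
          omega
        · have hi' : i.val ≠ 0 := fun h => hi (Fin.ext h)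
          have hsucc : i.succ ≠ 1 := by
            rw [Ne, Fin.ext_iff, Fin.val_succ, Fin.val_one]; omega
          simp only [w, z, Function.update_of_ne hsucc]
          by_cases hi1 : i.castSucc = 1
          · rw [hi1, Function.update_self]
            have : (1 : Fin (e + 1 + 1)) < i.succ := by rw [← hi1]; exact Fin.castSucc_lt_succ
            exact hα this
          · rw [Function.update_of_ne hi1]; exact hba i
    obtain ⟨h1, h2, h3⟩ := hZW.interlace
    refine hT.not_interlace ht hd h1 h2 hSX (hflip _ (hbmem 1)) ?_ ?_ h3
    · intro v hv
      obtain ⟨j, -, rfl⟩ := Finset.mem_image.1 hv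
      apply hXS
      by_cases hj : j = 1
      · subst hj; simp only [z, Function.update_self]; exact hxX
      · simp only [z, Function.update_of_ne hj]
        have h4 := hamem j
        rw [hAeq] at h4
        rcases Finset.mem_insert.1 h4 with h4 | h4
        · exact (hainj _ _ hj h4).elim
        · exact (Finset.mem_erase.1 h4).2
    · intro v hv
      obtain ⟨j, -, rfl⟩ := Finset.mem_image.1 hv
      by_cases hj : j = 1
      · subst hj
        simp only [w, Function.update_self]
        exact Finset.mem_erase.2 ⟨habne _ _, Finset.mem_union_left _ (hamem 1)⟩
      · simp only [w, Function.update_of_ne hj]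
        exact Finset.mem_erase.2 ⟨hbinj _ _ hj, Finset.mem_union_right _ (hbmem _)⟩

end Quiver

/-! ### Iterated exchanges -/

section Paths

variable {d m : ℕ}

/-- A sequence of exchanges that moves the elements of a set one after the other, each of them to a
place before the previous one, ends with a set that intertwines with the initial one. -/
theorem exists_intertwining_of_exchanges [NeZero m] (P : ℕ → Finset (Fin m)) (X N : ℕ → Fin m)
    (hcard : (P 0).card = d + 1) (hX0 : X 0 ∈ P 0) (hN0 : N 0 ∉ P 0)
    (hN : ∀ c ∈ P 0, ¬ Cyc (X 0) c (N 0))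
    (hstep : ∀ k ≤ d, P (k + 1) = insert (N k) ((P k).erase (X k)))
    (hX : ∀ k < d, X (k + 1) ∈ P k ∧ X (k + 1) ≠ X k ∧ (∀ c ∈ P k, ¬ Cyc (X (k + 1)) c (X k)) ∧
      Cyc (X (k + 1)) (N (k + 1)) (X k)) :
    ∃ C ⊆ P (d + 1), Intertwining d C (P 0) := by
  obtain ⟨a, ha, hmono⟩ := exists_sorted_listing hcard (N 0)
  let φ : Fin m → ℕ := fun v => (v - N 0).val
  have hφ0 : φ (N 0) = 0 := sub_self_val _
  have hφinj : ∀ u v, φ u = φ v → u = v := fun u v h => sub_val_inj.1 h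
  have hcyc : ∀ u v w, Cyc u v w ↔ NatCyc (φ u) (φ v) (φ w) := fun u v w =>
    (natCyc_sub_iff u v w (N 0)).symm
  let α : ℕ → Fin m := fun j => a (Fin.ofNat (d + 1) j)
  have hofNat : ∀ j ≤ d, (Fin.ofNat (d + 1) j).val = j := fun j hj =>
    Nat.mod_eq_of_lt (by omega)
  have hα : ∀ i j, i < j → j ≤ d → φ (α i) < φ (α j) := fun i j hij hj =>
    hmono (by rw [Fin.lt_def, hofNat i (by omega), hofNat j hj]; exact hij)
  have hαle : ∀ i j, i ≤ j → j ≤ d → φ (α i) ≤ φ (α j) := fun i j hij hj => by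
    rcases Nat.eq_or_lt_of_le hij with rfl | h
    · exact le_rfl
    · exact (hα i j h hj).le
  have hαmem : ∀ j, α j ∈ P 0 := fun j => by rw [← ha]; simp [α]
  have hαsurj : ∀ v ∈ P 0, ∃ j ≤ d, v = α j := by
    intro v hv
    rw [← ha] at hv
    obtain ⟨j, -, rfl⟩ := Finset.mem_image.1 hv
    exact ⟨j.val, by omega, by simp [α]⟩
  have hαpos : ∀ j, 0 < φ (α j) := fun j => Nat.pos_of_ne_zero fun h =>
    hN0 (hφinj _ _ (h.trans hφ0.symm) ▸ hαmem j)
  -- With N 0 as origin, X 0 is the last element of P 0, and the elements are moved in decreasing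
  -- order. After k moves the first d + 1 - k are untouched, and any other element of P k is N 0 or
  -- lies beyond α (d - k).
  have key : ∀ k ≤ d, X k = α (d - k) ∧ (∀ j ≤ d - k, α j ∈ P k) ∧
      (∀ v ∈ P k, (∃ j ≤ d - k, v = α j) ∨ φ v = 0 ∨ φ (α (d - k)) < φ v) ∧
      (0 < k → φ (α (d - k)) < φ (N k)) := by
    intro k
    induction k with
    | zero =>
      refine fun _ => ⟨?_, fun j _ => hαmem j, fun v hv => Or.inl (hαsurj v hv),
        fun h => absurd h (lt_irrefl 0)⟩
      obtain ⟨j, hj, hXj⟩ := hαsurj _ hX0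
      rw [Nat.sub_zero]
      by_cases hjd : j = d
      · rw [hXj, hjd]
      · exfalso
        refine hN _ (hαmem d) ?_
        rw [hcyc, hφ0, hXj]
        have := hα j d (by omega) le_rfl
        have := hαpos j
        unfold NatCyc; omega
    | succ k ih =>
      intro hk
      obtain ⟨h1, h2, h3, h3'⟩ := ih (by omega)
      obtain ⟨h4, h5, h6, h7⟩ := hX k (by omega)
      have hlt := hα (d - (k + 1)) (d - k) (by omega) (by omega)
      have hp := hαpos (d - (k + 1))
      have hXk : X (k + 1) = α (d - (k + 1)) := by
        have h8 := h6 _ (h2 (d - (k + 1)) (by omega))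
        rw [hcyc, h1] at h8
        rcases h3 _ h4 with ⟨j, hj, hXj⟩ | h | h
        · by_cases hj1 : j = d - k
          · exact (h5 (by rw [h1, hXj, hj1])).elim
          · by_cases hj2 : j = d - (k + 1)
            · rw [hXj, hj2]
            · have := hα j (d - (k + 1)) (by omega) (by omega)
              rw [hXj] at h8
              unfold NatCyc at h8; omega
        · unfold NatCyc at h8; omega
        · unfold NatCyc at h8; omega
      refine ⟨hXk, fun j hj => ?_, fun v hv => ?_, fun _ => ?_⟩
      · rw [hstep k (by omega)]
        refine Finset.mem_insert_of_mem (Finset.mem_erase.2 ⟨fun e => ?_, h2 j (by omega)⟩)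
        have := hα j (d - k) (by omega) (by omega)
        rw [e, h1] at this
        omega
      · rw [hstep k (by omega)] at hv
        rcases Finset.mem_insert.1 hv with rfl | hv
        · rcases Nat.eq_zero_or_pos k with rfl | hk0
          · exact Or.inr (Or.inl hφ0)
          · have := h3' hk0
            exact Or.inr (Or.inr (by omega))
        · obtain ⟨hvX, hv⟩ := Finset.mem_erase.1 hv
          rcases h3 v hv with ⟨j, hj, rfl⟩ | h | h
          · left
            refine ⟨j, ?_, rfl⟩
            have : j ≠ d - k := fun e => hvX (by rw [h1, e])
            omega
          · exact Or.inr (Or.inl h)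
          · exact Or.inr (Or.inr (by omega))
      · rw [hcyc, h1, hXk] at h7
        unfold NatCyc at h7
        omega
  have hNbetween : ∀ k < d, φ (α (d - (k + 1))) < φ (N (k + 1)) ∧ φ (N (k + 1)) < φ (α (d - k)) := by
    intro k hk
    have h1 := (hX k hk).2.2.2
    rw [hcyc, (key k (by omega)).1, (key (k + 1) (by omega)).1] at h1
    have := hα (d - (k + 1)) (d - k) (by omega) (by omega)
    unfold NatCyc at h1; omega
  have hNne : ∀ k j, k < j → j ≤ d → N k ≠ X j := by
    intro k j hkj hj e
    rw [(key j hj).1] at e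
    rcases Nat.eq_zero_or_pos k with rfl | hk0
    · have := hαpos (d - j)
      rw [← e, hφ0] at this
      omega
    · have h1 := (hNbetween (k - 1) (by omega)).1
      rw [show k - 1 + 1 = k by omega, e] at h1
      have := hαle (d - j) (d - k) (by omega) (by omega)
      omega
  have hNmem : ∀ k ≤ d, ∀ j, k < j → j ≤ d + 1 → N k ∈ P j := by
    intro k hk j hj
    induction j, hj using Nat.le_induction with
    | base => intro _; rw [hstep k hk]; exact Finset.mem_insert_self _ _
    | succ j hj ih =>
      intro hjd
      rw [hstep j (by omega)]
      exact Finset.mem_insert_of_mem (Finset.mem_erase.2 ⟨hNne k j hj (by omega), ih (by omega)⟩)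
  -- The final order is N 0 < α 0 < N d < α 1 < N (d - 1) < … < N 1 < α d; the first entry is
  -- special because X 0 is moved past the origin.
  let c : Fin (d + 1) → Fin m := fun i => if i.val = 0 then N 0 else N (d + 1 - i.val)
  have haα : ∀ i : Fin (d + 1), a i = α i.val := fun i => by simp [α]
  refine ⟨Finset.univ.image c, fun v hv => ?_, c, a, rfl, ha, N 0, fun i => ?_, fun i => ?_⟩
  · obtain ⟨i, -, rfl⟩ := Finset.mem_image.1 hv
    simp only [c]
    split_ifs with h
    · exact hNmem 0 (by omega) _ (by omega) le_rfl
    · exact hNmem _ (by omega) _ (by omega) le_rfl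
  · rw [Fin.lt_def]
    change φ (c i) < φ (a i)
    rw [haα]
    simp only [c]
    split_ifs with h
    · rw [hφ0]; exact hαpos _
    · have := (hNbetween (d - i.val) (by omega)).2
      rwa [show d - i.val + 1 = d + 1 - i.val by omega,
        show d - (d - i.val) = i.val by omega] at this
  · rw [Fin.lt_def]
    change φ (a i.castSucc) < φ (c i.succ)
    rw [haα]
    have := (hNbetween (d - (i.val + 1)) (by omega)).1
    rw [show d - (i.val + 1) + 1 = d + 1 - (i.val + 1) by omega,
      show d - (d + 1 - (i.val + 1)) = i.val by omega] at this
    simpa [c] using this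

end Paths

/-! ### Maximal retrograde paths -/

section RetrogradePaths

variable {d m : ℕ} [NeZero m] {t : Fin m → ℝ} {T : Finset (Finset (Fin m))}

theorem infix_triple {α : Type*} {p : List α} {k : ℕ} (hk : k + 2 < p.length) :
    [p[k], p[k + 1], p[k + 2]] <:+: p := by
  refine ⟨p.take k, p.drop (k + 3), ?_⟩
  conv_rhs => rw [← List.take_append_drop k p, List.drop_eq_getElem_cons (by omega),
    List.drop_eq_getElem_cons (by omega), List.drop_eq_getElem_cons (by omega)]
  simp

/-- A retrograde path has at most `d + 1` vertices. -/
theorem IsRetrogradePath.length_le (hT : IsTriangulation (2 * d) t T) (ht : StrictMono t)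
    (hd : 1 ≤ d) (hm : 1 < m) {p : List (Finset (Fin m))} (hp : IsRetrogradePath d t T p) :
    p.length ≤ d + 1 := by
  by_contra! hlen
  let P : ℕ → Finset (Fin m) := fun k => p.getD k ∅
  have hP : ∀ k (hk : k < p.length), P k = p[k] := fun k hk => by simp [P, hk]
  have hretro : ∀ k < d, IsRetrogradeAt d t T (P k) (P (k + 1)) (P (k + 2)) := by
    intro k hk
    rw [hP k (by omega), hP (k + 1) (by omega), hP (k + 2) (by omega)]
    exact hp.2.2 _ _ _ (infix_triple (by omega))
  have hdata : ∀ k, ∃ q q' x n : Fin m, k < d → q ∈ P k ∧ x ∈ P k ∧ n ∉ P k ∧ q ≠ x ∧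
      (∀ c ∈ P k, ¬ Cyc q c x) ∧ P (k + 1) = insert n ((P k).erase x) ∧
      P (k + 2) = insert q' ((P (k + 1)).erase q) ∧ Cyc q q' x ∧ Cyc q x n ∧
      ∀ c ∈ P k, ¬ Cyc x c n := by
    intro k
    by_cases hk : k < d
    · obtain ⟨q, q', x, n, h⟩ := (hretro k hk).exists_exchange hd hm
      exact ⟨q, q', x, n, fun _ => h⟩
    · exact ⟨0, 0, 0, 0, fun h => absurd h hk⟩
  choose q q' x n h using hdata
  -- Consecutive triples overlap in one arrow: the element leaving P (k + 1) is q k in one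
  -- description and x (k + 1) in the other.
  have hcons : ∀ k, k + 1 < d → x (k + 1) = q k := by
    intro k hk
    obtain ⟨-, -, -, -, -, -, h1, -⟩ := h k (by omega)
    obtain ⟨-, h2, h3, -, -, h4, -⟩ := h (k + 1) hk
    by_contra hne
    have h5 : x (k + 1) ∈ P (k + 1 + 1) := by
      change P (k + 1 + 1) = _ at h1
      rw [h1]
      exact Finset.mem_insert_of_mem (Finset.mem_erase.2 ⟨hne, h2⟩)
    rw [h4] at h5
    rcases Finset.mem_insert.1 h5 with h5 | h5
    · exact h3 (h5 ▸ h2)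
    · exact Finset.notMem_erase _ _ h5
  let X : ℕ → Fin m := fun k => if k = 0 then x 0 else q (k - 1)
  let N : ℕ → Fin m := fun k => if k = 0 then n 0 else q' (k - 1)
  have hXx : ∀ k < d, X k = x k := by
    intro k hk
    rcases k with _ | k
    · simp [X]
    · simp [X, hcons k hk]
  obtain ⟨-, h2, h3, -, -, h6, -, -, -, h10⟩ := h 0 (by omega)
  have harc : ∀ k ≤ d, P k ∈ dArcs d t T := by
    intro k hk
    rcases Nat.lt_or_ge k d with hk' | hk'
    · exact (hretro k hk').1.1
    · have := (hretro (k - 1) (by omega)).1.2.1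
      rwa [show k - 1 + 1 = k by omega] at this
  have hlast : P (d + 1) ∈ dArcs d t T := by
    have := (hretro (d - 1) (by omega)).2.1.2.1
    rwa [show d - 1 + 2 = d + 1 by omega] at this
  obtain ⟨C, hC, hint⟩ := exists_intertwining_of_exchanges (d := d) P X N (harc 0 (by omega)).1
    h2 h3 h10 (by
      intro k hk
      rcases k with _ | k
      · exact h6
      · exact (h k (by omega)).2.2.2.2.2.2.1) (by
      intro k hk
      obtain ⟨h1, -, -, h4, h5, -, -, h8, -⟩ := h k hk
      rw [hXx k hk]
      exact ⟨h1, h4, h5, h8⟩)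
  obtain ⟨hc1, hc2, hI⟩ := hint.interlace
  obtain ⟨-, ⟨S, hS, hPS⟩, -⟩ := hlast
  obtain ⟨-, ⟨S', hS', hPS'⟩, -⟩ := harc 0 (by omega)
  exact hT.not_interlace ht hd hc1 hc2 hS hS' (hC.trans hPS) hPS' hI

/-- Without a maximal extension, paths containing p could be lengthened beyond the bound d + 1. -/
theorem IsRetrogradePath.exists_maximal (hT : IsTriangulation (2 * d) t T) (ht : StrictMono t)
    (hd : 1 ≤ d) (hm : 1 < m) {p : List (Finset (Fin m))} (hp : IsRetrogradePath d t T p) :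
    ∃ q, IsMaximalRetrogradePath d t T q ∧ p <:+: q := by
  by_contra! hcon
  have key : ∀ k, ∃ q, IsRetrogradePath d t T q ∧ p <:+: q ∧ k ≤ q.length := by
    intro k
    induction k with
    | zero => exact ⟨p, hp, List.infix_rfl, Nat.zero_le _⟩
    | succ k ih =>
      obtain ⟨q, h1, h2, h3⟩ := ih
      have h4 := mt (fun h => hcon q h) (not_not.2 h2)
      unfold IsMaximalRetrogradePath at h4
      push Not at h4
      obtain ⟨q', h5, h6, h7⟩ := h4 h1
      exact ⟨q', h5, h2.trans h6, by omega⟩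
  obtain ⟨q, h1, -, h3⟩ := key (d + 2)
  have := h1.length_le hT ht hd hm
  omega

theorem IsRetrogradeAt.exists_inMiddle (hT : IsTriangulation (2 * d) t T) (ht : StrictMono t)
    (hd : 1 ≤ d) (hm : 1 < m) {X A Z : Finset (Fin m)} (h : IsRetrogradeAt d t T X A Z) :
    ∃ p, IsMaximalRetrogradePath d t T p ∧ InMiddle A p := by
  have hp : IsRetrogradePath d t T [X, A, Z] := by
    refine ⟨by simp, by simp [h.1, h.2.1], fun X' Y' Z' hinf => ?_⟩
    have := hinf.eq_of_length rfl
    simp only [List.cons.injEq, and_true] at this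
    obtain ⟨rfl, rfl, rfl⟩ := this
    exact h
  obtain ⟨q, hq, s, r, rfl⟩ := hp.exists_maximal hT ht hd hm
  refine ⟨_, hq, s.length + 1, by omega, by
    simp only [List.length_append, List.length_cons]; omega, ?_⟩
  rw [List.append_assoc, List.getElem?_append_right (by omega)]
  simp

theorem IsMaximalRetrogradePath.exists_isRetrogradeAt {A : Finset (Fin m)}
    {p : List (Finset (Fin m))} (hp : IsMaximalRetrogradePath d t T p) (hA : InMiddle A p) :
    ∃ X Z, IsRetrogradeAt d t T X A Z := by
  obtain ⟨i, h1, h2, h3⟩ := hA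
  obtain ⟨i, rfl⟩ : ∃ k, i = k + 1 := ⟨i - 1, by omega⟩
  rw [List.getElem?_eq_some_iff] at h3
  obtain ⟨h4, rfl⟩ := h3
  exact ⟨_, _, hp.1.2.2 _ _ _ (infix_triple (by omega))⟩

end RetrogradePaths

/-! ### Arrows between arcs differing in one element -/

section Arrows

variable {d m : ℕ} [NeZero m] {t : Fin m → ℝ} {T : Finset (Finset (Fin m))}

theorem image_sub_one {k : ℕ} (x : Fin k → Fin m) :
    Finset.univ.image (fun j => x j - 1) = shiftDown (Finset.univ.image x) := by
  rw [shiftDown, Finset.image_image]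
  rfl

theorem sub_sub_one_val (hm : 1 < m) (v l : Fin m) :
    (v - (l - 1)).val = if (v - l).val + 1 = m then 0 else (v - l).val + 1 := by
  rw [← add_one_val hm, show v - (l - 1) = v - l + 1 by abel]

/-- Moving the origin to l - 1 raises the positions of the y j by one, without wrapping round by
`hlast`, while x j - 1 takes over the old position of x j. -/
theorem intertwining_shiftDown (hm : 1 < m) {x y : Fin (d + 1) → Fin m} {l : Fin m}
    (hxy : ∀ j, (x j - l).val ≤ (y j - l).val)
    (hyx : ∀ j : Fin d, (y j.castSucc - l).val + 1 < (x j.succ - l).val)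
    (hlast : (y (Fin.last d) - l).val + 1 < m) :
    Intertwining d (shiftDown (Finset.univ.image x)) (Finset.univ.image y) := by
  have hy : ∀ j, (y j - l).val + 1 < m := by
    intro j
    refine Fin.lastCases hlast (fun j => ?_) j
    have := (x j.succ - l).2
    exact (hyx j).trans this
  have hval : ∀ j, (y j - (l - 1)).val = (y j - l).val + 1 := fun j => by
    rw [sub_sub_one_val hm, if_neg (hy j).ne]
  refine ⟨fun j => x j - 1, y, image_sub_one x, rfl, l - 1, fun j => ?_, fun j => ?_⟩
  · rw [Fin.lt_def, sub_sub_sub_cancel_right, hval]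
    exact Nat.lt_succ_of_le (hxy j)
  · rw [Fin.lt_def, sub_sub_sub_cancel_right, hval]
    exact hyx j

/-- The `d`-simplices between two that differ in a single element. -/
theorem eq_or_intertwining_of_between (hm : 1 < m) (hd : 1 ≤ d) {x y : Fin (d + 1) → Fin m}
    {i : Fin (d + 1)} (hx : StrictMono fun j => (x j - x 0).val)
    (hy : StrictMono fun j => (y j - x 0).val)
    (hxy : ∀ j, j ≠ i → y j = x j) (hi : (x i - x 0).val ≤ (y i - x 0).val)
    {A' : Finset (Fin m)} (hA' : A'.card = d + 1)
    (h1 : Interlace (shiftDown (Finset.univ.image x)) A')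
    (h2 : Interlace (shiftDown A') (Finset.univ.image y)) :
    (∃ w, A' = Finset.univ.image (Function.update x i w) ∧ (x i - x 0).val ≤ (w - x 0).val ∧
      (w - x 0).val ≤ (y i - x 0).val) ∨ Intertwining d (Finset.univ.image y) A' := by
  set l := x 0 with hl
  have hxy' : ∀ j, (x j - l).val ≤ (y j - l).val := fun j => by
    by_cases hj : j = i
    · subst hj; exact hi
    · rw [hxy j hj]
  obtain ⟨b, hb, hb1, hb2⟩ := h1.exists_alternate hA' hd (image_sub_one x)
    (by simpa only [sub_sub_sub_cancel_right] using hx)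
  simp only [sub_sub_sub_cancel_right, ← hl] at hb1 hb2
  have hbm : ∀ j, (b j - l).val + 1 < m := by
    intro j
    have := hb1 j
    rw [sub_sub_one_val hm] at this
    have := (b j - l).2
    split_ifs at * <;> omega
  have hb1' : ∀ j, (x j - l).val ≤ (b j - l).val := by
    intro j
    have := hb1 j
    rw [sub_sub_one_val hm, if_neg (hbm j).ne] at this
    omega
  have hb2' : ∀ j : Fin d, (b j.castSucc - l).val + 1 < (x j.succ - l).val := by
    intro j
    have := hb2 j
    rwa [sub_sub_one_val hm, if_neg (hbm _).ne] at this
  have hbmono : StrictMono fun j => (b j - l).val := Fin.strictMono_iff_lt_succ.2 fun j => by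
    have := hb2' j
    have := hb1' j.succ
    omega
  have hb0 : ∀ j, (b j - b 0).val = (b j - l).val - (b 0 - l).val := by
    intro j
    have : (b 0 - l).val ≤ (b j - l).val := hbmono.monotone (Fin.zero_le j)
    rw [← sub_sub_sub_cancel_right (b j) (b 0) l, sub_val_eq, if_pos this]
  have hY : (Finset.univ.image y).card = d + 1 := by
    rw [Finset.card_image_of_injective _ fun u v e => hy.injective (by simp [e])]
    simp
  obtain ⟨c, hc, hc1, hc2⟩ := h2.exists_alternate hY hd (a := fun j => b j - 1)
    (by rw [image_sub_one, hb]) (by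
      simp only [sub_sub_sub_cancel_right, hb0]
      intro u v huv
      have h3 := hbmono huv
      have h4 : (b 0 - l).val ≤ (b u - l).val := hbmono.monotone (Fin.zero_le u)
      simp only at h3 ⊢
      omega)
  simp only [sub_sub_sub_cancel_right] at hc1 hc2
  have hcm : ∀ j, (c j - b 0).val + 1 < m := by
    intro j
    have := hc1 j
    rw [sub_sub_one_val hm] at this
    have := (c j - b 0).2
    split_ifs at * <;> omega
  have hc1' : ∀ j, (b j - b 0).val ≤ (c j - b 0).val := by
    intro j
    have := hc1 j
    rw [sub_sub_one_val hm, if_neg (hcm j).ne] at this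
    omega
  have hc2' : ∀ j : Fin d, (c j.castSucc - b 0).val + 1 < (b j.succ - b 0).val := by
    intro j
    have := hc2 j
    rwa [sub_sub_one_val hm, if_neg (hcm _).ne] at this
  have hc0 : ∀ v : Fin m, (v - b 0).val = if (b 0 - l).val ≤ (v - l).val then
      (v - l).val - (b 0 - l).val else (v - l).val + m - (b 0 - l).val := fun v => by
    rw [← sub_sub_sub_cancel_right v (b 0) l, sub_val_eq]
  -- the elements before the last one do not wrap around
  have hlow : ∀ j : Fin d, (b j.castSucc - l).val ≤ (c j.castSucc - l).val ∧
      (c j.castSucc - l).val + 1 < (b j.succ - l).val := by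
    intro j
    have e1 := hc1' j.castSucc
    have e2 := hc2' j
    have e3 := hb0 j.castSucc
    have e4 := hb0 j.succ
    have e5 := hc0 (c j.castSucc)
    have e6 : (b 0 - l).val ≤ (b j.castSucc - l).val := hbmono.monotone (Fin.zero_le _)
    have e7 : (b 0 - l).val ≤ (b j.succ - l).val := hbmono.monotone (Fin.zero_le _)
    have e8 := (b j.succ - l).2
    split_ifs at e5 <;> omega
  have hlastc := hc0 (c (Fin.last d))
  have hlast1 := hc1' (Fin.last d)
  have hlast2 := hb0 (Fin.last d)
  have hlast3 := hcm (Fin.last d)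
  have hlast4 : (b 0 - l).val ≤ (b (Fin.last d) - l).val := hbmono.monotone (Fin.zero_le _)
  -- Only the last entry of c can wrap past the origin. If it does not, c lists y in order and x j ≤
  -- b j ≤ y j, so b agrees with x except at i. If it does, the rotated listing of y precedes b
  -- entrywise, and y intertwines with A'.
  by_cases hcase : (b 0 - l).val ≤ (c (Fin.last d) - l).val
  · left
    rw [if_pos hcase] at hlastc
    have hbc : ∀ j, (b j - l).val ≤ (c j - l).val := by
      intro j
      refine Fin.lastCases (by omega) (fun j => (hlow j).1) j
    have hcmono : StrictMono fun j => (c j - l).val := Fin.strictMono_iff_lt_succ.2 fun j => by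
      have := (hlow j).2
      have := hbc j.succ
      omega
    have hcy : (fun j => (c j - l).val) = fun j => (y j - l).val := by
      refine (hcmono.range_inj hy).1 ?_
      have := congrArg (fun s : Finset (Fin m) => (fun v => (v - l).val) '' (s : Set (Fin m))) hc
      simpa [← Set.range_comp, Function.comp_def] using this
    have hby : ∀ j, (b j - l).val ≤ (y j - l).val := fun j => by
      have this : (c j - l).val = (y j - l).val := congrFun hcy j
      rw [← this]
      exact hbc j
    refine ⟨b i, ?_, hb1' i, hby i⟩
    rw [← hb]
    congr 1
    ext1 j
    by_cases hj : j = i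
    · subst hj; simp
    · rw [Function.update_of_ne hj]
      refine (sub_val_inj (l := l)).1 (le_antisymm ?_ (hb1' j))
      rw [← hxy j hj]
      exact hby j
  · right
    rw [if_neg hcase] at hlastc
    let c' : Fin (d + 1) → Fin m := Fin.cons (c (Fin.last d)) fun j => c j.castSucc
    have hc'b : ∀ j, (c' j - l).val < (b j - l).val := by
      intro j
      refine Fin.cases ?_ (fun j => ?_) j
      · simp only [c', Fin.cons_zero]; omega
      · simp only [c', Fin.cons_succ]
        have := (hlow j).2
        omega
    have hbc' : ∀ j : Fin d, (b j.castSucc - l).val ≤ (c' j.succ - l).val := by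
      intro j
      simp only [c', Fin.cons_succ]
      exact (hlow j).1
    have hc'mono : StrictMono fun j => (c' j - l).val := Fin.strictMono_iff_lt_succ.2 fun j => by
      have := hc'b j.castSucc
      have := hbc' j
      omega
    have hc'img : Finset.univ.image c' = Finset.univ.image y := by
      rw [← hc]
      ext v
      simp only [Finset.mem_image, Finset.mem_univ, true_and]
      rw [Fin.exists_fin_succ (P := fun j => c' j = v), Fin.exists_fin_succ' (P := fun j => c j = v)]
      simp only [c', Fin.cons_zero, Fin.cons_succ]
      tauto
    have hcy : (fun j => (c' j - l).val) = fun j => (y j - l).val := by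
      refine (hc'mono.range_inj hy).1 ?_
      have := congrArg (fun s : Finset (Fin m) => (fun v => (v - l).val) '' (s : Set (Fin m))) hc'img
      simpa [← Set.range_comp, Function.comp_def] using this
    refine ⟨y, b, rfl, hb, l, fun j => ?_, fun j => ?_⟩
    · rw [Fin.lt_def]
      have this : (c' j - l).val = (y j - l).val := congrFun hcy j
      rw [← this]
      exact hc'b j
    · rw [Fin.lt_def]
      have := hb2' j
      have := hxy' j.succ
      omega

/-- Two `d`-arcs that differ in a single element are joined by an arrow, if there is no `d`-arc in
between that also differs from them only in this element. -/
theorem arrow_of_adjacent (hT : IsTriangulation (2 * d) t T) (ht : StrictMono t) (hm : 1 < m)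
    (hd : 1 ≤ d) {x y : Fin (d + 1) → Fin m} {i : Fin (d + 1)}
    (hx : StrictMono fun j => (x j - x 0).val) (hy : StrictMono fun j => (y j - x 0).val)
    (hxy : ∀ j, j ≠ i → y j = x j) (hi : (x i - x 0).val < (y i - x 0).val)
    (hyx : ∀ j : Fin d, (y j.castSucc - x 0).val + 1 < (x j.succ - x 0).val)
    (hlast : (y (Fin.last d) - x 0).val + 1 < m)
    (hX : Finset.univ.image x ∈ dArcs d t T) (hY : Finset.univ.image y ∈ dArcs d t T)
    (hbetween : ∀ w, (x i - x 0).val < (w - x 0).val → (w - x 0).val < (y i - x 0).val →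
      Finset.univ.image (Function.update x i w) ∉ dArcs d t T) :
    Arrow d t T (Finset.univ.image x) (Finset.univ.image y) := by
  have hxy' : ∀ j, (x j - x 0).val ≤ (y j - x 0).val := fun j => by
    by_cases hj : j = i
    · subst hj; exact hi.le
    · rw [hxy j hj]
  have hxi : Function.update x i (x i) = x := Function.update_eq_self _ _
  have hyi : Function.update x i (y i) = y := by
    ext1 j
    by_cases hj : j = i
    · subst hj; simp
    · rw [Function.update_of_ne hj, hxy j hj]
  refine ⟨hX, hY, fun e => ?_, intertwining_shiftDown hm hxy' hyx hlast, ?_⟩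
  · have hmem : x i ∈ Finset.univ.image y := by
      rw [← e]; exact Finset.mem_image_of_mem _ (Finset.mem_univ _)
    obtain ⟨j, -, hj⟩ := Finset.mem_image.1 hmem
    by_cases hji : j = i
    · rw [← hji, hj, hji] at hi
      exact lt_irrefl _ hi
    · rw [hxy j hji] at hj
      exact hji (hx.injective (by simp [hj]))
  · rintro ⟨A', hA', hne1, hne2, hi1, hi2⟩
    rcases eq_or_intertwining_of_between hm hd hx hy hxy hi.le hA'.1 hi1.interlace.2.2
      hi2.interlace.2.2 with ⟨w, rfl, hw1, hw2⟩ | hcross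
    · refine hbetween w (lt_of_le_of_ne hw1 fun e => hne1 ?_) (lt_of_le_of_ne hw2 fun e => hne2 ?_)
        hA'
      · rw [← sub_val_inj.1 e, hxi]
      · rw [sub_val_inj.1 e, hyi]
    -- The second alternative is a crossing of two faces of T.
    · obtain ⟨h1, h2, h3⟩ := hcross.interlace
      obtain ⟨-, ⟨S, hS, hYS⟩, -⟩ := hY
      obtain ⟨-, ⟨S', hS', hAS'⟩, -⟩ := hA'
      exact hT.not_interlace ht hd h1 h2 hS hS' hYS hAS' h3

end Arrows

/-! ### From crowded gaps to retrograde paths -/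

section MainTheorem

variable {d m : ℕ} [NeZero m] {t : Fin m → ℝ} {T : Finset (Finset (Fin m))}

theorem NonAdj.add_one_lt (hm : 1 < m) {a : Fin (d + 1) → Fin m}
    (h : NonAdj (Finset.univ.image a)) (ha : StrictMono fun j => (a j - a 0).val) :
    (∀ j : Fin d, (a j.castSucc - a 0).val + 1 < (a j.succ - a 0).val) ∧
      (a (Fin.last d) - a 0).val + 1 < m := by
  have hmem : ∀ j, a j ∈ Finset.univ.image a := fun j =>
    Finset.mem_image_of_mem _ (Finset.mem_univ _)
  have hval : ∀ v : Fin m, (v + 1 - a 0).val =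
      if (v - a 0).val + 1 = m then 0 else (v - a 0).val + 1 := fun v => by
    rw [add_sub_right_comm, add_one_val hm]
  constructor
  · intro j
    have h1 : (a j.castSucc - a 0).val < (a j.succ - a 0).val := ha Fin.castSucc_lt_succ
    have h2 : (a j.castSucc - a 0).val + 1 ≠ (a j.succ - a 0).val := by
      intro e
      have h3 := hval (a j.castSucc)
      have := (a j.succ - a 0).2
      rw [if_neg (by omega), e] at h3
      exact h _ (hmem j.castSucc) (sub_val_inj.1 h3 ▸ hmem j.succ)
    omega
  · have h1 := (a (Fin.last d) - a 0).2
    have h2 : (a (Fin.last d) - a 0).val + 1 ≠ m := by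
      intro e
      have h3 := hval (a (Fin.last d))
      rw [if_pos e] at h3
      have h4 : a (Fin.last d) + 1 = a 0 :=
        (sub_val_inj (l := a 0)).1 (h3.trans (sub_self_val _).symm)
      exact h _ (hmem (Fin.last d)) (by rw [h4]; exact hmem 0)
    omega

/-- If a gap of `A` contains two vertices of its link, then `A` is in the middle of a retrograde
path. -/
theorem exists_isRetrogradeAt_of_link (hT : IsTriangulation (2 * d) t T) (ht : StrictMono t)
    (hd : 1 ≤ d) (hm : 1 < m) {A : Finset (Fin m)} (hA : A ∈ dArcs d t T) (hnon : NonAdj A)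
    {a₀ n : Fin m} (ha₀ : a₀ ∈ A) (hn : n ∈ A) (hne : a₀ ≠ n) (hnext : ∀ c ∈ A, ¬ Cyc a₀ c n)
    {S S' : Finset (Fin m)} (hS : S ∈ T) (hS' : S' ∈ T) (hAS : A ⊆ S) (hAS' : A ⊆ S')
    {v v' : Fin m} (hv : v ∈ S) (hv' : v' ∈ S') (hcv : Cyc a₀ v n) (hcv' : Cyc a₀ v' n)
    (hlt : (v - a₀).val < (v' - a₀).val) : ∃ X Z, IsRetrogradeAt d t T X A Z := by
  classical
  obtain ⟨e, rfl⟩ : ∃ e, d = e + 1 := ⟨d - 1, by omega⟩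
  obtain ⟨a, rfl, rfl, ha⟩ := exists_listing hA.1 ha₀
  have hn1 : n = a 1 := eq_second_of_next ha hn hne hnext
  subst hn1
  set A := Finset.univ.image a with hAdef
  have hinj : Function.Injective a := fun i j h => ha.injective (by simp [h])
  have himg : ∀ i w, Finset.univ.image (Function.update a i w) = insert w (A.erase (a i)) :=
    fun i w => image_update hinj i w
  obtain ⟨hgap, hlast⟩ := hnon.add_one_lt hm ha
  -- The extremal choices leave no d-arc between the neighbours and A, which yields the arrows.
  -- Since v' and v are candidates, x ≤ v < v' ≤ y from the origin a 0.
  obtain ⟨y, hy, hymax⟩ := Finset.exists_max_image (Finset.univ.filter fun w =>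
    Cyc (a 0) w (a 1) ∧ ∃ S ∈ T, insert w (A.erase (a 1)) ⊆ S) (fun w => (w - a 0).val) ⟨v', by
      simp only [Finset.mem_filter, Finset.mem_univ, true_and]
      exact ⟨hcv', S', hS', Finset.insert_subset hv' ((Finset.erase_subset _ _).trans hAS')⟩⟩
  obtain ⟨x, hx, hxmin⟩ := Finset.exists_min_image (Finset.univ.filter fun w =>
    Cyc (a 0) w (a 1) ∧ ∃ S ∈ T, insert w (A.erase (a 0)) ⊆ S) (fun w => (w - a 0).val) ⟨v, by
      simp only [Finset.mem_filter, Finset.mem_univ, true_and]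
      exact ⟨hcv, S, hS, Finset.insert_subset hv ((Finset.erase_subset _ _).trans hAS)⟩⟩
  simp only [Finset.mem_filter, Finset.mem_univ, true_and, and_imp, forall_exists_index]
    at hx hy hxmin hymax
  have hyv := hymax v' hcv' S' hS' (Finset.insert_subset hv' ((Finset.erase_subset _ _).trans hAS'))
  have hxv := hxmin v hcv S hS (Finset.insert_subset hv ((Finset.erase_subset _ _).trans hAS))
  obtain ⟨hcy, SX, hSX, hXS⟩ := hy
  obtain ⟨hcx, SZ, hSZ, hZS⟩ := hx
  rw [cyc_sub_self_iff] at hcy hcx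
  have h0 : (a 0 - a 0).val = 0 := sub_self_val _
  have h10 : (0 : Fin (e + 1 + 1)) ≠ 1 := by simp
  have hgap0 := hgap 0
  rw [Fin.castSucc_zero, Fin.succ_zero_eq_one] at hgap0
  -- the listings of the two neighbours of `A`
  let b : Fin (e + 1 + 1) → Fin m := Function.update a 1 y
  let c : Fin (e + 1 + 1) → Fin m := Function.update a 0 x
  have hb0 : b 0 = a 0 := Function.update_of_ne h10 _ _
  have hb1 : b 1 = y := Function.update_self _ _ _
  have hbne : ∀ j, j ≠ 1 → b j = a j := fun j hj => Function.update_of_ne hj _ _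
  have hc0 : c 0 = x := Function.update_self _ _ _
  have hcne : ∀ j, j ≠ 0 → c j = a j := fun j hj => Function.update_of_ne hj _ _
  have hba : ∀ j, (b j - a 0).val ≤ (a j - a 0).val := fun j => by
    by_cases hj : j = 1
    · subst hj; rw [hb1]; exact hcy.2.le
    · rw [hbne j hj]
  have hac : ∀ j, (a j - a 0).val ≤ (c j - a 0).val := fun j => by
    by_cases hj : j = 0
    · subst hj; rw [h0]; exact Nat.zero_le _
    · rw [hcne j hj]
  have hab : ∀ j : Fin (e + 1), (a j.castSucc - a 0).val + 1 < (b j.succ - a 0).val := by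
    intro j
    by_cases hj : j.succ = 1
    · have : j = 0 := Fin.succ_injective _ (by rw [hj, Fin.succ_zero_eq_one])
      subst this
      rw [hj, hb1, Fin.castSucc_zero, h0]
      omega
    · rw [hbne _ hj]; exact hgap j
  have hca : ∀ j : Fin (e + 1), (c j.castSucc - a 0).val + 1 < (a j.succ - a 0).val := by
    intro j
    by_cases hj : j.castSucc = 0
    · have : j = 0 := Fin.castSucc_injective _ (by rw [hj, Fin.castSucc_zero])
      subst this
      rw [hj, hc0, Fin.succ_zero_eq_one]
      omega
    · rw [hcne _ hj]; exact hgap j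
  have hclast : (c (Fin.last (e + 1)) - a 0).val + 1 < m := by
    rw [hcne _ (by rw [Ne, Fin.ext_iff]; simp)]; exact hlast
  have hbmono : StrictMono fun j => (b j - a 0).val := Fin.strictMono_iff_lt_succ.2 fun j => by
    have := hba j.castSucc
    have := hab j
    omega
  have hcmono : StrictMono fun j => (c j - a 0).val := Fin.strictMono_iff_lt_succ.2 fun j => by
    have := hac j.succ
    have := hca j
    omega
  -- The new simplices are internal because each interlaces with a shifted set: X with its own
  -- shift, Z with the shift of A.
  have hXarc : Finset.univ.image b ∈ dArcs (e + 1) t T := by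
    obtain ⟨h1, h2, h3⟩ := (intertwining_shiftDown hm (x := b) (y := b) (l := a 0) (fun j => le_rfl)
      (fun j => by
        have := hba j.castSucc
        have := hab j
        omega) (by
        have := hba (Fin.last (e + 1))
        omega)).interlace
    exact h3.symm.mem_dArcs ht h2 h1 hSX (by rw [himg]; exact hXS)
  have hZarc : Finset.univ.image c ∈ dArcs (e + 1) t T := by
    obtain ⟨h1, h2, h3⟩ :=
      (intertwining_shiftDown hm (x := a) (y := c) (l := a 0) hac hca hclast).interlace
    exact h3.symm.mem_dArcs ht h2 h1 hSZ (by rw [himg]; exact hZS)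
  have hXA : Arrow (e + 1) t T (Finset.univ.image b) A := by
    refine arrow_of_adjacent hT ht hm hd (x := b) (y := a) (i := 1) (by rw [hb0]; exact hbmono)
      (by rw [hb0]; exact ha) (fun j hj => (hbne j hj).symm) (by rw [hb0, hb1]; exact hcy.2)
      (by rw [hb0]; exact hab) (by rw [hb0]; exact hlast) hXarc hA fun w hw1 hw2 hw => ?_
    rw [hb0, hb1] at hw1
    rw [hb0] at hw2
    rw [Function.update_idem, himg] at hw
    obtain ⟨-, ⟨S, hS, hwS⟩, -⟩ := hw
    have := hymax w ((cyc_sub_self_iff _ _ _).2 ⟨by omega, hw2⟩) S hS hwS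
    omega
  have hAZ : Arrow (e + 1) t T A (Finset.univ.image c) := by
    refine arrow_of_adjacent hT ht hm hd (x := a) (y := c) (i := 0) ha hcmono hcne
      (by rw [hc0, h0]; exact hcx.1) hca hclast hA hZarc fun w hw1 hw2 hw => ?_
    rw [h0] at hw1
    rw [hc0] at hw2
    rw [himg] at hw
    obtain ⟨-, ⟨S, hS, hwS⟩, -⟩ := hw
    have := hxmin w ((cyc_sub_self_iff _ _ _).2 ⟨hw1, by omega⟩) S hS hwS
    omega
  have hba' : b + Pi.single 1 (a 1 - y) = a := by
    rw [add_single_eq_update, hb1, add_sub_cancel, Function.update_idem, Function.update_eq_self]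
  have hac' : a + Pi.single (1 - 1) (x - a 0) = c := by
    rw [sub_self, add_single_eq_update, add_sub_cancel]
  -- The tuple required by the definition lists X, so the entry after a 0 is y, and the retrograde
  -- condition reads a 0 < x < y.
  refine ⟨Finset.univ.image b, Finset.univ.image c, hXA, hAZ, b, 1, a 1 - y, x - a 0,
    ⟨⟨a 0, hbmono⟩, rfl⟩, ?_, ?_, ?_⟩
  · rw [hba']; exact ⟨⟨a 0, ha⟩, rfl⟩
  · rw [hba', hac']; exact ⟨⟨a 0, hcmono⟩, rfl⟩
  · rw [sub_self, hb0, hb1, add_sub_cancel]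
    refine ⟨a 0, Fin.strictMono_iff_lt_succ.2 fun j => ?_⟩
    rw [Fin.lt_def]
    fin_cases j
    · change (a 0 - a 0).val < (x - a 0).val
      rw [h0]; exact hcx.1
    · change (x - a 0).val < (y - a 0).val
      omega

theorem isMutable_iff (hT : IsTriangulation (2 * d) t T) (ht : StrictMono t)
    (hd : 1 ≤ d) {A : Finset (Fin m)} (hA : A ∈ dArcs d t T) :
    IsMutable d t T A ↔ ¬ ∃ p, IsMaximalRetrogradePath d t T p ∧ InMiddle A p := by
  have hm : 2 * d + 1 ≤ m := by
    obtain ⟨-, ⟨S, hS, -⟩, -⟩ := hA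
    have := Finset.card_le_univ S
    rw [(hT.1 S hS).2, Fintype.card_fin] at this
    exact this
  constructor
  · rintro hmut ⟨p, hp, hAp⟩
    obtain ⟨X, Z, h⟩ := hp.exists_isRetrogradeAt hAp
    exact hmut.not_isRetrogradeAt hT ht hd (by omega) h
  · intro h
    refine isMutable_of_link hT ht hd hA ?_
    intro a ha n hn hne hnext S hS S' hS' hAS hAS' v hv v' hv' hc hc'
    have hnon := nonAdj_of_not_in_facet hd hm ht hA.1 hA.2.2
    by_contra hvv
    have hvv' : (v - a).val ≠ (v' - a).val := fun e => hvv (sub_val_inj.1 e)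
    apply h
    rcases Nat.lt_or_gt_of_ne hvv' with hlt | hlt
    · obtain ⟨X, Z, hr⟩ := exists_isRetrogradeAt_of_link hT ht hd (by omega) hA hnon ha hn hne hnext
        hS hS' hAS hAS' hv hv' hc hc' hlt
      exact hr.exists_inMiddle hT ht hd (by omega)
    · obtain ⟨X, Z, hr⟩ := exists_isRetrogradeAt_of_link hT ht hd (by omega) hA hnon ha hn hne hnext
        hS' hS hAS' hAS hv' hv hc' hc hlt
      exact hr.exists_inMiddle hT ht hd (by omega)

end MainTheorem

end CyclicPolytope

theorem theorem4p9 (n d : ℕ) (hd : 1 ≤ d) (t : Fin (n + 2 * d + 1) → ℝ) (ht : StrictMono t)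
    (T : Finset (Finset (Fin (n + 2 * d + 1))))
    (hT : CyclicPolytope.IsTriangulation (2 * d) t T)
    (A : Finset (Fin (n + 2 * d + 1))) (hA : A ∈ CyclicPolytope.dArcs d t T) :
    CyclicPolytope.IsMutable d t T A ↔
      ¬ ∃ p, CyclicPolytope.IsMaximalRetrogradePath d t T p ∧ CyclicPolytope.InMiddle A p :=
  CyclicPolytope.isMutable_iff hT ht hd hA
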